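/- Let $n\ge 4$, $1\le \ell\le n-2$, $0\le h\le \ell$ and $0\le r$ with $r+1\le n-\ell-1$. Let $I_0=\{1,\dots,n\}$ be the vertices of the Dynkin diagram of type $D_n$ with Cartan matrix $C$ (vertex $n-2$ is joined to $n-3$, $n-1$ and $n$). **Monomials.** For a Laurent monomial $m=\prod_{i\in I_0,l\in\mathbb Z}Y_{i,l}^{u_{i,l}(m)}$ let $\mathrm{wt}(m)=\sum_i\big(\sum_l u_{i,l}(m)\big)\Lambda_i$, $\varphi_{i,L}(m)=\sum_{l\le L}u_{i,l}(m)$, $\varepsilon_{i,L}(m)=-\sum_{l\ge L}u_{i,l}(m)$, $\varphi_i(m)=\max_L\varphi_{i,L}(m)$, $\varepsilon_i(m)=\max_L\varepsilon_{i,L}(m)$, $q_i(m)=\min\{L:\varphi_{i,L}(m)=\varphi_i(m)\}$, $p_i(m)=\max\{L:\varepsilon_{i,L}(m)=\varepsilon_i(m)\}$, $A_{i,l}=Y_{i,l-1}Y_{i,l+1}\prod_{j\ne i}Y_{j,l}^{C_{j,i}}$. Put $\tilde f_i m=mA_{i,q_i(m)+1}^{-1}$ if $\varphi_i(m)>0$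 and $\tilde f_im=0$ otherwise; $\tilde e_i m=mA_{i,p_i(m)-1}$ if $\varepsilon_i(m)>0$ and $\tilde e_im=0$ otherwise. **Boxes and tableaux.** Let $\mathbf B=\{1,\dots,n,\overline n,\dots,\overline 1\}$, partially ordered by $1\prec\dots\prec n-1\prec n,\overline n\prec\overline{n-1}\prec\dots\prec\overline1$, with $n,\overline n$ incomparable. For $p\in\mathbb Z$ (with $Y_{0,*}=1$) let $[i]_p=Y_{i-1,p+i}^{-1}Y_{i,p+i-1}$ and $[\overline i]_p=Y_{i-1,p+2n-2-i}Y_{i,p+2n-1-i}^{-1}$ for $i\le n-2$, $[n-1]_p=Y_{n-2,p+n-1}^{-1}Y_{n-1,p+n-2}Y_{n,p+n-2}$, $[\overline{n-1}]_p=Y_{n-2,p+n-1}Y_{n-1,p+n}^{-1}Y_{n,p+n}^{-1}$, $[n]_p=Y_{n-1,p+n}^{-1}Y_{n,p+n-2}$, $[\overline n]_p=Y_{n-1,p+n-2}Y_{n,p+n}^{-1}$. For a tableau $T=(i_1,\dots,i_\ell)\in\mathbf B^\ell$, whose two columns are $(i_1,\dots,i_h)$ and $(i_{h+1},\dots,i_\ell)$,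 put $m_T=\prod_{c\le h}[i_c]_{\ell-2c+1}\prod_{c>h}[i_c]_{\ell-2r-2c+1}$. Let $D_{\ell,h,r}$ be the set of such $T$ satisfying: (D.1) $i_1\nsucceq i_2\nsucceq\dots\nsucceq i_h$ and $i_{h+1}\nsucceq\dots\nsucceq i_\ell$; (D.2), (D.3) there are no $a<b\le h$, respectively $h+1\le a<b$, and $k$ with $i_a=k$, $i_b=\overline k$, $b-a=n-1-k$; (D.4) there are no $a\le h<b$ and $k$ with $i_a=k$, $i_b=\overline k$, $b-a=n-\max(r,1)-k$; and, if $1\le h<\ell$, (D.5) if $i_{h+1}=k\in\{1,\dots,n-1\}$ and $i_h\succeq i_{h+1}$, then $i_h=k'\in\{1,\dots,n-1\}$ and $(\overline{k'},\overline{k'-1},\dots,\overline k)=(i_{b'},i_{b'+1},\dots,i_b)$ for some $b'\le b$ with $n-r-k<b-h\le n-k-1$; (D.6) if $i_{h+1}=\overline k\in\{\overline1,\dots,\overline{n-1}\}$ and $i_h\succeq i_{h+1}$, then $i_h=\overline{k'}\in\{\overline1,\dots,\overline{n-1}\}$ and $(k',k'+1,\dots,k)=(i_{a'},\dots,i_a)$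 for some $a'\le a$ with $n-r-k\le h-a<n-k-1$; (D.7) if $i_{h+1}\in\{n,\overline n\}$, then $i_h\nsucceq i_{h+1}$. **Crystal structure.** On tableaux, $\mathrm{wt},\varepsilon_k,\varphi_k$ are those of $m_T$. If $\tilde f_km_T\ne0$, then $\tilde f_kT$ is the tableau obtained from $T$ by replacing one entry along an arrow labelled $k$ of the graph with arrows $j\xrightarrow{j}j+1$ and $\overline{j+1}\xrightarrow{j}\overline j$ for $1\le j\le n-1$, $n-1\xrightarrow{n}\overline n$ and $n\xrightarrow{n}\overline{n-1}$, such that $m_{\tilde f_kT}=\tilde f_km_T$; if this is possible at two positions $a<b$, the entry $i_a$ is replaced if $a,b$ are in the same column or $r=0$, and $i_b$ otherwise. If $\tilde f_km_T=0$, then $\tilde f_kT=0$. The operator $\tilde e_k$ is defined in the same way with reversed arrows, with $i_b$ replaced if $a,b$ are in the same column or $r=0$, and $i_a$ otherwise. **The maps.** $\sigma_{\ell,h,r}(T)$ is obtained from $T$ by performing, successively for $k=1,2,\dots,n-r-1$, the replacement of all pairs $(i_a,i_b)=(k,\overline k)$ with $a\le h<b$ and $b-a=n-r-k-1$ by $(k+1,\overline{k+1})$.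 For $s\ge1$, $\sigma'_{\ell,h,s}(T)=T$ if $s=1$, and if $s>1$ it is obtained from $T$ by performing, successively for $k=n-s,n-s-1,\dots,3$, the replacement of all pairs $(i_a,i_b)=(k,\overline k)$ with $a\le h<b$ and $b-a=n-s-k+1$ by $(k-1,\overline{k-1})$. **Proposition.** $D_{\ell,h,r}$ and $D_{\ell,h,r+1}$ (with the crystal structures for $r$ and $r+1$ respectively) are crystals of type $D_n$, and $\sigma_{\ell,h,r}$ is an isomorphism of crystals from $D_{\ell,h,r}$ to $D_{\ell,h,r+1}$, that is, a bijection that preserves $\mathrm{wt}$, $\varepsilon_k$, $\varphi_k$ and commutes with $\tilde e_k$, $\tilde f_k$ for all $k\in I_0$. Its inverse is $\sigma'_{\ell,h,r+1}$. -/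

import Mathlib

/-! ## Crystals -/

/-- The data of a crystal with index set `I` on a set `B`. Weights are given by their
coordinates on the fundamental weights, and `none` plays the role of the element `0`. -/
structure CrystalData (I B : Type) where
  wt : B → I → ℤ
  eps : I → B → ℤ
  phi : I → B → ℤ
  e : I → B → Option B
  f : I → B → Option B

namespace CrystalData

/-- The subset `S` is stable under the Kashiwara operators, and the axioms of a crystal with
Cartan matrix `C` hold on it. The simple root `α_i` has coordinates `j ↦ C j i`. -/
structure IsCrystalOn {I B : Type} (X : CrystalData I B) (C : Matrix I I ℤ) (S : Set B) :
    Prop where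
  phi_eq : ∀ i, ∀ b ∈ S, X.phi i b = X.eps i b + X.wt b i
  e_mem : ∀ i, ∀ b ∈ S, ∀ b', X.e i b = some b' → b' ∈ S
  f_mem : ∀ i, ∀ b ∈ S, ∀ b', X.f i b = some b' → b' ∈ S
  wt_e : ∀ i, ∀ b ∈ S, ∀ b', X.e i b = some b' → ∀ j, X.wt b' j = X.wt b j + C j i
  wt_f : ∀ i, ∀ b ∈ S, ∀ b', X.f i b = some b' → ∀ j, X.wt b' j = X.wt b j - C j i
  eps_e : ∀ i, ∀ b ∈ S, ∀ b', X.e i b = some b' → X.eps i b' = X.eps i b - 1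
  phi_e : ∀ i, ∀ b ∈ S, ∀ b', X.e i b = some b' → X.phi i b' = X.phi i b + 1
  eps_f : ∀ i, ∀ b ∈ S, ∀ b', X.f i b = some b' → X.eps i b' = X.eps i b + 1
  phi_f : ∀ i, ∀ b ∈ S, ∀ b', X.f i b = some b' → X.phi i b' = X.phi i b - 1
  f_iff_e : ∀ i, ∀ b ∈ S, ∀ b' ∈ S, X.f i b = some b' ↔ X.e i b' = some b

/-- `s` restricts to an isomorphism of crystals from `S` (with structure `X`) onto `S'`
(with structure `X'`): a bijection that preserves `wt`, `ε_i`, `φ_i` and commutes with the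
Kashiwara operators. -/
structure IsIsoOn {I B B' : Type} (X : CrystalData I B) (S : Set B) (X' : CrystalData I B')
    (S' : Set B') (s : B → B') : Prop where
  bijOn : Set.BijOn s S S'
  wt_eq : ∀ b ∈ S, X'.wt (s b) = X.wt b
  eps_eq : ∀ i, ∀ b ∈ S, X'.eps i (s b) = X.eps i b
  phi_eq : ∀ i, ∀ b ∈ S, X'.phi i (s b) = X.phi i b
  e_eq : ∀ i, ∀ b ∈ S, X'.e i (s b) = (X.e i b).map s
  f_eq : ∀ i, ∀ b ∈ S, X'.f i (s b) = (X.f i b).map s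

end CrystalData

namespace TypeD

/-! ## The monomial crystal of finite type `D_n`

The vertex `k` of the Dynkin diagram, `1 ≤ k ≤ n`, is the element of `Fin n` with value `k - 1`.
A Laurent monomial in the variables `Y_{k,l}` is given by its exponents, so that the product of
monomials is written as a sum. -/

abbrev Monomial (n : ℕ) : Type := Fin n × ℤ →₀ ℤ

/-- The variable `Y_{k,l}`, with `k` numbered from `1`; by convention it is the trivial monomial
if `k` is not a vertex (this occurs for `k = 0` only). -/
noncomputable def Y (n k : ℕ) (l : ℤ) : Monomial n :=
  if hk : 1 ≤ k ∧ k ≤ n then Finsupp.single (⟨k - 1, by omega⟩, l) 1 else 0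

/-- `A_{i,l} = Y_{i,l-1} Y_{i,l+1} ∏_{j ≠ i} Y_{j,l}^{C_{j,i}}`. -/
noncomputable def monA {n : ℕ} (i : Fin n) (l : ℤ) : Monomial n :=
  Finsupp.single (i, l - 1) 1 + Finsupp.single (i, l + 1) 1 +
    ∑ j ∈ Finset.univ.erase i, Finsupp.single (j, l) (CartanMatrix.D n j i)

/-- The coordinate `∑_l u_{i,l}(m)` of the weight of `m`. -/
def monWt {n : ℕ} (m : Monomial n) (i : Fin n) : ℤ :=
  ∑ x ∈ m.support with x.1 = i, m x

/-- `φ_{i,L}(m) = ∑_{l ≤ L} u_{i,l}(m)`. -/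
def monPhiAt {n : ℕ} (i : Fin n) (L : ℤ) (m : Monomial n) : ℤ :=
  ∑ x ∈ m.support with x.1 = i ∧ x.2 ≤ L, m x

/-- `ε_{i,L}(m) = - ∑_{l ≥ L} u_{i,l}(m)`. -/
def monEpsAt {n : ℕ} (i : Fin n) (L : ℤ) (m : Monomial n) : ℤ :=
  -∑ x ∈ m.support with x.1 = i ∧ L ≤ x.2, m x

noncomputable def monPhi {n : ℕ} (i : Fin n) (m : Monomial n) : ℤ := ⨆ L : ℤ, monPhiAt i L m

noncomputable def monEps {n : ℕ} (i : Fin n) (m : Monomial n) : ℤ := ⨆ L : ℤ, monEpsAt i L m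

/-- `q_i(m) = min {L | φ_{i,L}(m) = φ_i(m)}` (used only if `φ_i(m) > 0`). -/
noncomputable def monQ {n : ℕ} (i : Fin n) (m : Monomial n) : ℤ :=
  sInf {L : ℤ | monPhiAt i L m = monPhi i m}

/-- `p_i(m) = max {L | ε_{i,L}(m) = ε_i(m)}` (used only if `ε_i(m) > 0`). -/
noncomputable def monP {n : ℕ} (i : Fin n) (m : Monomial n) : ℤ :=
  sSup {L : ℤ | monEpsAt i L m = monEps i m}

noncomputable def monE {n : ℕ} (i : Fin n) (m : Monomial n) : Option (Monomial n) :=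
  if monEps i m = 0 then none else some (m + monA i (monP i m - 1))

noncomputable def monF {n : ℕ} (i : Fin n) (m : Monomial n) : Option (Monomial n) :=
  if monPhi i m = 0 then none else some (m - monA i (monQ i m + 1))

/-! ## Letters and boxes -/

/-- `plain k` is the letter `k` and `bar k` is the letter `k̄`. -/
inductive Letter : Type
  | plain (k : ℕ)
  | bar (k : ℕ)
  deriving DecidableEq

namespace Letter

/-- The letter belongs to `𝐁 = {1, …, n, n̄, …, 1̄}`. -/
def Valid (n : ℕ) : Letter → Prop
  | plain k => 1 ≤ k ∧ k ≤ n
  | bar k => 1 ≤ k ∧ k ≤ n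

/-- The partial order `x ⪯ y` on `𝐁`, in which `n` and `n̄` are not comparable. -/
def Le (n : ℕ) : Letter → Letter → Prop
  | plain i, plain j => i ≤ j
  | bar i, bar j => j ≤ i
  | plain i, bar j => ¬(i = n ∧ j = n)
  | bar _, plain _ => False

/-- The end of the arrow labelled `k` that starts at a letter, in the crystal graph of the vector
representation; a letter without such an arrow is sent to itself. -/
def next (n k : ℕ) : Letter → Letter
  | plain i =>
    if k < n ∧ i = k then plain (k + 1)
    else if k = n ∧ i + 1 = n then bar n
    else if k = n ∧ i = n then bar (n - 1)
    else plain i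
  | bar i => if k < n ∧ i = k + 1 then bar k else bar i

/-- The start of the arrow labelled `k` that ends at a letter; a letter without such an arrow is
sent to itself. -/
def prev (n k : ℕ) : Letter → Letter
  | plain i => if k < n ∧ i = k + 1 then plain k else plain i
  | bar i =>
    if k < n ∧ i = k then bar (k + 1)
    else if k = n ∧ i = n then plain (n - 1)
    else if k = n ∧ i + 1 = n then plain n
    else bar i

/-- The monomial of a box with suffix `p`, where all variables `Y_{0,*}` are set to `1`. -/
noncomputable def box (n : ℕ) (p : ℤ) : Letter → Monomial n
  | plain i =>
    if i + 2 ≤ n then -Y n (i - 1) (p + i) + Y n i (p + i - 1)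
    else if i + 1 = n then -Y n (n - 2) (p + n - 1) + Y n (n - 1) (p + n - 2) + Y n n (p + n - 2)
    else -Y n (n - 1) (p + n) + Y n n (p + n - 2)
  | bar i =>
    if i + 2 ≤ n then Y n (i - 1) (p + 2 * n - 2 - i) - Y n i (p + 2 * n - 1 - i)
    else if i + 1 = n then Y n (n - 2) (p + n - 1) - Y n (n - 1) (p + n) - Y n n (p + n)
    else Y n (n - 1) (p + n - 2) - Y n n (p + n)

end Letter

open Letter

/-! ## Tableaux -/

/-- A tableau `T = ((i_1, …, i_h), (i_{h+1}, …, i_ℓ))`. -/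
abbrev Tableau (ℓ : ℕ) : Type := Fin ℓ → Letter

/-- The position of an entry, numbered from `1`. -/
def pos {ℓ : ℕ} (a : Fin ℓ) : ℕ := a.val + 1

/-- The suffix of the box in position `a`. -/
def suffix {ℓ : ℕ} (h r : ℕ) (a : Fin ℓ) : ℤ :=
  if pos a ≤ h then (ℓ : ℤ) - 2 * pos a + 1 else (ℓ : ℤ) - 2 * r - 2 * pos a + 1

/-- The monomial `m_T`. -/
noncomputable def mon (n : ℕ) {ℓ : ℕ} (h r : ℕ) (T : Tableau ℓ) : Monomial n :=
  ∑ a, box n (suffix h r a) (T a)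

def SameColumn {ℓ : ℕ} (h : ℕ) (a b : Fin ℓ) : Prop := pos a ≤ h ↔ pos b ≤ h

def CondD1 (n : ℕ) {ℓ : ℕ} (h : ℕ) (T : Tableau ℓ) : Prop :=
  ∀ a b : Fin ℓ, pos b = pos a + 1 → SameColumn h a b → ¬Le n (T b) (T a)

def CondD2 (n : ℕ) {ℓ : ℕ} (h : ℕ) (T : Tableau ℓ) : Prop :=
  ¬∃ (a b : Fin ℓ) (k : ℕ), pos a < pos b ∧ pos b ≤ h ∧ T a = plain k ∧ T b = bar k ∧
    (pos b : ℤ) - pos a = n - 1 - k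

def CondD3 (n : ℕ) {ℓ : ℕ} (h : ℕ) (T : Tableau ℓ) : Prop :=
  ¬∃ (a b : Fin ℓ) (k : ℕ), h + 1 ≤ pos a ∧ pos a < pos b ∧ T a = plain k ∧ T b = bar k ∧
    (pos b : ℤ) - pos a = n - 1 - k

def CondD4 (n : ℕ) {ℓ : ℕ} (h r : ℕ) (T : Tableau ℓ) : Prop :=
  ¬∃ (a b : Fin ℓ) (k : ℕ), pos a ≤ h ∧ h + 1 ≤ pos b ∧ T a = plain k ∧ T b = bar k ∧
    (pos b : ℤ) - pos a = n - (max r 1 : ℕ) - k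

/-- If `i_{h+1} = k ∈ {1, …, n-1}` and `i_h ⪰ i_{h+1}`, then `i_h = k' ∈ {1, …, n-1}` and the
sequence of the barred letters from `k'` down to `k` stands in consecutive positions ending in a
position `b` with `n - r - k < b - h ≤ n - k - 1`. -/
def CondD5 (n : ℕ) {ℓ : ℕ} (h r : ℕ) (T : Tableau ℓ) : Prop :=
  ∀ x y : Fin ℓ, pos x = h → pos y = h + 1 → ∀ k : ℕ, 1 ≤ k → k < n → T y = plain k →
    Le n (T y) (T x) →
    ∃ k' : ℕ, 1 ≤ k' ∧ k' < n ∧ T x = plain k' ∧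
      ∃ b : Fin ℓ,
        (∀ j : ℕ, k ≤ j → j ≤ k' →
          ∃ c : Fin ℓ, (pos c : ℤ) = pos b - ((j : ℤ) - k) ∧ T c = bar j) ∧
        (n : ℤ) - r - k < (pos b : ℤ) - h ∧ (pos b : ℤ) - h ≤ n - k - 1

/-- If `i_{h+1}` is `k` barred, with `k ∈ {1, …, n-1}`, and `i_h ⪰ i_{h+1}`, then `i_h` is `k'`
barred, with `k' ∈ {1, …, n-1}`, and the sequence of the letters from `k'` up to `k` stands in
consecutive positions ending in a position `a` with `n - r - k ≤ h - a < n - k - 1`. -/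
def CondD6 (n : ℕ) {ℓ : ℕ} (h r : ℕ) (T : Tableau ℓ) : Prop :=
  ∀ x y : Fin ℓ, pos x = h → pos y = h + 1 → ∀ k : ℕ, 1 ≤ k → k < n → T y = bar k →
    Le n (T y) (T x) →
    ∃ k' : ℕ, 1 ≤ k' ∧ k' < n ∧ T x = bar k' ∧
      ∃ a : Fin ℓ,
        (∀ j : ℕ, k' ≤ j → j ≤ k →
          ∃ c : Fin ℓ, (pos c : ℤ) = pos a - ((k : ℤ) - j) ∧ T c = plain j) ∧
        (n : ℤ) - r - k ≤ (h : ℤ) - pos a ∧ (h : ℤ) - pos a < n - k - 1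

def CondD7 (n : ℕ) {ℓ : ℕ} (h : ℕ) (T : Tableau ℓ) : Prop :=
  ∀ x y : Fin ℓ, pos x = h → pos y = h + 1 → (T y = plain n ∨ T y = bar n) →
    ¬Le n (T y) (T x)

/-- The set `D_{ℓ,h,r}` of tableaux with entries in `𝐁` and with (D.1) to (D.7). -/
def tableauSet (n ℓ h r : ℕ) : Set (Tableau ℓ) :=
  {T | (∀ a, (T a).Valid n) ∧ CondD1 n h T ∧ CondD2 n h T ∧ CondD3 n h T ∧ CondD4 n h r T ∧
    CondD5 n h r T ∧ CondD6 n h r T ∧ CondD7 n h T}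

/-! ## The crystal structure on tableaux

It is transported from monomials along `T ↦ m_T`. The operators replace one entry along an arrow
of the vector representation. At most two entries can be used; if there are two, in positions
`a < b`, the choice between them is the one that is forced by the conditions (D.2) to (D.4). -/

open Classical in
/-- The entries `i_c` of `T` such that replacing `i_c` along the arrow labelled `k` turns `m_T`
into `f_k m_T`. -/
noncomputable def candF {n ℓ : ℕ} (h r : ℕ) (k : Fin n) (T : Tableau ℓ) : Finset (Fin ℓ) :=
  {c | monF k (mon n h r T) =
    some (mon n h r (Function.update T c ((T c).next n (k.val + 1))))}

open Classical in
/-- The entries `i_c` of `T` such that replacing `i_c` along the reversed arrow labelled `k` turns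
`m_T` into `e_k m_T`. -/
noncomputable def candE {n ℓ : ℕ} (h r : ℕ) (k : Fin n) (T : Tableau ℓ) : Finset (Fin ℓ) :=
  {c | monE k (mon n h r T) =
    some (mon n h r (Function.update T c ((T c).prev n (k.val + 1))))}

open Classical in
/-- If there are two candidates, the first one is used if they stand in the same column or if
`r = 0`, and the last one otherwise. -/
noncomputable def tabF {n ℓ : ℕ} (h r : ℕ) (k : Fin n) (T : Tableau ℓ) : Option (Tableau ℓ) :=
  if hc : (candF h r k T).Nonempty then
    let a := (candF h r k T).min' hc
    let b := (candF h r k T).max' hc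
    let c := if r = 0 ∨ SameColumn h a b then a else b
    some (Function.update T c ((T c).next n (k.val + 1)))
  else none

open Classical in
/-- If there are two candidates, the last one is used if they stand in the same column or if
`r = 0`, and the first one otherwise. -/
noncomputable def tabE {n ℓ : ℕ} (h r : ℕ) (k : Fin n) (T : Tableau ℓ) : Option (Tableau ℓ) :=
  if hc : (candE h r k T).Nonempty then
    let a := (candE h r k T).min' hc
    let b := (candE h r k T).max' hc
    let c := if r = 0 ∨ SameColumn h a b then b else a
    some (Function.update T c ((T c).prev n (k.val + 1)))
  else none

noncomputable def tableauCrystal (n ℓ h r : ℕ) : CrystalData (Fin n) (Tableau ℓ) where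
  wt T := monWt (mon n h r T)
  eps k T := monEps k (mon n h r T)
  phi k T := monPhi k (mon n h r T)
  e k T := tabE h r k T
  f k T := tabF h r k T

/-! ## The maps `σ_{ℓ,h,r}` and `σ'_{ℓ,h,r}` -/

/-- Replace every pair `(i_a, i_b)` formed by `k` and `k` barred, with `a ≤ h`, `h + 1 ≤ b` and
`b - a = d`, by the pair formed by `k'` and `k'` barred. Since `b - a` is prescribed, such pairs
are disjoint, so that the order of the replacements is immaterial. -/
def replacePairs {ℓ : ℕ} (h : ℕ) (d : ℤ) (k k' : ℕ) (T : Tableau ℓ) : Tableau ℓ := fun c =>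
  if pos c ≤ h ∧ T c = plain k ∧
      ∃ b : Fin ℓ, h + 1 ≤ pos b ∧ T b = bar k ∧ (pos b : ℤ) - pos c = d then plain k'
  else if h + 1 ≤ pos c ∧ T c = bar k ∧
      ∃ a : Fin ℓ, pos a ≤ h ∧ T a = plain k ∧ (pos c : ℤ) - pos a = d then bar k'
  else T c

/-- For `k = 1, 2, …, n - r - 1`, in this order, replace the pairs `(k, k̄)` with
`b - a = n - r - k - 1` by `(k+1)` and `(k+1)` barred. -/
def sigma (n ℓ h r : ℕ) (T : Tableau ℓ) : Tableau ℓ :=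
  (List.range' 1 (n - r - 1)).foldl
    (fun (U : Tableau ℓ) (k : ℕ) => replacePairs h ((n : ℤ) - r - k - 1) k (k + 1) U) T

/-- The identity for `r = 1`. For `r > 1` and `k = n - r, n - r - 1, …, 3`, in this order, replace
the pairs `(k, k̄)` with `b - a = n - r - k + 1` by `(k-1)` and `(k-1)` barred. -/
def sigmaInv (n ℓ h r : ℕ) (T : Tableau ℓ) : Tableau ℓ :=
  if r ≤ 1 then T
  else (List.range' 3 (n - r - 2)).reverse.foldl
    (fun (U : Tableau ℓ) (k : ℕ) => replacePairs h ((n : ℤ) - r - k + 1) k (k - 1) U) T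

end TypeD

/-! Fix a vertex `k`. The box of an entry contains at most one variable `Y_{k,*}`; its exponent is
the sign `sg`, and its second index is, up to an affine change, the location `vloc`. From the vertex
`k` the monomial `m_T` is therefore a distribution of signs on `ℤ`: `φ_k` is the maximum of its
partial sums `Phi`, and `f_k` may act on exactly those entries of sign 1 that stand where a positive
maximum is first attained (`mem_candF`). Two symmetries reduce the work. Reversing the tableau and
exchanging every letter with its barred version turns `e` into `f`, `ε` into `φ` and `h` into `ℓ -
h` (`tabE_eq`, `sigma_dual`). Exchanging `n` and `n̄` exchanges the vertices `n - 1` and `n`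
(`tabF_tau`).

For `r = 0` the conditions describe a single column of length `ℓ` (`mem_tableauSet_zero`), and the
crystal axioms are checked directly (`tabF_zero_aux`). From `r` to `r + 1` they are transported
along the isomorphism `σ` (`CrystalData.IsCrystalOn.of_isIsoOn`), so everything proceeds by
induction on `r`. For `r = 0` the map `σ` is the identity.

For `r ≥ 1`, `σ` is a reflection of lattice paths. Let `P j` count the letters `1, …, j` in the
first column and `Q j` the letters `1̄, …, j̄` in the second. For `j < n` both functions have steps
0 or 1, and they determine where these letters stand. The path `g j = j - P j - Q j` starts at 0 and
has steps in `{-1, 0, 1}`; a step `-1` is a simultaneous step of `P` and `Q`. Put `c = n - ℓ - 1 - r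
> 0`. Condition (D.4) for `r` forbids the step from `c + 1` down to `c`, and (D.4) for `r + 1`
forbids the step from `c` down to `c - 1`. Hence between the first and the last visit to the level
`c` the path stays below or on it in the first case, and above or on it in the second. Reflecting
this piece, `P' j = j - c - Q j` and `Q' j = j - c - P j` (`Seg`), exchanges the two situations. The
successive replacements in `σ` and `σ'` perform this reflection one value of `j` at a time
(`enc_sigma`, `enc_sigmaInv`), and the other conditions are seen to survive it.

For the crystal structure, first keep the shift `r`. At a vertex `k` with `k + 1 < n` the encoded
letters occupy only the locations `-P k` and `Q k + c - k`, and the reflection swaps these two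
together with their weights (`Seg.psi_eq`); the vertex `n - 1` does not feel the reflection
(`phi_last_of_seg`). So `T` and `σ T` have the same `Phi` for `r`. Changing the shift to `r + 1`
moves the second column by one location, and (D.4) for `r + 1` excludes the coincidences of opposite
signs that could spoil the first maximum (`FirstMaxPos.of_perturb`).

For the commutation with `f_k`, the distribution of signs is read backwards. Once double steps from
the level `c` are excluded, it determines the counting functions, even across an arrow
(`NoDouble.eq_of_psi_arrow`). So `σ (f_k T)` arises from `σ T` by one arrow at the same location
(`exists_update_sigma`). Finally (D.2) to (D.4) for the image show that this arrow is at the first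
possible entry (`le_of_mem_candF`), which is the one selected by the structure for `r + 1`
(`tabF_succ`). -/

/-! ## Step functions on `ℤ` -/

/-- The function `F` has a positive maximum, and `V` is the first place where it is attained. -/
def FirstMaxPos (F : ℤ → ℤ) (V : ℤ) : Prop :=
  0 < F V ∧ (∀ W, F W ≤ F V) ∧ ∀ W < V, F W < F V

theorem FirstMaxPos.unique {F : ℤ → ℤ} {V W : ℤ} (hV : FirstMaxPos F V) (hW : FirstMaxPos F W) :
    V = W := by
  rcases lt_trichotomy V W with h | h | h
  · have := hW.2.2 V h; have := hV.2.1 W; omega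
  · exact h
  · have := hV.2.2 W h; have := hW.2.1 V; omega

/-- A bounded integer function attains its maximum; if this is positive, vanishing to the left of
`lo` bounds from below the places where it is attained, so there is a first one. -/
theorem exists_firstMaxPos {F : ℤ → ℤ} (lo B : ℤ) (hlo : ∀ V < lo, F V = 0) (hB : ∀ V, F V ≤ B) :
    (∀ V, F V ≤ 0) ∨ ∃ V, FirstMaxPos F V := by
  by_cases h : ∀ V, F V ≤ 0
  · exact Or.inl h
  · push Not at h
    obtain ⟨V0, hV0⟩ := h
    obtain ⟨M, ⟨V1, hV1⟩, hM⟩ := Int.exists_greatest_of_bdd (P := fun z => ∃ V, F V = z)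
      ⟨B, fun z ⟨V, hV⟩ => hV ▸ hB V⟩ ⟨F V0, V0, rfl⟩
    obtain ⟨V, hV, hmin⟩ := Int.exists_least_of_bdd (P := fun V => F V = M)
      ⟨lo, fun V hV => by
        by_contra hlt
        have := hlo V (by omega)
        have := hM _ ⟨V0, rfl⟩
        omega⟩ ⟨V1, hV1⟩
    have h0 := hM _ ⟨V0, rfl⟩
    refine Or.inr ⟨V, by omega, fun W => ?_, fun W hW => ?_⟩
    · have := hM _ ⟨W, rfl⟩; omega
    · have h1 := hM _ ⟨W, rfl⟩
      have h2 : F W ≠ M := fun h => by have := hmin W h; omega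
      omega

namespace TypeD

open Letter

/-! ### Signs and locations of boxes -/

namespace Letter

/-- The sign with which a box contributes to the exponents of the variables `Y_{k,*}`. -/
def sg (n k : ℕ) : Letter → ℤ
  | plain i => if k < n then (if i = k then 1 else if i = k + 1 then -1 else 0)
      else if i = n ∨ i + 1 = n then 1 else 0
  | bar i => if k < n then (if i = k + 1 then 1 else if i = k then -1 else 0)
      else if i = n ∨ i + 1 = n then -1 else 0

/-- The normalized second index of the variable `Y_{k,*}` that occurs in a box. -/
def off (n k : ℕ) : Letter → ℤ
  | plain i => if k < n ∧ i = k + 1 then 1 else 0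
  | bar i => if k < n then (if i = k + 1 then n - 1 - k else n - k) else 1

/-- The vertex `k`, where `n` is identified with `n - 1`. -/
def row (n k : ℕ) : ℤ := if k < n then k else n - 1

end Letter

theorem Y_apply (n k : ℕ) (l₀ : ℤ) (i : Fin n) (l : ℤ) :
    Y n k l₀ (i, l) = if k = i.val + 1 ∧ l = l₀ then 1 else 0 := by
  have := i.isLt
  unfold Y
  split_ifs with h1 h2 h2
  · rw [Finsupp.single_apply, if_pos]
    ext <;> simp <;> omega
  · rw [Finsupp.single_apply, if_neg]
    simp only [Prod.mk.injEq, Fin.ext_iff]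
    omega
  · omega
  · rfl

/-- No box contains two variables with the same vertex, so for each `i` the exponents form a single
peak. For a fixed vertex and tableau all these indices have the same parity, which is why a location
can be normalized by halving. -/
theorem box_apply {n : ℕ} (hn : 4 ≤ n) (p : ℤ) {x : Letter} (hx : x.Valid n) (i : Fin n) (l : ℤ) :
    box n p x (i, l) =
      if l = p + 2 * off n (i.val + 1) x + row n (i.val + 1) - 1
      then sg n (i.val + 1) x else 0 := by
  have hi := i.isLt
  cases x with
  | plain j =>
    simp only [Valid] at hx
    simp only [box, off, sg, row]
    split_ifs <;> simp only [Finsupp.add_apply, Finsupp.neg_apply, Y_apply] <;>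
      split_ifs <;> omega
  | bar j =>
    simp only [Valid] at hx
    simp only [box, off, sg, row]
    split_ifs <;> simp only [Finsupp.sub_apply, Y_apply] <;>
      split_ifs <;> omega

theorem monA_apply {n : ℕ} (i : Fin n) (l₀ : ℤ) (j : Fin n) (l : ℤ) :
    monA i l₀ (j, l) = if j = i then (if l = l₀ - 1 then 1 else 0) + (if l = l₀ + 1 then 1 else 0)
      else if l = l₀ then CartanMatrix.D n j i else 0 := by
  unfold monA
  simp only [Finsupp.add_apply, Finsupp.single_apply, Finsupp.finsetSum_apply, Prod.mk.injEq]
  by_cases h : j = i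
  · subst h
    rw [Finset.sum_eq_zero]
    · simp [eq_comm]
    · intro x hx
      rw [if_neg]
      rintro ⟨rfl, -⟩
      simp at hx
  · rw [Finset.sum_eq_single j]
    · simp [h, Ne.symm h, eq_comm]
    · intro x _ hx
      simp [hx]
    · intro hx
      simp [h] at hx

theorem monA_injective {n : ℕ} (i : Fin n) {l₁ l₂ : ℤ} (h : monA i l₁ = monA i l₂) : l₁ = l₂ := by
  have h1 := DFunLike.congr_fun h (i, l₁ - 1)
  have h2 := DFunLike.congr_fun h (i, l₂ - 1)
  simp only [monA_apply, if_true] at h1 h2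
  split_ifs at h1 h2 <;> omega

theorem monA_ne_zero {n : ℕ} (i : Fin n) (l : ℤ) : monA i l ≠ 0 := by
  intro h
  have h1 := DFunLike.congr_fun h (i, l - 1)
  simp only [monA_apply, if_true, Finsupp.coe_zero, Pi.zero_apply] at h1
  split_ifs at h1 <;> omega

theorem next_valid {n k : ℕ} (hn : 4 ≤ n) (hk : 1 ≤ k) {x : Letter} (hx : x.Valid n) :
    (x.next n k).Valid n := by
  cases x <;> simp only [Valid, Letter.next] at * <;> split_ifs <;>
    omega

theorem next_eq_self {n k : ℕ} {x : Letter} (h : sg n k x ≠ 1) :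
    x.next n k = x := by
  cases x with
  | plain i =>
    simp only [sg, Letter.next] at *
    split_ifs at * <;> first | rfl | (exfalso; omega)
  | bar i =>
    simp only [sg, Letter.next] at *
    split_ifs at * <;> first | rfl | (exfalso; omega)

theorem next_cases {n k : ℕ} {x : Letter} (hkn : k ≤ n) (h : sg n k x = 1) :
    (k < n ∧ x = plain k ∧ x.next n k = plain (k + 1)) ∨
    (k < n ∧ x = bar (k + 1) ∧ x.next n k = bar k) ∨
    (k = n ∧ x = plain (n - 1) ∧ x.next n k = bar n) ∨
    (k = n ∧ x = plain n ∧ x.next n k = bar (n - 1)) := by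
  cases x <;> simp only [sg] at h <;> split_ifs at h <;> simp_all [Letter.next] <;> grind

/-- An arrow `k` turns `Y_{k,l-1}` into `Y_{k,l+1}^{-1}`: the sign flips and the normalized index
grows by one. -/
theorem sg_next {n k : ℕ} (hn : 4 ≤ n) (hkn : k ≤ n) {x : Letter} (h : sg n k x = 1) :
    sg n k (x.next n k) = -1 ∧ off n k (x.next n k) = off n k x + 1 := by
  rcases next_cases hkn h with ⟨hin, rfl, hx'⟩ | ⟨hin, rfl, hx'⟩ | ⟨hin, rfl, hx'⟩ |
    ⟨hin, rfl, hx'⟩ <;> rw [hx'] <;> clear hx' h <;> simp only [sg, off] <;>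
    constructor <;> split_ifs <;> first | omega | grind

theorem sg_sub_sg_next {n i j : ℕ} (hn : 4 ≤ n) {x : Letter} (hin : i < n) (hjn : j < n)
    (hij : j ≠ i) (h : sg n (i + 1) x = 1) :
    sg n (j + 1) x - sg n (j + 1) (x.next n (i + 1)) =
      (if j + 1 = i ∧ i + 2 < n then -1
      else if i + 1 = j ∧ j + 2 < n then -1
      else if j + 3 = n ∧ (i + 2 = n ∨ i + 1 = n) then -1
      else if i + 3 = n ∧ (j + 2 = n ∨ j + 1 = n) then -1
      else 0) := by
  rcases next_cases hin h with ⟨hin, rfl, hx'⟩ | ⟨hin, rfl, hx'⟩ | ⟨hin, rfl, hx'⟩ |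
    ⟨hin, rfl, hx'⟩ <;> rw [hx'] <;> clear hx' h <;> simp only [sg] <;> split_ifs <;> omega

theorem off_of_sg_ne {n i j : ℕ} (hn : 4 ≤ n) {x : Letter} (hin : i < n) (hjn : j < n)
    (hij : j ≠ i) (h : sg n (i + 1) x = 1)
    (hj : sg n (j + 1) x ≠ sg n (j + 1) (x.next n (i + 1))) :
    (sg n (j + 1) x ≠ 0 → 2 * off n (j + 1) x + row n (j + 1) - 1 =
      2 * off n (i + 1) x + row n (i + 1)) ∧
    (sg n (j + 1) (x.next n (i + 1)) ≠ 0 →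
      2 * off n (j + 1) (x.next n (i + 1)) + row n (j + 1) - 1 =
        2 * off n (i + 1) x + row n (i + 1)) := by
  rcases next_cases hin h with ⟨hin, rfl, hx'⟩ | ⟨hin, rfl, hx'⟩ | ⟨hin, rfl, hx'⟩ |
    ⟨hin, rfl, hx'⟩ <;> rw [hx'] at hj ⊢ <;> clear hx' h <;> simp only [sg] at hj ⊢ <;>
    simp only [off, row] <;> constructor <;> split_ifs at hj ⊢ <;> omega

theorem off_next_of_sg_eq {n i j : ℕ} (hn : 4 ≤ n) {x : Letter} (hin : i < n) (hjn : j < n)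
    (h : sg n (i + 1) x = 1) (hj : sg n (j + 1) x = sg n (j + 1) (x.next n (i + 1)))
    (h0 : sg n (j + 1) x ≠ 0) :
    off n (j + 1) x = off n (j + 1) (x.next n (i + 1)) := by
  rcases next_cases hin h with ⟨hin, rfl, hx'⟩ | ⟨hin, rfl, hx'⟩ | ⟨hin, rfl, hx'⟩ |
    ⟨hin, rfl, hx'⟩ <;> rw [hx'] at hj ⊢ <;> clear hx' h <;> simp only [sg] at hj h0 <;>
    simp only [off] <;> split_ifs at hj h0 ⊢ <;> omega

/-- At the vertex `i` the arrow removes `Y_{i,l-1}` and creates `Y_{i,l+1}^{-1}`, and `l` is the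
index of `A_{i,l}`. At another vertex either nothing changes, or every variable involved has index
`l` and the exponent changes by the Cartan entry. -/
theorem box_sub_box_next {n : ℕ} (hn : 4 ≤ n) (p : ℤ) {x : Letter} (hx : x.Valid n) (i : Fin n)
    (h : sg n (i.val + 1) x = 1) :
    box n p x - box n p (x.next n (i.val + 1)) =
      monA i (p + 2 * off n (i.val + 1) x + row n (i.val + 1)) := by
  ext ⟨j, l⟩
  rw [Finsupp.sub_apply, box_apply hn p hx, box_apply hn p (next_valid hn (by omega) hx),
    monA_apply]
  by_cases hij : j = i
  · subst hij
    obtain ⟨h1, h2⟩ := sg_next hn j.isLt h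
    rw [h, h1, h2, if_pos rfl]
    split_ifs <;> first | omega | grind
  · have hij' : j.val ≠ i.val := fun h => hij (Fin.ext h)
    have h1 := sg_sub_sg_next hn i.isLt j.isLt hij' h
    rw [if_neg hij]
    simp only [CartanMatrix.D, Matrix.of_apply, if_neg hij, if_neg (by omega : ¬n ≤ 2)]
    rw [← h1]
    by_cases hj : sg n (j.val + 1) x = sg n (j.val + 1) (x.next n (i.val + 1))
    · by_cases h0 : sg n (j.val + 1) x = 0
      · simp [← hj, h0]
      · rw [← off_next_of_sg_eq hn i.isLt j.isLt h hj h0, ← hj]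
        split_ifs <;> omega
    · obtain ⟨h2, h3⟩ := off_of_sg_ne hn i.isLt j.isLt hij' h hj
      generalize sg n (j.val + 1) x = s at *
      generalize sg n (j.val + 1) (x.next n (i.val + 1)) = s' at *
      clear h1 hj
      split_ifs <;> omega

/-! ## The statistics of the monomial of a tableau -/

/-- The row of an entry, where the second column is shifted down by `r`. -/
def shiftPos {ℓ : ℕ} (h r : ℕ) (a : Fin ℓ) : ℤ := if pos a ≤ h then pos a else pos a + r

/-- The normalized second index of the variable `Y_{k,*}` that occurs in the box of `i_a`. -/
def vloc {ℓ : ℕ} (n h r k : ℕ) (T : Tableau ℓ) (a : Fin ℓ) : ℤ := off n k (T a) - shiftPos h r a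

/-- `φ_{k,L}(m_T)` as a function of the normalized second index. -/
def Phi {ℓ : ℕ} (n h r k : ℕ) (T : Tableau ℓ) (V : ℤ) : ℤ :=
  ∑ a, if vloc n h r k T a ≤ V then sg n k (T a) else 0

theorem suffix_eq {ℓ : ℕ} (h r : ℕ) (a : Fin ℓ) : suffix h r a = ℓ - 2 * shiftPos h r a + 1 := by
  unfold suffix shiftPos; split_ifs <;> ring

theorem monPhiAt_eq_sum {n : ℕ} (i : Fin n) (L : ℤ) (m : Monomial n) :
    monPhiAt i L m = m.sum fun x u => if x.1 = i ∧ x.2 ≤ L then u else 0 := by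
  unfold monPhiAt Finsupp.sum
  rw [Finset.sum_filter]

theorem monPhiAt_sum {n : ℕ} {ι : Type*} (i : Fin n) (L : ℤ) (s : Finset ι) (m : ι → Monomial n) :
    monPhiAt i L (∑ a ∈ s, m a) = ∑ a ∈ s, monPhiAt i L (m a) := by
  simp only [monPhiAt_eq_sum]
  rw [Finsupp.sum_finsetSum_index]
  · intro x; simp
  · intro x a b; split_ifs <;> simp

theorem monPhiAt_of_apply {n : ℕ} (i : Fin n) (L l₀ w : ℤ) (m : Monomial n)
    (h : ∀ l, m (i, l) = if l = l₀ then w else 0) :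
    monPhiAt i L m = if l₀ ≤ L then w else 0 := by
  unfold monPhiAt
  have hz : ∀ x ∈ m.support.filter (fun x => x.1 = i ∧ x.2 ≤ L), x ≠ (i, l₀) → m x = 0 := by
    rintro ⟨j, l⟩ hx hne
    simp only [Finset.mem_filter] at hx
    obtain ⟨-, rfl, -⟩ := hx
    rw [h, if_neg]
    rintro rfl
    exact hne rfl
  by_cases hL : l₀ ≤ L
  · rw [if_pos hL, Finset.sum_eq_single (i, l₀) hz]
    · rw [h, if_pos rfl]
    · intro hx
      simp only [Finset.mem_filter, Finsupp.mem_support_iff, hL, and_true] at hx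
      tauto
  · rw [if_neg hL]
    refine Finset.sum_eq_zero fun x hx => hz x hx ?_
    rintro rfl
    simp only [Finset.mem_filter] at hx
    exact hL hx.2.2

/-- An entry with location `v` has its variable at index `2 v + ℓ + row`, so cutting at `L` amounts
to cutting the locations at the floor of `(L - ℓ - row) / 2`. -/
theorem monPhiAt_mon {n ℓ : ℕ} (hn : 4 ≤ n) (h r : ℕ) (i : Fin n) (L : ℤ) {T : Tableau ℓ}
    (hT : ∀ a, (T a).Valid n) :
    monPhiAt i L (mon n h r T) =
      Phi n h r (i.val + 1) T ((L - ℓ - row n (i.val + 1)) / 2) := by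
  unfold mon Phi
  rw [monPhiAt_sum]
  refine Finset.sum_congr rfl fun a _ => ?_
  rw [monPhiAt_of_apply _ _ _ _ _ (box_apply hn _ (hT a) i)]
  refine if_congr ?_ rfl rfl
  rw [suffix_eq, vloc]
  omega

theorem Phi_eq_zero_of_lt {ℓ : ℕ} (n h r k : ℕ) (T : Tableau ℓ) :
    ∃ lo, ∀ V < lo, Phi n h r k T V = 0 := by
  refine ⟨-∑ a, |vloc n h r k T a|, fun V hV => Finset.sum_eq_zero fun a _ => if_neg ?_⟩
  have h1 := Finset.single_le_sum (f := fun a => |vloc n h r k T a|) (fun _ _ => abs_nonneg _)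
    (Finset.mem_univ a)
  have h2 := neg_abs_le (vloc n h r k T a)
  omega

theorem sg_le_one (n k : ℕ) (x : Letter) : sg n k x ≤ 1 := by
  cases x <;> simp only [sg] <;> split_ifs <;> omega

theorem neg_one_le_sg (n k : ℕ) (x : Letter) : -1 ≤ sg n k x := by
  cases x <;> simp only [sg] <;> split_ifs <;> omega

theorem Phi_le {ℓ : ℕ} (n h r k : ℕ) (T : Tableau ℓ) (V : ℤ) : Phi n h r k T V ≤ ℓ := by
  unfold Phi
  calc _ ≤ ∑ a : Fin ℓ, (1 : ℤ) := Finset.sum_le_sum fun a _ => by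
        have := sg_le_one n k (T a)
        split_ifs <;> omega
    _ = ℓ := by simp

theorem Phi_nonpos_or_firstMaxPos {ℓ : ℕ} (n h r k : ℕ) (T : Tableau ℓ) :
    (∀ V, Phi n h r k T V ≤ 0) ∨ ∃ V, FirstMaxPos (Phi n h r k T) V := by
  obtain ⟨lo, hlo⟩ := Phi_eq_zero_of_lt n h r k T
  exact exists_firstMaxPos lo ℓ hlo (Phi_le n h r k T)

theorem monPhi_of_nonpos {n ℓ : ℕ} (hn : 4 ≤ n) {h r : ℕ} {i : Fin n} {T : Tableau ℓ}
    (hT : ∀ a, (T a).Valid n) (H : ∀ V, Phi n h r (i.val + 1) T V ≤ 0) :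
    monPhi i (mon n h r T) = 0 := by
  refine IsGreatest.csSup_eq ⟨?_, ?_⟩
  · obtain ⟨lo, hlo⟩ := Phi_eq_zero_of_lt n h r (i.val + 1) T
    refine ⟨2 * (lo - 1) + ℓ + row n (i.val + 1), ?_⟩
    change monPhiAt i _ _ = 0
    rw [monPhiAt_mon hn h r i _ hT]
    exact hlo _ (by omega)
  · rintro _ ⟨L, rfl⟩
    change monPhiAt i _ _ ≤ _
    rw [monPhiAt_mon hn h r i _ hT]
    exact H _

theorem monPhi_of_firstMaxPos {n ℓ : ℕ} (hn : 4 ≤ n) {h r : ℕ} {i : Fin n} {T : Tableau ℓ}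
    (hT : ∀ a, (T a).Valid n) {V : ℤ} (H : FirstMaxPos (Phi n h r (i.val + 1) T) V) :
    monPhi i (mon n h r T) = Phi n h r (i.val + 1) T V := by
  refine IsGreatest.csSup_eq ⟨⟨2 * V + ℓ + row n (i.val + 1), ?_⟩, ?_⟩
  · change monPhiAt i _ _ = _
    rw [monPhiAt_mon hn h r i _ hT]
    congr 1
    omega
  · rintro _ ⟨L, rfl⟩
    change monPhiAt i _ _ ≤ _
    rw [monPhiAt_mon hn h r i _ hT]
    exact H.2.1 _

theorem monQ_of_firstMaxPos {n ℓ : ℕ} (hn : 4 ≤ n) {h r : ℕ} {i : Fin n} {T : Tableau ℓ}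
    (hT : ∀ a, (T a).Valid n) {V : ℤ} (H : FirstMaxPos (Phi n h r (i.val + 1) T) V) :
    monQ i (mon n h r T) = 2 * V + ℓ + row n (i.val + 1) := by
  refine IsLeast.csInf_eq ⟨?_, ?_⟩
  · rw [Set.mem_ofPred_eq, monPhi_of_firstMaxPos hn hT H, monPhiAt_mon hn h r i _ hT]
    congr 1
    omega
  · intro L hL
    rw [Set.mem_ofPred_eq, monPhi_of_firstMaxPos hn hT H, monPhiAt_mon hn h r i _ hT] at hL
    by_contra hlt
    have := H.2.2 ((L - ℓ - row n (i.val + 1)) / 2) (by omega)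
    omega

theorem mon_update {n ℓ : ℕ} (h r : ℕ) (T : Tableau ℓ) (c : Fin ℓ) (y : Letter) :
    mon n h r (Function.update T c y) =
      mon n h r T - (box n (suffix h r c) (T c) - box n (suffix h r c) y) := by
  classical
  unfold mon
  rw [← Finset.add_sum_erase _ _ (Finset.mem_univ c), ← Finset.add_sum_erase _
    (fun a => box n (suffix h r a) (T a)) (Finset.mem_univ c),
    Finset.sum_congr rfl (g := fun a => box n (suffix h r a) (T a))]
  · simp only [Function.update_self]; abel
  · intro a ha
    rw [Function.update_of_ne (Finset.ne_of_mem_erase ha)]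

/-- Both `f_i` and the replacement divide `m_T` by some `A_{i,*}`, and `monA` is injective in its
index, so the two indices must agree. An entry without an outgoing arrow is left unchanged by
`next`, and then `monA` would have to vanish. -/
theorem mem_candF {n ℓ : ℕ} (hn : 4 ≤ n) {h r : ℕ} {i : Fin n} {T : Tableau ℓ}
    (hT : ∀ a, (T a).Valid n) (c : Fin ℓ) :
    c ∈ candF h r i T ↔ sg n (i.val + 1) (T c) = 1 ∧
      FirstMaxPos (Phi n h r (i.val + 1) T) (vloc n h r (i.val + 1) T c) := by
  unfold candF
  rw [Finset.mem_filter, mon_update, monF]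
  simp only [Finset.mem_univ, true_and]
  rcases Phi_nonpos_or_firstMaxPos n h r (i.val + 1) T with H | ⟨V, H⟩
  · rw [monPhi_of_nonpos hn hT H, if_pos rfl]
    refine iff_of_false (by simp) fun ⟨_, h1, _⟩ => ?_
    have := H (vloc n h r (i.val + 1) T c)
    omega
  · have h0 := H.1
    rw [monPhi_of_firstMaxPos hn hT H, if_neg (by omega), monQ_of_firstMaxPos hn hT H,
      Option.some_inj, sub_right_inj]
    by_cases hs : sg n (i.val + 1) (T c) = 1
    · rw [box_sub_box_next hn _ (hT c) i hs]
      have hv : FirstMaxPos (Phi n h r (i.val + 1) T) (vloc n h r (i.val + 1) T c) ↔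
          vloc n h r (i.val + 1) T c = V := ⟨fun h' => h'.unique H, fun h' => h' ▸ H⟩
      rw [hv, suffix_eq, vloc]
      refine ⟨fun h' => ⟨hs, ?_⟩, fun h' => ?_⟩
      · have := monA_injective i h'
        omega
      · congr 1
        omega
    · rw [next_eq_self hs, sub_self]
      exact iff_of_false (monA_ne_zero _ _) fun h' => hs h'.1

/-! ## The choice of the entry -/

theorem tabF_eq_none {n ℓ h r : ℕ} {k : Fin n} {T : Tableau ℓ} (H : ∀ c, c ∉ candF h r k T) :
    tabF h r k T = none := by
  unfold tabF
  rw [dif_neg]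
  rintro ⟨c, hc⟩
  exact H c hc

/-- The two alternatives mirror the tie rule: either `c` is the first candidate and the rule asks
for the first, or it is the last and every other candidate stands in the other column. -/
theorem tabF_eq_some {n ℓ h r : ℕ} {k : Fin n} {T : Tableau ℓ} {c : Fin ℓ} (hc : c ∈ candF h r k T)
    (H : (∀ c' ∈ candF h r k T, c ≤ c' ∧ (r = 0 ∨ SameColumn h c c')) ∨
      ∀ c' ∈ candF h r k T, c' ≤ c ∧ (c' = c ∨ (r ≠ 0 ∧ ¬SameColumn h c' c))) :
    tabF h r k T = some (Function.update T c ((T c).next n (k.val + 1))) := by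
  have hne : (candF h r k T).Nonempty := ⟨c, hc⟩
  unfold tabF
  rw [dif_pos hne]
  rcases H with H | H
  · have hmin : (candF h r k T).min' hne = c :=
      le_antisymm (Finset.min'_le _ _ hc) (Finset.le_min' _ _ _ fun c' h' => (H c' h').1)
    have hmax := (H _ (Finset.max'_mem _ hne)).2
    rw [← hmin] at hmax
    dsimp only
    rw [if_pos hmax, hmin]
  · have hmax : (candF h r k T).max' hne = c :=
      le_antisymm (Finset.max'_le _ _ _ fun c' h' => (H c' h').1) (Finset.le_max' _ _ hc)
    have hmin := (H _ (Finset.min'_mem _ hne)).2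
    dsimp only
    rcases hmin with hmin | ⟨h1, h2⟩
    · rw [hmin, hmax, ite_self]
    · rw [← hmax] at h2
      rw [if_neg (by tauto), hmax]

theorem exists_of_tabF_eq_some {n ℓ h r : ℕ} {k : Fin n} {T T' : Tableau ℓ}
    (H : tabF h r k T = some T') :
    ∃ c ∈ candF h r k T, T' = Function.update T c ((T c).next n (k.val + 1)) := by
  unfold tabF at H
  split_ifs at H with hne
  simp only [Option.some_inj] at H
  refine ⟨_, ?_, H.symm⟩
  split_ifs
  · exact Finset.min'_mem _ _
  · exact Finset.max'_mem _ _

/-! ## Duality -/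

/-- Exchange of the letters `k` and `k` barred. -/
def Letter.dual : Letter → Letter
  | plain i => bar i
  | bar i => plain i

@[simp] theorem dual_dual_letter (x : Letter) : x.dual.dual = x := by cases x <;> rfl

theorem dual_valid {n : ℕ} {x : Letter} : x.dual.Valid n ↔ x.Valid n := by cases x <;> rfl

/-- The tableau with the dual letters in the reversed order. -/
def dual {ℓ : ℕ} (T : Tableau ℓ) : Tableau ℓ := fun a => (T a.rev).dual

@[simp] theorem dual_dual {ℓ : ℕ} (T : Tableau ℓ) : dual (dual T) = T := by
  funext a; simp [dual]

theorem dual_injective {ℓ : ℕ} : Function.Injective (dual (ℓ := ℓ)) := fun S T h => by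
  rw [← dual_dual S, h, dual_dual]

theorem pos_rev {ℓ : ℕ} (a : Fin ℓ) : (pos a.rev : ℤ) = ℓ + 1 - pos a := by
  have := a.isLt
  unfold pos
  rw [Fin.val_rev]
  omega

theorem sg_dual (n k : ℕ) (x : Letter) : sg n k x.dual = -sg n k x := by
  cases x <;> simp only [sg, Letter.dual] <;> split_ifs <;> omega

theorem off_dual {n k : ℕ} {x : Letter} (h : sg n k x ≠ 0) :
    off n k x.dual = n - row n k - off n k x := by
  cases x <;> simp only [sg] at h <;> simp only [off, row, Letter.dual] <;> split_ifs at h ⊢ <;>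
    omega

theorem dual_prev {n k : ℕ} {x : Letter} (hx : x.Valid n) :
    (x.prev n k).dual = x.dual.next n k := by
  cases x <;> simp only [Valid] at hx <;> simp only [Letter.prev, Letter.dual, Letter.next] <;>
    split_ifs <;> first | rfl | omega

theorem dual_next {n k : ℕ} {x : Letter} (hx : x.Valid n) :
    (x.next n k).dual = x.dual.prev n k := by
  cases x <;> simp only [Valid] at hx <;> simp only [Letter.prev, Letter.dual, Letter.next] <;>
    split_ifs <;> first | rfl | omega

theorem dual_update {ℓ : ℕ} (T : Tableau ℓ) (c : Fin ℓ) (y : Letter) :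
    dual (Function.update T c y) = Function.update (dual T) c.rev y.dual := by
  funext a
  unfold dual
  by_cases h : a = c.rev
  · subst h; simp
  · rw [Function.update_of_ne h, Function.update_of_ne]
    rintro rfl
    simp at h

theorem shiftPos_rev {ℓ h : ℕ} (hh : h ≤ ℓ) (r : ℕ) (a : Fin ℓ) :
    shiftPos (ℓ - h) r a.rev = ℓ + 1 + r - shiftPos h r a := by
  have := pos_rev a
  unfold shiftPos
  split_ifs <;> omega

theorem sameColumn_rev {ℓ h : ℕ} (hh : h ≤ ℓ) (a b : Fin ℓ) :
    SameColumn (ℓ - h) a.rev b.rev ↔ SameColumn h a b := by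
  have := pos_rev a
  have := pos_rev b
  unfold SameColumn
  omega

/-- Two monomials are related by inverting and reflecting the variables. -/
def DualMon {n : ℕ} (K : ℤ) (m m' : Monomial n) : Prop := ∀ i l, m (i, l) = -m' (i, K - l)

theorem DualMon.symm {n : ℕ} {K : ℤ} {m m' : Monomial n} (H : DualMon K m m') : DualMon K m' m := by
  intro i l
  rw [H i (K - l)]
  simp

theorem DualMon.eq_iff {n : ℕ} {K : ℤ} {m m' p p' : Monomial n} (H : DualMon K m m')
    (H' : DualMon K p p') : m = p ↔ m' = p' := by
  constructor
  · rintro rfl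
    ext ⟨i, l⟩
    rw [H.symm i l, H'.symm i l]
  · rintro rfl
    ext ⟨i, l⟩
    rw [H i l, H' i l]

theorem DualMon.monEpsAt {n : ℕ} {K : ℤ} {m m' : Monomial n} (H : DualMon K m m') (i : Fin n)
    (L : ℤ) : monEpsAt i L m = monPhiAt i (K - L) m' := by
  unfold TypeD.monEpsAt monPhiAt
  rw [← Finset.sum_neg_distrib]
  refine Finset.sum_bij' (fun x _ => (x.1, K - x.2)) (fun x _ => (x.1, K - x.2)) ?_ ?_ ?_ ?_ ?_
  · rintro ⟨j, l⟩ hx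
    simp only [Finset.mem_filter, Finsupp.mem_support_iff] at hx ⊢
    refine ⟨fun h0 => hx.1 ?_, hx.2.1, by omega⟩
    rw [H, h0, neg_zero]
  · rintro ⟨j, l⟩ hx
    simp only [Finset.mem_filter, Finsupp.mem_support_iff] at hx ⊢
    refine ⟨fun h0 => hx.1 ?_, hx.2.1, by omega⟩
    rw [H.symm, h0, neg_zero]
  · rintro ⟨j, l⟩ _
    simp
  · rintro ⟨j, l⟩ _
    simp
  · rintro ⟨j, l⟩ _
    rw [H, neg_neg]

theorem DualMon.monEps {n : ℕ} {K : ℤ} {m m' : Monomial n} (H : DualMon K m m') (i : Fin n) :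
    monEps i m = monPhi i m' := by
  unfold TypeD.monEps monPhi
  refine (Equiv.subLeft K).iSup_congr fun L => ?_
  rw [H.monEpsAt]
  rfl

theorem DualMon.monP {n : ℕ} {K : ℤ} {m m' : Monomial n} (H : DualMon K m m') (i : Fin n)
    {q : ℤ} (hq : IsLeast {L : ℤ | monPhiAt i L m' = monPhi i m'} q) : monP i m = K - q := by
  refine IsGreatest.csSup_eq ⟨?_, ?_⟩
  · rw [Set.mem_ofPred_eq, H.monEpsAt, H.monEps, sub_sub_cancel]
    exact hq.1
  · intro L hL
    rw [Set.mem_ofPred_eq, H.monEpsAt, H.monEps] at hL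
    have := hq.2 hL
    omega

theorem monA_dual {n : ℕ} (K : ℤ) (i : Fin n) (l : ℤ) :
    DualMon K (monA i l) (-monA i (K - l)) := by
  intro j l'
  rw [Finsupp.neg_apply, neg_neg, monA_apply, monA_apply]
  split_ifs <;> omega

theorem DualMon.add {n : ℕ} {K : ℤ} {m m' p p' : Monomial n} (H : DualMon K m m')
    (H' : DualMon K p p') : DualMon K (m + p) (m' + p') := by
  intro i l
  rw [Finsupp.add_apply, Finsupp.add_apply, H, H']
  ring

/-- Reversal sends the shifted row `s` to `ℓ + 1 + r - s`, and dualizing sends `off` to `n - row -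
off`. In the second index `ℓ + row + 2 (off - s)` this is the reflection at half of `2n - 2 - 2r`.
-/
theorem mon_dual {n ℓ h : ℕ} (hn : 4 ≤ n) (hh : h ≤ ℓ) (r : ℕ) {T : Tableau ℓ}
    (hT : ∀ a, (T a).Valid n) :
    DualMon (2 * n - 2 - 2 * r) (mon n h r T) (mon n (ℓ - h) r (dual T)) := by
  intro i l
  unfold mon
  rw [Finsupp.finsetSum_apply, Finsupp.finsetSum_apply, ← Finset.sum_neg_distrib]
  refine Fintype.sum_equiv Fin.revPerm _ _ fun a => ?_
  rw [box_apply hn _ (hT a), box_apply hn _ (by rw [dual, dual_valid]; exact hT _), suffix_eq,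
    suffix_eq]
  simp only [Fin.revPerm_apply, dual, Fin.rev_rev]
  rw [shiftPos_rev hh, sg_dual]
  by_cases h0 : sg n (i.val + 1) (T a) = 0
  · simp [h0]
  · rw [off_dual h0]
    split_ifs <;> omega

theorem isLeast_monQ {n ℓ : ℕ} (hn : 4 ≤ n) {h r : ℕ} {i : Fin n} {T : Tableau ℓ}
    (hT : ∀ a, (T a).Valid n) {V : ℤ} (H : FirstMaxPos (Phi n h r (i.val + 1) T) V) :
    IsLeast {L : ℤ | monPhiAt i L (mon n h r T) = monPhi i (mon n h r T)}
      (monQ i (mon n h r T)) := by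
  rw [monQ_of_firstMaxPos hn hT H]
  constructor
  · rw [Set.mem_ofPred_eq, monPhi_of_firstMaxPos hn hT H, monPhiAt_mon hn h r i _ hT]
    congr 1
    omega
  · intro L hL
    rw [Set.mem_ofPred_eq, monPhi_of_firstMaxPos hn hT H, monPhiAt_mon hn h r i _ hT] at hL
    by_contra hlt
    have := H.2.2 ((L - ℓ - row n (i.val + 1)) / 2) (by omega)
    omega

theorem monE_dual {n ℓ h r : ℕ} (hn : 4 ≤ n) (hh : h ≤ ℓ) {i : Fin n} {T : Tableau ℓ}
    (hT : ∀ a, (T a).Valid n) {m m' : Monomial n} (hm : DualMon (2 * n - 2 - 2 * r) m m') :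
    monE i (mon n h r T) = some m ↔ monF i (mon n (ℓ - h) r (dual T)) = some m' := by
  have hT' : ∀ a, (dual T a).Valid n := fun a => by rw [dual, dual_valid]; exact hT _
  have hd := mon_dual hn hh r hT
  unfold monE monF
  rw [hd.monEps]
  rcases Phi_nonpos_or_firstMaxPos n (ℓ - h) r (i.val + 1) (dual T) with H | ⟨V, H⟩
  · rw [monPhi_of_nonpos hn hT' H, if_pos rfl, if_pos rfl]
    simp
  · have h0 := H.1
    rw [monPhi_of_firstMaxPos hn hT' H, if_neg (by omega), if_neg (by omega),
      hd.monP i (isLeast_monQ hn hT' H), Option.some_inj, Option.some_inj]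
    refine DualMon.eq_iff ?_ hm
    rw [sub_eq_add_neg (mon n (ℓ - h) r (dual T))]
    refine hd.add ?_
    rw [← sub_sub_cancel (2 * (n : ℤ) - 2 - 2 * r) (monQ i (mon n (ℓ - h) r (dual T)) + 1),
      ← sub_sub]
    exact monA_dual _ i _

theorem mem_candE {n ℓ h r : ℕ} (hn : 4 ≤ n) (hh : h ≤ ℓ) {i : Fin n} {T : Tableau ℓ}
    (hT : ∀ a, (T a).Valid n) (c : Fin ℓ) :
    c ∈ candE h r i T ↔ c.rev ∈ candF (ℓ - h) r i (dual T) := by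
  have hpv : ((T c).prev n (i.val + 1)).Valid n := by
    rw [← dual_valid, dual_prev (hT c)]
    exact next_valid hn (by omega) (dual_valid.2 (hT c))
  have hU : ∀ a, (Function.update T c ((T c).prev n (i.val + 1)) a).Valid n := by
    intro a
    by_cases ha : a = c
    · subst ha; rwa [Function.update_self]
    · rw [Function.update_of_ne ha]; exact hT a
  unfold candE candF
  simp only [Finset.mem_filter, Finset.mem_univ, true_and]
  rw [monE_dual hn hh hT (mon_dual hn hh r hU), dual_update, dual_prev (hT c)]
  simp only [dual, Fin.rev_rev]

/-- Reversal exchanges the first and the last candidate and preserves the relation of standing in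
the same column, so the tie rule for `e` is the mirror image of the one for `f`. -/
theorem tabE_eq {n ℓ h r : ℕ} (hn : 4 ≤ n) (hh : h ≤ ℓ) {i : Fin n} {T : Tableau ℓ}
    (hT : ∀ a, (T a).Valid n) :
    tabE h r i T = (tabF (ℓ - h) r i (dual T)).map dual := by
  have hmem := mem_candE (r := r) hn hh (i := i) hT
  have hupd : ∀ c, dual (Function.update (dual T) c ((dual T c).next n (i.val + 1))) =
      Function.update T c.rev ((T c.rev).prev n (i.val + 1)) := by
    intro c
    rw [dual_update, dual_dual, dual_next (by rw [dual, dual_valid]; exact hT _)]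
    simp [dual]
  by_cases hne : (candE h r i T).Nonempty
  · have hne' : (candF (ℓ - h) r i (dual T)).Nonempty := by
      obtain ⟨c, hc⟩ := hne
      exact ⟨c.rev, (hmem c).1 hc⟩
    have hmin : (candF (ℓ - h) r i (dual T)).min' hne' = ((candE h r i T).max' hne).rev := by
      refine le_antisymm (Finset.min'_le _ _ ((hmem _).1 (Finset.max'_mem _ _)))
        (Finset.le_min' _ _ _ fun c hc => ?_)
      rw [Fin.rev_le_iff]
      exact Finset.le_max' _ _ ((hmem _).2 (by rwa [Fin.rev_rev]))
    have hmax : (candF (ℓ - h) r i (dual T)).max' hne' = ((candE h r i T).min' hne).rev := by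
      refine le_antisymm (Finset.max'_le _ _ _ fun c hc => ?_)
        (Finset.le_max' _ _ ((hmem _).1 (Finset.min'_mem _ _)))
      rw [Fin.le_rev_iff]
      exact Finset.min'_le _ _ ((hmem _).2 (by rwa [Fin.rev_rev]))
    unfold tabE tabF
    rw [dif_pos hne, dif_pos hne']
    dsimp only
    rw [Option.map_some, hupd]
    have hc : SameColumn (ℓ - h) ((candF (ℓ - h) r i (dual T)).min' hne')
        ((candF (ℓ - h) r i (dual T)).max' hne') ↔
        SameColumn h ((candE h r i T).min' hne) ((candE h r i T).max' hne) := by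
      rw [hmin, hmax, sameColumn_rev hh]
      unfold SameColumn; tauto
    split_ifs with h1 h2 h2
    · rw [hmin, Fin.rev_rev]
    · rw [hc] at h2; exact absurd h1 h2
    · rw [hc] at h2; exact absurd h2 h1
    · rw [hmax, Fin.rev_rev]
  · rw [tabF_eq_none]
    · unfold tabE
      rw [dif_neg hne, Option.map_none]
    · intro c hc
      exact hne ⟨c.rev, (hmem _).2 (by rwa [Fin.rev_rev])⟩

/-! ## Duality of the tableau sets -/

theorem le_dual {n : ℕ} (x y : Letter) : Le n x.dual y.dual ↔ Le n y x := by
  cases x <;> cases y <;> simp only [Le, Letter.dual]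
  tauto

theorem dual_apply {ℓ : ℕ} (T : Tableau ℓ) (a : Fin ℓ) : dual T a = (T a.rev).dual := rfl

theorem dual_eq_plain {ℓ : ℕ} {T : Tableau ℓ} {a : Fin ℓ} {k : ℕ} :
    dual T a = plain k ↔ T a.rev = bar k := by
  rw [dual_apply]; cases T a.rev <;> simp [Letter.dual]

theorem dual_eq_bar {ℓ : ℕ} {T : Tableau ℓ} {a : Fin ℓ} {k : ℕ} :
    dual T a = bar k ↔ T a.rev = plain k := by
  rw [dual_apply]; cases T a.rev <;> simp [Letter.dual]

theorem forall_dual_valid {n ℓ : ℕ} {T : Tableau ℓ} (hT : ∀ a, (T a).Valid n) (a : Fin ℓ) :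
    (dual T a).Valid n := by rw [dual, dual_valid]; exact hT _

theorem condD1_dual {n ℓ h : ℕ} (hh : h ≤ ℓ) {T : Tableau ℓ} (H : CondD1 n h T) :
    CondD1 n (ℓ - h) (dual T) := by
  intro a b hab hc
  rw [dual_apply, dual_apply, le_dual]
  have ha := pos_rev a
  have hb := pos_rev b
  refine H b.rev a.rev (by omega) ?_
  unfold SameColumn at *
  omega

theorem condD3_dual {n ℓ h : ℕ} (hh : h ≤ ℓ) {T : Tableau ℓ} (H : CondD2 n h T) :
    CondD3 n (ℓ - h) (dual T) := by
  rintro ⟨a, b, k, h1, h2, h3, h4, h5⟩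
  have ha := pos_rev a
  have hb := pos_rev b
  exact H ⟨b.rev, a.rev, k, by omega, by omega, dual_eq_bar.1 h4, dual_eq_plain.1 h3, by omega⟩

theorem condD2_dual {n ℓ h : ℕ} (hh : h ≤ ℓ) {T : Tableau ℓ} (H : CondD3 n h T) :
    CondD2 n (ℓ - h) (dual T) := by
  rintro ⟨a, b, k, h1, h2, h3, h4, h5⟩
  have ha := pos_rev a
  have hb := pos_rev b
  exact H ⟨b.rev, a.rev, k, by omega, by omega, dual_eq_bar.1 h4, dual_eq_plain.1 h3, by omega⟩

theorem condD4_dual {n ℓ h r : ℕ} (hh : h ≤ ℓ) {T : Tableau ℓ} (H : CondD4 n h r T) :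
    CondD4 n (ℓ - h) r (dual T) := by
  rintro ⟨a, b, k, h1, h2, h3, h4, h5⟩
  have ha := pos_rev a
  have hb := pos_rev b
  exact H ⟨b.rev, a.rev, k, by omega, by omega, dual_eq_bar.1 h4, dual_eq_plain.1 h3, by omega⟩

/-- The seam is reversed, so (D.6) for `T` supplies the run of letters. Conditions (D.5) and (D.7)
are needed only to exclude the other kinds of letters at the top of the second column. -/
theorem condD5_dual {n ℓ h r : ℕ} (hh : h ≤ ℓ) {T : Tableau ℓ} (hT : ∀ a, (T a).Valid n)
    (H5 : CondD5 n h r T) (H6 : CondD6 n h r T) (H7 : CondD7 n h T) :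
    CondD5 n (ℓ - h) r (dual T) := by
  intro x y hx hy k hk1 hkn hTy hle
  rw [dual_apply, dual_apply, le_dual] at hle
  rw [dual_eq_plain] at hTy
  have hxr := pos_rev x
  have hyr := pos_rev y
  have hxv := hT x.rev
  have hy' : pos y.rev = h := by omega
  have hx' : pos x.rev = h + 1 := by omega
  cases hTx : T x.rev with
  | plain i =>
    rw [hTx] at hxv
    rcases hxv.2.lt_or_eq with hi | rfl
    · obtain ⟨k', -, -, h3, -⟩ := H5 y.rev x.rev hy' hx' i hxv.1 hi hTx hle
      simp [hTy] at h3
    · exact absurd hle (H7 y.rev x.rev hy' hx' (Or.inl hTx))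
  | bar K =>
    rw [hTx] at hxv
    rcases hxv.2.lt_or_eq with hi | rfl
    · obtain ⟨k', h1, h2, h3, a, h4, h5, h6⟩ := H6 y.rev x.rev hy' hx' K hxv.1 hi hTx hle
      rw [hTy, bar.injEq] at h3
      subst h3
      rw [hTx, hTy] at hle
      obtain ⟨c, hc1, -⟩ := h4 k le_rfl hle
      refine ⟨K, hxv.1, hi, dual_eq_plain.2 hTx, c.rev, fun j hj1 hj2 => ?_, ?_, ?_⟩
      · obtain ⟨d, hd1, hd2⟩ := h4 j hj1 hj2
        refine ⟨d.rev, ?_, dual_eq_bar.2 (by rwa [Fin.rev_rev])⟩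
        have := pos_rev d
        have := pos_rev c
        omega
      · have := pos_rev c
        omega
      · have := pos_rev c
        omega
    · exact absurd hle (H7 y.rev x.rev hy' hx' (Or.inr hTx))

theorem condD6_dual {n ℓ h r : ℕ} (hh : h ≤ ℓ) {T : Tableau ℓ} (hT : ∀ a, (T a).Valid n)
    (H5 : CondD5 n h r T) (H6 : CondD6 n h r T) (H7 : CondD7 n h T) :
    CondD6 n (ℓ - h) r (dual T) := by
  intro x y hx hy k hk1 hkn hTy hle
  rw [dual_apply, dual_apply, le_dual] at hle
  rw [dual_eq_bar] at hTy
  have hxr := pos_rev x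
  have hyr := pos_rev y
  have hxv := hT x.rev
  have hy' : pos y.rev = h := by omega
  have hx' : pos x.rev = h + 1 := by omega
  cases hTx : T x.rev with
  | plain K =>
    rw [hTx] at hxv
    rcases hxv.2.lt_or_eq with hi | rfl
    · obtain ⟨k', h1, h2, h3, a, h4, h5, h6⟩ := H5 y.rev x.rev hy' hx' K hxv.1 hi hTx hle
      rw [hTy, plain.injEq] at h3
      subst h3
      rw [hTx, hTy] at hle
      obtain ⟨c, hc1, -⟩ := h4 k hle le_rfl
      refine ⟨K, hxv.1, hi, dual_eq_bar.2 hTx, c.rev, fun j hj1 hj2 => ?_, ?_, ?_⟩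
      · obtain ⟨d, hd1, hd2⟩ := h4 j hj1 hj2
        refine ⟨d.rev, ?_, dual_eq_plain.2 (by rwa [Fin.rev_rev])⟩
        have := pos_rev d
        have := pos_rev c
        omega
      · have := pos_rev c
        omega
      · have := pos_rev c
        omega
    · exact absurd hle (H7 y.rev x.rev hy' hx' (Or.inl hTx))
  | bar i =>
    rw [hTx] at hxv
    rcases hxv.2.lt_or_eq with hi | rfl
    · obtain ⟨k', -, -, h3, -⟩ := H6 y.rev x.rev hy' hx' i hxv.1 hi hTx hle
      simp [hTy] at h3
    · exact absurd hle (H7 y.rev x.rev hy' hx' (Or.inr hTx))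

theorem condD7_dual {n ℓ h r : ℕ} (hh : h ≤ ℓ) {T : Tableau ℓ} (hT : ∀ a, (T a).Valid n)
    (H5 : CondD5 n h r T) (H6 : CondD6 n h r T) (H7 : CondD7 n h T) :
    CondD7 n (ℓ - h) (dual T) := by
  intro x y hx hy hTy hle
  rw [dual_apply, dual_apply, le_dual] at hle
  rw [dual_eq_plain, dual_eq_bar] at hTy
  have hxr := pos_rev x
  have hyr := pos_rev y
  have hxv := hT x.rev
  have hy' : pos y.rev = h := by omega
  have hx' : pos x.rev = h + 1 := by omega
  cases hTx : T x.rev with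
  | plain K =>
    rw [hTx] at hxv
    rcases hxv.2.lt_or_eq with hi | rfl
    · obtain ⟨k', -, h2, h3, -⟩ := H5 y.rev x.rev hy' hx' K hxv.1 hi hTx hle
      rw [h3] at hTy
      simp at hTy
      omega
    · exact H7 y.rev x.rev hy' hx' (Or.inl hTx) hle
  | bar i =>
    rw [hTx] at hxv
    rcases hxv.2.lt_or_eq with hi | rfl
    · obtain ⟨k', -, h2, h3, -⟩ := H6 y.rev x.rev hy' hx' i hxv.1 hi hTx hle
      rw [h3] at hTy
      simp at hTy
      omega
    · exact H7 y.rev x.rev hy' hx' (Or.inr hTx) hle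

theorem dual_mem {n ℓ h r : ℕ} (hh : h ≤ ℓ) {T : Tableau ℓ} (hT : T ∈ tableauSet n ℓ h r) :
    dual T ∈ tableauSet n ℓ (ℓ - h) r := by
  obtain ⟨h0, h1, h2, h3, h4, h5, h6, h7⟩ := hT
  exact ⟨forall_dual_valid h0, condD1_dual hh h1, condD2_dual hh h3, condD3_dual hh h2,
    condD4_dual hh h4, condD5_dual hh h0 h5 h6 h7, condD6_dual hh h0 h5 h6 h7,
    condD7_dual hh h0 h5 h6 h7⟩

theorem replacePairs_dual {ℓ h : ℕ} (hh : h ≤ ℓ) (d : ℤ) (k k' : ℕ) (T : Tableau ℓ) :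
    replacePairs (ℓ - h) d k k' (dual T) = dual (replacePairs h d k k' T) := by
  funext c
  have hc := pos_rev c
  have hcl := c.isLt
  rw [dual_apply]
  unfold replacePairs
  have e1 : (pos c ≤ ℓ - h ∧ dual T c = plain k ∧
      ∃ b : Fin ℓ, ℓ - h + 1 ≤ pos b ∧ dual T b = bar k ∧ (pos b : ℤ) - pos c = d) ↔
      (h + 1 ≤ pos c.rev ∧ T c.rev = bar k ∧
        ∃ a : Fin ℓ, pos a ≤ h ∧ T a = plain k ∧ (pos c.rev : ℤ) - pos a = d) := by
    rw [dual_eq_plain]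
    refine and_congr (by omega) (and_congr Iff.rfl ?_)
    constructor
    · rintro ⟨b, h1, h2, h3⟩
      have hb := pos_rev b
      exact ⟨b.rev, by omega, dual_eq_bar.1 h2, by omega⟩
    · rintro ⟨b, h1, h2, h3⟩
      have hb := pos_rev b
      exact ⟨b.rev, by omega, dual_eq_bar.2 (by rwa [Fin.rev_rev]), by omega⟩
  have e2 : (ℓ - h + 1 ≤ pos c ∧ dual T c = bar k ∧
      ∃ a : Fin ℓ, pos a ≤ ℓ - h ∧ dual T a = plain k ∧ (pos c : ℤ) - pos a = d) ↔
      (pos c.rev ≤ h ∧ T c.rev = plain k ∧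
        ∃ b : Fin ℓ, h + 1 ≤ pos b ∧ T b = bar k ∧ (pos b : ℤ) - pos c.rev = d) := by
    rw [dual_eq_bar]
    refine and_congr (by omega) (and_congr Iff.rfl ?_)
    constructor
    · rintro ⟨b, h1, h2, h3⟩
      have hb := pos_rev b
      exact ⟨b.rev, by omega, dual_eq_plain.1 h2, by omega⟩
    · rintro ⟨b, h1, h2, h3⟩
      have hb := pos_rev b
      exact ⟨b.rev, by omega, dual_eq_plain.2 (by rwa [Fin.rev_rev]), by omega⟩
  simp only [e1, e2]
  split_ifs with h1 h2 h2
  · omega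
  · rfl
  · rfl
  · rfl

theorem sigma_dual {n ℓ h : ℕ} (hh : h ≤ ℓ) (r : ℕ) (T : Tableau ℓ) :
    sigma n ℓ (ℓ - h) r (dual T) = dual (sigma n ℓ h r T) := by
  unfold sigma
  induction List.range' 1 (n - r - 1) generalizing T with
  | nil => rfl
  | cons k L ih => rw [List.foldl_cons, List.foldl_cons, replacePairs_dual hh, ih]

open Classical in
/-- The choice among the possible positions for the operator `f_k`. -/
noncomputable def pick {ℓ : ℕ} (h r : ℕ) (s : Finset (Fin ℓ)) : Option (Fin ℓ) :=
  if hs : s.Nonempty then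
    some (if r = 0 ∨ SameColumn h (s.min' hs) (s.max' hs) then s.min' hs else s.max' hs)
  else none

theorem tabF_eq_map_pick {n ℓ : ℕ} (h r : ℕ) (k : Fin n) (T : Tableau ℓ) :
    tabF h r k T = (pick h r (candF h r k T)).map
      fun c => Function.update T c ((T c).next n (k.val + 1)) := by
  unfold tabF pick
  by_cases hs : (candF h r k T).Nonempty
  · rw [dif_pos hs, dif_pos hs]
    rfl
  · rw [dif_neg hs, dif_neg hs]
    rfl

/-! ## The symmetry between the vertices `n - 1` and `n` -/

/-- Exchange of the letters `n` and `n` barred. -/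
def Letter.tau (n : ℕ) : Letter → Letter
  | plain i => if i = n then bar n else plain i
  | bar i => if i = n then plain n else bar i

/-- Exchange of the letters `n` and `n` barred in a tableau. -/
def tau {ℓ : ℕ} (n : ℕ) (T : Tableau ℓ) : Tableau ℓ := fun a => (T a).tau n

@[simp] theorem tau_tau_letter (n : ℕ) (x : Letter) : (x.tau n).tau n = x := by
  cases x <;> simp only [Letter.tau] <;> split_ifs with h <;> simp [h]

@[simp] theorem tau_tau {ℓ : ℕ} (n : ℕ) (T : Tableau ℓ) : tau n (tau n T) = T := by
  funext a; simp [tau]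

theorem tau_apply {ℓ : ℕ} (n : ℕ) (T : Tableau ℓ) (a : Fin ℓ) : tau n T a = (T a).tau n := rfl

theorem tau_valid {n : ℕ} {x : Letter} : (x.tau n).Valid n ↔ x.Valid n := by
  cases x <;> simp only [Letter.tau] <;> split_ifs with h <;> simp [Valid, h]

theorem tau_eq_plain {n k : ℕ} (hk : k < n) (x : Letter) : x.tau n = plain k ↔ x = plain k := by
  cases x <;> simp only [Letter.tau] <;> split_ifs with h <;> simp <;> omega

theorem tau_eq_bar {n k : ℕ} (hk : k < n) (x : Letter) : x.tau n = bar k ↔ x = bar k := by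
  cases x <;> simp only [Letter.tau] <;> split_ifs with h <;> simp <;> omega

theorem le_tau {n : ℕ} {x y : Letter} (hx : x.Valid n) (hy : y.Valid n) :
    Le n (x.tau n) (y.tau n) ↔ Le n x y := by
  cases x <;> cases y <;> simp only [Valid] at hx hy <;> simp only [Letter.tau] <;>
    split_ifs <;> simp only [Le] <;> grind

theorem sg_tau {n : ℕ} (hn : 4 ≤ n) (x : Letter) : sg n (n - 1) (x.tau n) = sg n n x := by
  cases x <;> simp only [Letter.tau, sg] <;> split_ifs <;> grind

theorem off_tau {n : ℕ} (hn : 4 ≤ n) {x : Letter} (h : sg n n x ≠ 0) :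
    off n (n - 1) (x.tau n) = off n n x := by
  cases x <;> simp only [sg] at h <;> simp only [Letter.tau, off] <;> split_ifs at h ⊢ <;>
    grind

theorem next_tau {n : ℕ} (hn : 4 ≤ n) {x : Letter} (hx : x.Valid n) :
    (x.tau n).next n (n - 1) = (x.next n n).tau n := by
  cases x <;> simp only [Valid] at hx <;> simp only [Letter.tau, Letter.next] <;> split_ifs <;>
    grind

theorem tau_update {ℓ : ℕ} (n : ℕ) (T : Tableau ℓ) (c : Fin ℓ) (y : Letter) :
    tau n (Function.update T c y) = Function.update (tau n T) c (y.tau n) := by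
  funext a
  unfold tau
  by_cases h : a = c
  · subst h; simp
  · rw [Function.update_of_ne h, Function.update_of_ne h]

theorem Phi_tau {n ℓ : ℕ} (hn : 4 ≤ n) (h r : ℕ) (T : Tableau ℓ) :
    Phi n h r (n - 1) (tau n T) = Phi n h r n T := by
  funext V
  unfold Phi
  refine Finset.sum_congr rfl fun a _ => ?_
  unfold vloc
  rw [tau_apply, sg_tau hn]
  by_cases h0 : sg n n (T a) = 0
  · simp [h0]
  · rw [off_tau hn h0]

theorem forall_tau_valid {n ℓ : ℕ} {T : Tableau ℓ} (hT : ∀ a, (T a).Valid n) (a : Fin ℓ) :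
    (tau n T a).Valid n := by rw [tau_apply, tau_valid]; exact hT _

theorem candF_tau {n ℓ h r : ℕ} (hn : 4 ≤ n) {i j : Fin n} (hi : i.val + 2 = n)
    (hj : j.val + 1 = n) {T : Tableau ℓ} (hT : ∀ a, (T a).Valid n) :
    candF h r i (tau n T) = candF h r j T := by
  ext c
  rw [mem_candF hn (forall_tau_valid hT), mem_candF hn hT, hj, (by omega : i.val + 1 = n - 1),
    Phi_tau hn, tau_apply, sg_tau hn, vloc, vloc, tau_apply]
  refine and_congr_right fun h1 => ?_
  rw [off_tau hn (by omega)]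

theorem tabF_tau {n ℓ h r : ℕ} (hn : 4 ≤ n) {i j : Fin n} (hi : i.val + 2 = n)
    (hj : j.val + 1 = n) {T : Tableau ℓ} (hT : ∀ a, (T a).Valid n) :
    tabF h r i (tau n T) = (tabF h r j T).map (tau n) := by
  have hc := candF_tau (h := h) (r := r) hn hi hj hT
  have hu : ∀ c, tau n (Function.update T c ((T c).next n (j.val + 1))) =
      Function.update (tau n T) c ((tau n T c).next n (i.val + 1)) := by
    intro c
    rw [tau_update, hj, (by omega : i.val + 1 = n - 1), tau_apply, next_tau hn (hT c)]
  rw [tabF_eq_map_pick, tabF_eq_map_pick, hc, Option.map_map]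
  congr 1
  funext c
  exact (hu c).symm

theorem monPhi_tau {n ℓ h r : ℕ} (hn : 4 ≤ n) {i j : Fin n} (hi : i.val + 2 = n)
    (hj : j.val + 1 = n) {T : Tableau ℓ} (hT : ∀ a, (T a).Valid n) :
    monPhi i (mon n h r (tau n T)) = monPhi j (mon n h r T) := by
  have hP : Phi n h r (i.val + 1) (tau n T) = Phi n h r (j.val + 1) T := by
    rw [hj, (by omega : i.val + 1 = n - 1), Phi_tau hn]
  rcases Phi_nonpos_or_firstMaxPos n h r (j.val + 1) T with H | ⟨V, H⟩
  · rw [monPhi_of_nonpos hn hT H, monPhi_of_nonpos hn (forall_tau_valid hT) (by rwa [hP])]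
  · rw [monPhi_of_firstMaxPos hn hT H,
      monPhi_of_firstMaxPos hn (forall_tau_valid hT) (by rwa [hP]), hP]

theorem tau_mem {n ℓ h r : ℕ} {T : Tableau ℓ} (hT : T ∈ tableauSet n ℓ h r) :
    tau n T ∈ tableauSet n ℓ h r := by
  obtain ⟨h0, h1, h2, h3, h4, h5, h6, h7⟩ := hT
  refine ⟨forall_tau_valid h0, fun a b hab hc => ?_, ?_, ?_, ?_, ?_, ?_, ?_⟩
  · rw [tau_apply, tau_apply, le_tau (h0 _) (h0 _)]
    exact h1 a b hab hc
  · rintro ⟨a, b, k, e1, e2, e3, e4, e5⟩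
    -- The prescribed distance is positive, so a forbidden pair never involves the letters `n`,
    -- `n̄`, which are the only ones moved by `tau`.
    have hk : k < n := by omega
    exact h2 ⟨a, b, k, e1, e2, (tau_eq_plain hk _).1 e3, (tau_eq_bar hk _).1 e4, e5⟩
  · rintro ⟨a, b, k, e1, e2, e3, e4, e5⟩
    have hk : k < n := by omega
    exact h3 ⟨a, b, k, e1, e2, (tau_eq_plain hk _).1 e3, (tau_eq_bar hk _).1 e4, e5⟩
  · rintro ⟨a, b, k, e1, e2, e3, e4, e5⟩
    have hk : k < n := by omega
    exact h4 ⟨a, b, k, e1, e2, (tau_eq_plain hk _).1 e3, (tau_eq_bar hk _).1 e4, e5⟩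
  · intro x y hx hy k hk hkn hy' hle
    rw [tau_apply, tau_apply, le_tau (h0 _) (h0 _)] at hle
    obtain ⟨k', e1, e2, e3, b, e4, e5⟩ := h5 x y hx hy k hk hkn ((tau_eq_plain hkn _).1 hy') hle
    refine ⟨k', e1, e2, (tau_eq_plain e2 _).2 e3, b, fun j hj1 hj2 => ?_, e5⟩
    obtain ⟨c, hc1, hc2⟩ := e4 j hj1 hj2
    exact ⟨c, hc1, (tau_eq_bar (by omega) _).2 hc2⟩
  · intro x y hx hy k hk hkn hy' hle
    rw [tau_apply, tau_apply, le_tau (h0 _) (h0 _)] at hle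
    obtain ⟨k', e1, e2, e3, b, e4, e5⟩ := h6 x y hx hy k hk hkn ((tau_eq_bar hkn _).1 hy') hle
    refine ⟨k', e1, e2, (tau_eq_bar e2 _).2 e3, b, fun j hj1 hj2 => ?_, e5⟩
    obtain ⟨c, hc1, hc2⟩ := e4 j hj1 hj2
    exact ⟨c, hc1, (tau_eq_plain (by omega) _).2 hc2⟩
  · intro x y hx hy hy' hle
    rw [tau_apply, tau_apply, le_tau (h0 _) (h0 _)] at hle
    refine h7 x y hx hy ?_ hle
    have hv := h0 y
    rw [tau_apply] at hy'
    cases hTy : T y <;> rw [hTy] at hy' <;> simp only [Letter.tau] at hy' <;> split_ifs at hy' <;>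
      simp_all

theorem tau_mem_iff {n ℓ h r : ℕ} {T : Tableau ℓ} :
    tau n T ∈ tableauSet n ℓ h r ↔ T ∈ tableauSet n ℓ h r :=
  ⟨fun H => by simpa using tau_mem H, fun H => tau_mem H⟩

theorem replacePairs_tau {n ℓ : ℕ} (h : ℕ) (d : ℤ) {k k' : ℕ} (hk : k < n) (hk' : k' < n)
    (T : Tableau ℓ) : replacePairs h d k k' (tau n T) = tau n (replacePairs h d k k' T) := by
  funext c
  unfold replacePairs
  simp only [tau_apply, tau_eq_plain hk, tau_eq_bar hk]
  split_ifs <;> simp only [Letter.tau, if_neg hk'.ne]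

/-- The steps of `sigma` create letters `k + 1 ≤ n - r`. For `r ≥ 1` neither `n` nor `n̄` takes
part, so `tau` commutes with each step. -/
theorem sigma_tau {n ℓ h r : ℕ} (hr : 1 ≤ r) (T : Tableau ℓ) :
    sigma n ℓ h r (tau n T) = tau n (sigma n ℓ h r T) := by
  unfold sigma
  have : ∀ k ∈ List.range' 1 (n - r - 1), k + 1 < n := by
    intro k hk
    rw [List.mem_range'_1] at hk
    omega
  generalize List.range' 1 (n - r - 1) = L at this ⊢
  induction L generalizing T with
  | nil => rfl
  | cons k L ih =>
    have hk := this k List.mem_cons_self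
    rw [List.foldl_cons, List.foldl_cons, replacePairs_tau h _ (by omega) hk,
      ih _ (fun j hj => this j (List.mem_cons_of_mem _ hj))]

/-! ## Crystal axioms -/

theorem monWt_eq_sum {n : ℕ} (m : Monomial n) (i : Fin n) :
    monWt m i = m.sum fun x u => if x.1 = i then u else 0 := by
  unfold monWt Finsupp.sum
  rw [Finset.sum_filter]

theorem monWt_add {n : ℕ} (m m' : Monomial n) (i : Fin n) :
    monWt (m + m') i = monWt m i + monWt m' i := by
  simp only [monWt_eq_sum]
  rw [Finsupp.sum_add_index']
  · intro x; simp
  · intro x a b; split_ifs <;> simp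

theorem monWt_single {n : ℕ} (x : Fin n × ℤ) (u : ℤ) (i : Fin n) :
    monWt (Finsupp.single x u) i = if x.1 = i then u else 0 := by
  rw [monWt_eq_sum, Finsupp.sum_single_index]
  simp

theorem monWt_sum {n : ℕ} {ι : Type*} (s : Finset ι) (m : ι → Monomial n) (i : Fin n) :
    monWt (∑ a ∈ s, m a) i = ∑ a ∈ s, monWt (m a) i := by
  simp only [monWt_eq_sum]
  rw [Finsupp.sum_finsetSum_index]
  · intro x; simp
  · intro x a b; split_ifs <;> simp

theorem monWt_monA {n : ℕ} (i : Fin n) (l : ℤ) (j : Fin n) :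
    monWt (monA i l) j = CartanMatrix.D n j i := by
  unfold monA
  rw [monWt_add, monWt_add, monWt_single, monWt_single, monWt_sum]
  simp only [monWt_single]
  by_cases h : i = j
  · subst h
    rw [Finset.sum_eq_zero fun x hx => if_neg (Finset.ne_of_mem_erase hx)]
    simp [CartanMatrix.D]
  · rw [Finset.sum_eq_single j (fun x _ hx => if_neg hx)
      (fun hj => absurd (Finset.mem_erase.2 ⟨Ne.symm h, Finset.mem_univ _⟩) hj)]
    simp [h]

/-- The exponents up to `L - 1` and those from `L` on add up to the weight. Taking maxima gives `φ =
ε + wt`. -/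
theorem monEpsAt_eq {n : ℕ} (i : Fin n) (L : ℤ) (m : Monomial n) :
    monEpsAt i L m = monPhiAt i (L - 1) m - monWt m i := by
  rw [monWt_eq_sum, monPhiAt_eq_sum]
  unfold monEpsAt Finsupp.sum
  rw [Finset.sum_filter, ← Finset.sum_sub_distrib, ← Finset.sum_neg_distrib]
  refine Finset.sum_congr rfl fun x _ => ?_
  by_cases h : x.1 = i <;> simp only [h, true_and, false_and, if_true, if_false, neg_zero, sub_zero]
  split_ifs <;> omega

theorem isGreatest_monPhi {n ℓ : ℕ} (hn : 4 ≤ n) (h r : ℕ) (i : Fin n) {T : Tableau ℓ}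
    (hT : ∀ a, (T a).Valid n) :
    IsGreatest (Set.range fun L => monPhiAt i L (mon n h r T)) (monPhi i (mon n h r T)) := by
  have key : ∃ M, IsGreatest (Set.range fun L => monPhiAt i L (mon n h r T)) M := by
    rcases Phi_nonpos_or_firstMaxPos n h r (i.val + 1) T with H | ⟨V, H⟩
    · obtain ⟨lo, hlo⟩ := Phi_eq_zero_of_lt n h r (i.val + 1) T
      refine ⟨0, ⟨2 * (lo - 1) + ℓ + row n (i.val + 1), ?_⟩, ?_⟩
      · change monPhiAt i _ _ = 0
        rw [monPhiAt_mon hn h r i _ hT]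
        exact hlo _ (by omega)
      · rintro _ ⟨L, rfl⟩
        change monPhiAt i _ _ ≤ _
        rw [monPhiAt_mon hn h r i _ hT]
        exact H _
    · refine ⟨_, ⟨2 * V + ℓ + row n (i.val + 1), rfl⟩, ?_⟩
      rintro _ ⟨L, rfl⟩
      change monPhiAt i _ _ ≤ monPhiAt i _ _
      rw [monPhiAt_mon hn h r i _ hT, monPhiAt_mon hn h r i _ hT]
      refine (H.2.1 _).trans (le_of_eq ?_)
      congr 1
      omega
  obtain ⟨M, hM⟩ := key
  have : monPhi i (mon n h r T) = M := hM.csSup_eq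
  rwa [this]

theorem monPhi_eq_iff {n ℓ : ℕ} (hn : 4 ≤ n) (h r : ℕ) (i : Fin n) {T : Tableau ℓ}
    (hT : ∀ a, (T a).Valid n) {M : ℤ} : monPhi i (mon n h r T) = M ↔
      (∀ V, Phi n h r (i.val + 1) T V ≤ M) ∧ ∃ V, Phi n h r (i.val + 1) T V = M := by
  have hG := isGreatest_monPhi hn h r i hT
  have h1 : ∀ V, Phi n h r (i.val + 1) T V ≤ monPhi i (mon n h r T) := by
    intro V
    refine le_trans (le_of_eq ?_) (hG.2 ⟨2 * V + ℓ + row n (i.val + 1), rfl⟩)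
    change _ = monPhiAt i _ _
    rw [monPhiAt_mon hn h r i _ hT]
    congr 1
    omega
  have h2 : ∃ V, Phi n h r (i.val + 1) T V = monPhi i (mon n h r T) := by
    obtain ⟨L, hL⟩ := hG.1
    change monPhiAt i _ _ = _ at hL
    rw [monPhiAt_mon hn h r i _ hT] at hL
    exact ⟨_, hL⟩
  constructor
  · rintro rfl
    exact ⟨h1, h2⟩
  · rintro ⟨h3, V, h4⟩
    obtain ⟨W, hW⟩ := h2
    have := h1 V
    have := h3 W
    omega

theorem monPhi_eq_eps_add_wt {n ℓ : ℕ} (hn : 4 ≤ n) (h r : ℕ) (i : Fin n) {T : Tableau ℓ}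
    (hT : ∀ a, (T a).Valid n) :
    monPhi i (mon n h r T) = monEps i (mon n h r T) + monWt (mon n h r T) i := by
  have hG := isGreatest_monPhi hn h r i hT
  have : monEps i (mon n h r T) = monPhi i (mon n h r T) - monWt (mon n h r T) i := by
    refine IsGreatest.csSup_eq ⟨?_, ?_⟩
    · obtain ⟨L, hL⟩ := hG.1
      refine ⟨L + 1, ?_⟩
      change monPhiAt i _ _ = _ at hL
      change monEpsAt i _ _ = _
      rw [monEpsAt_eq, add_sub_cancel_right, hL]
    · rintro _ ⟨L, rfl⟩
      change monEpsAt i _ _ ≤ _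
      rw [monEpsAt_eq]
      have := hG.2 ⟨L - 1, rfl⟩
      change monPhiAt i _ _ ≤ _ at this
      omega
  omega

theorem monEps_eq_monPhi_dual {n ℓ h : ℕ} (hn : 4 ≤ n) (hh : h ≤ ℓ) (r : ℕ) (i : Fin n)
    {T : Tableau ℓ} (hT : ∀ a, (T a).Valid n) :
    monEps i (mon n h r T) = monPhi i (mon n (ℓ - h) r (dual T)) :=
  (mon_dual hn hh r hT).monEps i

theorem update_valid {n ℓ : ℕ} {T : Tableau ℓ} (hT : ∀ a, (T a).Valid n) {c : Fin ℓ} {y : Letter}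
    (hy : y.Valid n) (a : Fin ℓ) : (Function.update T c y a).Valid n := by
  by_cases ha : a = c
  · subst ha; rwa [Function.update_self]
  · rw [Function.update_of_ne ha]; exact hT a

theorem Phi_update {ℓ : ℕ} (n h r k : ℕ) (T : Tableau ℓ) (c : Fin ℓ) (y : Letter) (V : ℤ) :
    Phi n h r k (Function.update T c y) V = Phi n h r k T V -
      (if vloc n h r k T c ≤ V then sg n k (T c) else 0) +
      (if off n k y - shiftPos h r c ≤ V then sg n k y else 0) := by
  unfold Phi
  rw [← Finset.add_sum_erase _ _ (Finset.mem_univ c), ← Finset.add_sum_erase _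
    (fun a => if vloc n h r k T a ≤ V then sg n k (T a) else 0) (Finset.mem_univ c),
    Finset.sum_congr rfl (g := fun a => if vloc n h r k T a ≤ V then sg n k (T a) else 0)]
  · simp only [vloc, Function.update_self]
    ring
  · intro a ha
    rw [vloc, vloc, Function.update_of_ne (Finset.ne_of_mem_erase ha)]

theorem Phi_update_next {n ℓ h r k : ℕ} (hn : 4 ≤ n) (hkn : k ≤ n) {T : Tableau ℓ} {c : Fin ℓ}
    (hc : sg n k (T c) = 1) (V : ℤ) :
    Phi n h r k (Function.update T c ((T c).next n k)) V = Phi n h r k T V -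
      (if vloc n h r k T c ≤ V then 1 else 0) - (if vloc n h r k T c + 1 ≤ V then 1 else 0) := by
  obtain ⟨h1, h2⟩ := sg_next hn hkn hc
  rw [Phi_update, h1, h2, hc, (by unfold vloc; ring :
    off n k (T c) + 1 - shiftPos h r c = vloc n h r k T c + 1)]
  split_ifs <;> ring

/-- Let `V` be the first place of the maximum `M`. The arrow lowers `Phi` by 1 at `V` and by 2
beyond it, while before `V` all values were already at most `M - 1`; so the new maximum is `M - 1`,
still attained at `V`. -/
theorem monPhi_update_next {n ℓ h r : ℕ} (hn : 4 ≤ n) {i : Fin n} {T : Tableau ℓ}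
    (hT : ∀ a, (T a).Valid n) {c : Fin ℓ} (hc : c ∈ candF h r i T) :
    monPhi i (mon n h r (Function.update T c ((T c).next n (i.val + 1)))) =
      monPhi i (mon n h r T) - 1 := by
  obtain ⟨h1, h2⟩ := (mem_candF hn hT c).1 hc
  rw [monPhi_of_firstMaxPos hn hT h2,
    monPhi_eq_iff hn h r i (update_valid hT (next_valid hn (by omega) (hT c)))]
  have hU := Phi_update_next (h := h) (r := r) hn i.isLt h1
  constructor
  · intro V
    rw [Nat.succ_eq_add_one] at hU
    rw [hU]
    have := h2.2.1 V
    have := h2.2.2 V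
    split_ifs <;> omega
  · refine ⟨vloc n h r (i.val + 1) T c, ?_⟩
    rw [Nat.succ_eq_add_one] at hU
    rw [hU]
    split_ifs <;> omega

theorem monWt_update_next {n ℓ h r : ℕ} {i : Fin n} {T : Tableau ℓ} {c : Fin ℓ}
    (hc : c ∈ candF h r i T) (j : Fin n) :
    monWt (mon n h r (Function.update T c ((T c).next n (i.val + 1)))) j =
      monWt (mon n h r T) j - CartanMatrix.D n j i := by
  unfold candF at hc
  replace hc := (Finset.mem_filter.1 hc).2
  unfold monF at hc
  split_ifs at hc
  rw [Option.some_inj] at hc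
  have h1 := monWt_add (mon n h r T - monA i (monQ i (mon n h r T) + 1))
    (monA i (monQ i (mon n h r T) + 1)) j
  rw [sub_add_cancel, monWt_monA, hc] at h1
  omega

/-- The effect of `f` on the statistics is already known on monomials, and the axioms for `e` follow
from those for `f`. What remains to be checked in each case is that the set is stable and that the
two operators invert each other. -/
theorem isCrystalOn_of {n ℓ h r : ℕ} (hn : 4 ≤ n) {S : Set (Tableau ℓ)}
    (hS : ∀ T ∈ S, ∀ a, (T a).Valid n)
    (hf : ∀ i : Fin n, ∀ T ∈ S, ∀ T', tabF h r i T = some T' → T' ∈ S ∧ tabE h r i T' = some T)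
    (he : ∀ i : Fin n, ∀ T ∈ S, ∀ T', tabE h r i T = some T' → T' ∈ S ∧ tabF h r i T' = some T) :
    (tableauCrystal n ℓ h r).IsCrystalOn (CartanMatrix.D n) S := by
  have hphi : ∀ i : Fin n, ∀ T ∈ S, ∀ T', tabF h r i T = some T' →
      monPhi i (mon n h r T') = monPhi i (mon n h r T) - 1 := by
    intro i T hT T' hTT'
    obtain ⟨c, hc, rfl⟩ := exists_of_tabF_eq_some hTT'
    exact monPhi_update_next hn (hS T hT) hc
  have hwt : ∀ i : Fin n, ∀ T ∈ S, ∀ T', tabF h r i T = some T' → ∀ j,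
      monWt (mon n h r T') j = monWt (mon n h r T) j - CartanMatrix.D n j i := by
    intro i T hT T' hTT'
    obtain ⟨c, hc, rfl⟩ := exists_of_tabF_eq_some hTT'
    exact monWt_update_next hc
  have heps : ∀ i : Fin n, ∀ T ∈ S, ∀ T', tabF h r i T = some T' →
      monEps i (mon n h r T') = monEps i (mon n h r T) + 1 := by
    intro i T hT T' hTT'
    have h1 := hphi i T hT T' hTT'
    have h2 := hwt i T hT T' hTT' i
    have h3 := monPhi_eq_eps_add_wt hn h r i (hS T hT)
    have h4 := monPhi_eq_eps_add_wt hn h r i (hS T' (hf i T hT T' hTT').1)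
    have h5 : CartanMatrix.D n i i = 2 := by simp [CartanMatrix.D]
    omega
  refine ⟨fun i T hT => monPhi_eq_eps_add_wt hn h r i (hS T hT), fun i T hT T' h' => (he i T hT T' h').1,
    fun i T hT T' h' => (hf i T hT T' h').1, fun i T hT T' h' j => ?_, hwt, fun i T hT T' h' => ?_,
    fun i T hT T' h' => ?_, heps, hphi, fun i T hT T' hT' => ⟨fun h' => (hf i T hT T' h').2,
      fun h' => (he i T' hT' T h').2⟩⟩
  · have := hwt i T' (he i T hT T' h').1 T (he i T hT T' h').2 j
    change monWt _ _ = monWt _ _ + _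
    omega
  · have := heps i T' (he i T hT T' h').1 T (he i T hT T' h').2
    change monEps _ _ = monEps _ _ - _
    omega
  · have := hphi i T' (he i T hT T' h').1 T (he i T hT T' h').2
    change monPhi _ _ = monPhi _ _ + _
    omega

theorem Phi_dual {n ℓ h : ℕ} (hh : h ≤ ℓ) (r k : ℕ) (T : Tableau ℓ) (V : ℤ) :
    Phi n (ℓ - h) r k (dual T) V =
      Phi n h r k T (n - row n k - (ℓ + 1 + r) - V - 1) - ∑ a, sg n k (T a) := by
  unfold Phi
  rw [← Finset.sum_sub_distrib]
  refine Fintype.sum_equiv Fin.revPerm _ _ fun a => ?_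
  have := shiftPos_rev hh r a.rev
  rw [Fin.rev_rev] at this
  simp only [Fin.revPerm_apply, vloc, dual_apply, sg_dual, this]
  by_cases h0 : sg n k (T a.rev) = 0
  · simp [h0]
  · rw [off_dual h0]
    split_ifs <;> omega

theorem exists_Phi_eq_sum {n ℓ : ℕ} (h r k : ℕ) (T : Tableau ℓ) :
    ∃ hi, ∀ V ≥ hi, Phi n h r k T V = ∑ a, sg n k (T a) := by
  refine ⟨∑ a, |vloc n h r k T a|, fun V hV => Finset.sum_congr rfl fun a _ => if_pos ?_⟩
  have h1 := Finset.single_le_sum (f := fun a => |vloc n h r k T a|) (fun _ _ => abs_nonneg _)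
    (Finset.mem_univ a)
  have h2 := le_abs_self (vloc n h r k T a)
  omega

/-- Raising candidates in terms of the last maximum of `Phi`. -/
theorem mem_candE_iff {n ℓ h r : ℕ} (hn : 4 ≤ n) (hh : h ≤ ℓ) {i : Fin n} {T : Tableau ℓ}
    (hT : ∀ a, (T a).Valid n) (c : Fin ℓ) :
    c ∈ candE h r i T ↔ sg n (i.val + 1) (T c) = -1 ∧
      ∑ a, sg n (i.val + 1) (T a) <
        Phi n h r (i.val + 1) T (vloc n h r (i.val + 1) T c - 1) ∧
      (∀ W, Phi n h r (i.val + 1) T W ≤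
        Phi n h r (i.val + 1) T (vloc n h r (i.val + 1) T c - 1)) ∧
      ∀ W ≥ vloc n h r (i.val + 1) T c, Phi n h r (i.val + 1) T W <
        Phi n h r (i.val + 1) T (vloc n h r (i.val + 1) T c - 1) := by
  rw [mem_candE hn hh hT, mem_candF hn (forall_dual_valid hT), dual_apply, Fin.rev_rev, sg_dual]
  by_cases hs : sg n (i.val + 1) (T c) = -1
  · have hv : vloc n (ℓ - h) r (i.val + 1) (dual T) c.rev =
        n - row n (i.val + 1) - (ℓ + 1 + r) - vloc n h r (i.val + 1) T c := by
      unfold vloc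
      rw [dual_apply, Fin.rev_rev, off_dual (by omega), shiftPos_rev hh]
      ring
    refine and_congr (by omega) ?_
    unfold FirstMaxPos
    rw [hv]
    simp only [Phi_dual hh]
    rw [sub_sub_cancel]
    refine and_congr (by omega) (and_congr ?_ ?_)
    · constructor
      · intro H W
        have := H (n - row n (i.val + 1) - (ℓ + 1 + r) - W - 1)
        rw [(by ring : (n : ℤ) - row n (i.val + 1) - (ℓ + 1 + r) -
          (n - row n (i.val + 1) - (ℓ + 1 + r) - W - 1) - 1 = W)] at this
        omega
      · intro H W
        have := H (n - row n (i.val + 1) - (ℓ + 1 + r) - W - 1)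
        omega
    · constructor
      · intro H W hW
        have := H (n - row n (i.val + 1) - (ℓ + 1 + r) - W - 1) (by omega)
        rw [(by ring : (n : ℤ) - row n (i.val + 1) - (ℓ + 1 + r) -
          (n - row n (i.val + 1) - (ℓ + 1 + r) - W - 1) - 1 = W)] at this
        omega
      · intro H W hW
        have := H (n - row n (i.val + 1) - (ℓ + 1 + r) - W - 1) (by omega)
        omega
  · exact iff_of_false (fun h' => hs (by omega)) (fun h' => hs h'.1)

/-- After the arrow `Phi` has lost 1 at the old first maximum and 2 to its right, so this place
becomes the last maximum. The new entry has sign `-1` one location further, as required for `e`. -/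
theorem candE_of_candF {n ℓ h r : ℕ} (hn : 4 ≤ n) (hh : h ≤ ℓ) {i : Fin n} {T : Tableau ℓ}
    (hT : ∀ a, (T a).Valid n) {c : Fin ℓ} (hc : c ∈ candF h r i T) :
    c ∈ candE h r i (Function.update T c ((T c).next n (i.val + 1))) := by
  obtain ⟨h1, h2⟩ := (mem_candF hn hT c).1 hc
  obtain ⟨h3, h4⟩ := sg_next hn i.isLt h1
  rw [Nat.succ_eq_add_one] at h3 h4
  rw [mem_candE_iff hn hh (update_valid hT (next_valid hn (by omega) (hT c)))]
  have hU := Phi_update_next (h := h) (r := r) hn i.isLt h1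
  rw [Nat.succ_eq_add_one] at hU
  have hv : vloc n h r (i.val + 1) (Function.update T c ((T c).next n (i.val + 1))) c =
      vloc n h r (i.val + 1) T c + 1 := by
    unfold vloc
    rw [Function.update_self, h4]
    ring
  have key : ∀ W ≥ vloc n h r (i.val + 1) T c + 1,
      Phi n h r (i.val + 1) (Function.update T c ((T c).next n (i.val + 1))) W <
      Phi n h r (i.val + 1) T (vloc n h r (i.val + 1) T c) - 1 := by
    intro W hW
    rw [hU]
    have := h2.2.1 W
    split_ifs <;> omega
  rw [hv, add_sub_cancel_right, Function.update_self]
  have hV : Phi n h r (i.val + 1) (Function.update T c ((T c).next n (i.val + 1)))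
      (vloc n h r (i.val + 1) T c) = Phi n h r (i.val + 1) T (vloc n h r (i.val + 1) T c) - 1 := by
    rw [hU]
    split_ifs <;> omega
  rw [hV]
  refine ⟨h3, ?_, fun W => ?_, key⟩
  · obtain ⟨hi, hhi⟩ := exists_Phi_eq_sum (n := n) h r (i.val + 1)
      (Function.update T c ((T c).next n (i.val + 1)))
    rw [← hhi (max hi (vloc n h r (i.val + 1) T c + 1)) (le_max_left _ _)]
    exact key _ (le_max_right _ _)
  · rcases lt_or_ge W (vloc n h r (i.val + 1) T c + 1) with hW | hW
    · rw [hU]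
      have := h2.2.1 W
      have := h2.2.2 W
      split_ifs <;> omega
    · exact (key W hW).le

theorem prev_next {n k : ℕ} (hn : 4 ≤ n) {x : Letter} (hkn : k ≤ n) (h : sg n k x = 1) :
    (x.next n k).prev n k = x := by
  rcases next_cases hkn h with ⟨hin, rfl, hx'⟩ | ⟨hin, rfl, hx'⟩ | ⟨hin, rfl, hx'⟩ |
    ⟨hin, rfl, hx'⟩ <;> rw [hx'] <;> simp only [Letter.prev] <;> grind

theorem tau_dual {ℓ : ℕ} (n : ℕ) (T : Tableau ℓ) : tau n (dual T) = dual (tau n T) := by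
  funext a
  rw [tau_apply, dual_apply, dual_apply, tau_apply]
  cases T a.rev <;> simp only [Letter.tau, Letter.dual] <;> split_ifs <;> rfl

theorem tabE_tau {n ℓ h r : ℕ} (hn : 4 ≤ n) (hh : h ≤ ℓ) {i j : Fin n} (hi : i.val + 2 = n)
    (hj : j.val + 1 = n) {T : Tableau ℓ} (hT : ∀ a, (T a).Valid n) :
    tabE h r i (tau n T) = (tabE h r j T).map (tau n) := by
  rw [tabE_eq hn hh (forall_tau_valid hT), tabE_eq hn hh hT, ← tau_dual,
    tabF_tau hn hi hj (forall_dual_valid hT), Option.map_map, Option.map_map]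
  congr 1
  funext S
  exact (tau_dual n S).symm

/-! ## One column -/

/-- The height of a letter in the order of the letters. -/
def Letter.ht (n : ℕ) : Letter → ℕ
  | plain i => i
  | bar i => 2 * n - i

theorem not_le_iff {n : ℕ} {x y : Letter} (hx : x.Valid n) (hy : y.Valid n) :
    ¬Le n y x ↔ x.ht n < y.ht n ∨ (x = plain n ∧ y = bar n) ∨ (x = bar n ∧ y = plain n) := by
  cases x <;> cases y <;> simp only [Valid] at hx hy <;> simp only [Le, Letter.ht] <;> simp <;>
    omega

/-- Consecutive letters of a column increase in height, except in an alternating run of `n` and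
`n̄`, where all heights are `n`. -/
theorem CondD1.ht_lt {n ℓ h : ℕ} {T : Tableau ℓ} (hT : ∀ a, (T a).Valid n) (H : CondD1 n h T)
    {a b : Fin ℓ} (hab : pos a < pos b) (hc : SameColumn h a b) :
    (T a).ht n < (T b).ht n ∨ ((T a).ht n = n ∧ (T b).ht n = n) := by
  obtain ⟨d, hd⟩ : ∃ d, pos b = pos a + 1 + d := ⟨pos b - (pos a + 1), by omega⟩
  induction d generalizing b with
  | zero =>
    rcases (not_le_iff (hT a) (hT b)).1 (H a b (by omega) hc) with h1 | ⟨h1, h2⟩ | ⟨h1, h2⟩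
    · exact Or.inl h1
    · rw [h1, h2]; exact Or.inr ⟨rfl, by simp only [Letter.ht]; omega⟩
    · rw [h1, h2]; exact Or.inr ⟨by simp only [Letter.ht]; omega, rfl⟩
  | succ d ih =>
    have hb := b.isLt
    unfold pos at hd
    have hb' : pos (⟨b.val - 1, by omega⟩ : Fin ℓ) = b.val - 1 + 1 := rfl
    have hb'' : pos b = b.val + 1 := rfl
    have ha' : pos a = a.val + 1 := rfl
    have h1 := ih (b := ⟨b.val - 1, by omega⟩) (by omega)
      (by unfold SameColumn at *; omega) (by omega)
    have h2 := (not_le_iff (hT _) (hT b)).1 (H ⟨b.val - 1, by omega⟩ b (by omega)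
      (by unfold SameColumn at *; omega))
    rcases h2 with h2 | ⟨h2, h3⟩ | ⟨h2, h3⟩
    · omega
    · have e1 : (T b).ht n = n := by rw [h3]; simp only [Letter.ht]; omega
      have e2 : (T (⟨b.val - 1, by omega⟩ : Fin ℓ)).ht n = n := by rw [h2]; rfl
      omega
    · have e1 : (T b).ht n = n := by rw [h3]; rfl
      have e2 : (T (⟨b.val - 1, by omega⟩ : Fin ℓ)).ht n = n := by
        rw [h2]; simp only [Letter.ht]; omega
      omega

/-- For `r = 0` the ranges of positions in (D.5) and (D.6) are empty, so the seam obeys the same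
rule as the interior of a column. As `max 0 1 = 1`, the conditions (D.2) to (D.4) combine into (D.2)
for the whole column. -/
theorem mem_tableauSet_zero {n ℓ h : ℕ} {T : Tableau ℓ} :
    T ∈ tableauSet n ℓ h 0 ↔ (∀ a, (T a).Valid n) ∧ CondD1 n ℓ T ∧ CondD2 n ℓ T := by
  have hpos : ∀ a : Fin ℓ, pos a ≤ ℓ := fun a => a.isLt
  constructor
  · rintro ⟨h0, h1, h2, h3, h4, h5, h6, h7⟩
    refine ⟨h0, fun a b hab _ hle => ?_, ?_⟩
    · by_cases hc : SameColumn h a b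
      · exact h1 a b hab hc hle
      · have ha : pos a = h := by unfold SameColumn at hc; omega
        have hv := h0 b
        cases hTb : T b with
        | plain k =>
          rw [hTb] at hv
          rcases hv.2.lt_or_eq with hk | rfl
          · obtain ⟨k', -, -, -, c, -, e1, e2⟩ := h5 a b ha (by omega) k hv.1 hk hTb hle
            omega
          · exact h7 a b ha (by omega) (Or.inl hTb) hle
        | bar k =>
          rw [hTb] at hv
          rcases hv.2.lt_or_eq with hk | rfl
          · obtain ⟨k', -, -, -, c, -, e1, e2⟩ := h6 a b ha (by omega) k hv.1 hk hTb hle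
            omega
          · exact h7 a b ha (by omega) (Or.inr hTb) hle
    · rintro ⟨a, b, k, e1, e2, e3, e4, e5⟩
      by_cases hb : pos b ≤ h
      · exact h2 ⟨a, b, k, e1, hb, e3, e4, e5⟩
      · by_cases ha : pos a ≤ h
        · exact h4 ⟨a, b, k, ha, by omega, e3, e4, by simpa using e5⟩
        · exact h3 ⟨a, b, k, by omega, e1, e3, e4, e5⟩
  · rintro ⟨h0, h1, h2⟩
    have hadj : ∀ x y : Fin ℓ, pos x = h → pos y = h + 1 → ¬Le n (T y) (T x) := fun x y hx hy =>
      h1 x y (by omega) ⟨fun _ => hpos y, fun _ => hpos x⟩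
    refine ⟨h0, fun a b hab _ => h1 a b hab ⟨fun _ => hpos b, fun _ => hpos a⟩, ?_, ?_, ?_,
      fun x y hx hy k _ _ _ hle => absurd hle (hadj x y hx hy),
      fun x y hx hy k _ _ _ hle => absurd hle (hadj x y hx hy),
      fun x y hx hy _ => hadj x y hx hy⟩
    · rintro ⟨a, b, k, e1, e2, e3, e4, e5⟩
      exact h2 ⟨a, b, k, e1, hpos b, e3, e4, e5⟩
    · rintro ⟨a, b, k, e1, e2, e3, e4, e5⟩
      exact h2 ⟨a, b, k, e2, hpos b, e3, e4, e5⟩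
    · rintro ⟨a, b, k, e1, e2, e3, e4, e5⟩
      exact h2 ⟨a, b, k, by omega, hpos b, e3, e4, by simpa using e5⟩

/-- The indicator of the letter `x` in row `p`. -/
noncomputable def ind {ℓ : ℕ} (T : Tableau ℓ) (p : ℤ) (x : Letter) : ℤ :=
  open Classical in if ∃ a, (pos a : ℤ) = p ∧ T a = x then 1 else 0

theorem pos_injective {ℓ : ℕ} {a b : Fin ℓ} (h : pos a = pos b) : a = b := by
  unfold pos at h
  exact Fin.ext (by omega)

theorem ind_eq_sum {ℓ : ℕ} (T : Tableau ℓ) (p : ℤ) (x : Letter) :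
    ind T p x = ∑ a, if (pos a : ℤ) = p ∧ T a = x then 1 else 0 := by
  unfold ind
  split_ifs with h
  · obtain ⟨a, ha⟩ := h
    rw [Finset.sum_eq_single a, if_pos ha]
    · intro b _ hb
      rw [if_neg]
      rintro ⟨h1, -⟩
      exact hb (pos_injective (by omega))
    · simp
  · rw [Finset.sum_eq_zero]
    intro a _
    rw [if_neg]
    exact fun ha => h ⟨a, ha⟩

theorem ind_of {ℓ : ℕ} {T : Tableau ℓ} {p : ℤ} {x : Letter} {a : Fin ℓ} (h1 : (pos a : ℤ) = p)
    (h2 : T a = x) : ind T p x = 1 := if_pos ⟨a, h1, h2⟩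

theorem ind_nonneg {ℓ : ℕ} (T : Tableau ℓ) (p : ℤ) (x : Letter) : 0 ≤ ind T p x := by
  unfold ind; split_ifs <;> omega

theorem exists_of_ind {ℓ : ℕ} {T : Tableau ℓ} {p : ℤ} {x : Letter} (h : 0 < ind T p x) :
    ∃ a, (pos a : ℤ) = p ∧ T a = x := by
  unfold ind at h; split_ifs at h with h'
  · exact h'
  · omega

theorem ind_le_one {ℓ : ℕ} (T : Tableau ℓ) (p : ℤ) (x : Letter) : ind T p x ≤ 1 := by
  unfold ind; split_ifs <;> omega

/-- For `k < n` four letters carry a sign, and without a shift each of them can reach the location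
`V` from one row only. -/
theorem Phi_jump {n ℓ h k : ℕ} (hkn : k < n) (T : Tableau ℓ) (V : ℤ) :
    Phi n h 0 k T V - Phi n h 0 k T (V - 1) =
      ind T (-V) (plain k) - ind T (-V + 1) (plain (k + 1)) +
        ind T (n - 1 - k - V) (bar (k + 1)) - ind T (n - 1 - k - V + 1) (bar k) := by
  simp only [ind_eq_sum]
  unfold Phi
  rw [← Finset.sum_sub_distrib, ← Finset.sum_sub_distrib, ← Finset.sum_add_distrib,
    ← Finset.sum_sub_distrib]
  refine Finset.sum_congr rfl fun a _ => ?_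
  unfold vloc shiftPos
  cases T a <;> simp only [sg, off, hkn, if_true, true_and, plain.injEq, bar.injEq, reduceCtorEq,
    and_false, if_false, Nat.cast_zero, add_zero, ite_self] <;> split_ifs <;> omega

theorem sg_eq_one_iff {n k : ℕ} (hkn : k < n) {x : Letter} :
    sg n k x = 1 ↔ x = plain k ∨ x = bar (k + 1) := by
  cases x <;> simp only [sg, hkn, if_true] <;> split_ifs <;> simp <;> omega

theorem sg_eq_neg_one_iff {n k : ℕ} (hkn : k < n) {x : Letter} :
    sg n k x = -1 ↔ x = plain (k + 1) ∨ x = bar k := by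
  cases x <;> simp only [sg, hkn, if_true] <;> split_ifs <;> simp <;> omega

theorem exists_of_tabF_zero {n ℓ h : ℕ} {k : Fin n} {T T' : Tableau ℓ}
    (H : tabF h 0 k T = some T') :
    ∃ c ∈ candF h 0 k T, (∀ c' ∈ candF h 0 k T, c ≤ c') ∧
      T' = Function.update T c ((T c).next n (k.val + 1)) := by
  unfold tabF at H
  split_ifs at H with hne
  simp only [true_or, if_true, Option.some_inj] at H
  exact ⟨_, Finset.min'_mem _ _, fun c' hc' => Finset.min'_le _ _ hc', H.symm⟩

theorem tabE_zero_eq_some {n ℓ h : ℕ} {k : Fin n} {T : Tableau ℓ} {c : Fin ℓ}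
    (hc : c ∈ candE h 0 k T) (H : ∀ c' ∈ candE h 0 k T, c' ≤ c) :
    tabE h 0 k T = some (Function.update T c ((T c).prev n (k.val + 1))) := by
  have hne : (candE h 0 k T).Nonempty := ⟨c, hc⟩
  unfold tabE
  rw [dif_pos hne]
  have hmax : (candE h 0 k T).max' hne = c :=
    le_antisymm (Finset.max'_le _ _ _ H) (Finset.le_max' _ _ hc)
  simp only [true_or, if_true, hmax]

/-! ## The crystal for `r = 0` -/

theorem vloc_zero {n ℓ h k : ℕ} (T : Tableau ℓ) (a : Fin ℓ) :
    vloc n h 0 k T a = off n k (T a) - pos a := by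
  unfold vloc shiftPos; simp

theorem vloc_zero_of_sg_eq_one {n ℓ h k : ℕ} (hkn : k < n) {T : Tableau ℓ} {a : Fin ℓ} :
    (T a = plain k → vloc n h 0 k T a = -pos a) ∧
    (T a = bar (k + 1) → vloc n h 0 k T a = n - 1 - k - pos a) ∧
    (T a = plain (k + 1) → vloc n h 0 k T a = 1 - pos a) ∧
    (T a = bar k → vloc n h 0 k T a = n - k - pos a) := by
  rw [vloc_zero]
  refine ⟨?_, ?_, ?_, ?_⟩ <;> intro h <;> rw [h] <;> simp [off, hkn]

/-- At the first maximum `V` the jump of `Phi` is positive, and at `V + 1` it is not. Together with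
(D.2) and the choice of the first candidate this excludes every neighbour of `c` that would violate
(D.1) or (D.2) after the replacement, and also every later candidate for `e`. -/
theorem tabF_zero_aux {n ℓ h : ℕ} (hn : 4 ≤ n) (hh : h ≤ ℓ) {i : Fin n} (hi : i.val + 1 < n)
    {T T' : Tableau ℓ} (hT : T ∈ tableauSet n ℓ h 0) (hTT' : tabF h 0 i T = some T') :
    T' ∈ tableauSet n ℓ h 0 ∧ tabE h 0 i T' = some T := by
  obtain ⟨hv, h1, h2⟩ := mem_tableauSet_zero.1 hT
  obtain ⟨c, hc, hmin, rfl⟩ := exists_of_tabF_zero hTT'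
  obtain ⟨hs, hF⟩ := (mem_candF hn hv c).1 hc
  have hvl := fun a => vloc_zero_of_sg_eq_one (h := h) hi (T := T) (a := a)
  have hcF := mem_candF hn (h := h) (r := 0) (i := i) hv
  have hv' := update_valid hv (c := c) (next_valid hn (k := i.val + 1) (by omega) (hv c))
  have hcE := candE_of_candF hn hh hv hc
  have hpn := prev_next hn hi.le hs
  have hE := mem_candE_iff hn (r := 0) hh (i := i) hv'
  have hvl' := fun a => vloc_zero_of_sg_eq_one (h := h) hi (a := a)
    (T := Function.update T c ((T c).next n (i.val + 1)))
  generalize hk : i.val + 1 = k at *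
  generalize hV : vloc n h 0 k T c = V at *
  have J1 := Phi_jump (h := h) hi T V
  have J2 := Phi_jump (h := h) hi T (V + 1)
  have F1 := hF.2.2 (V - 1) (by omega)
  have F2 := hF.2.1 (V + 1)
  rw [add_sub_cancel_right] at J2
  -- two letters cannot share a position
  have hne : ∀ (a b : Fin ℓ) (x y : Letter), T a = x → T b = y → x ≠ y →
      (pos a : ℤ) ≠ pos b := by
    rintro a b x y ha hb hxy hab
    have := pos_injective (a := a) (b := b) (by omega)
    subst this
    exact hxy (ha.symm.trans hb)
  have hD2 : ∀ (a b : Fin ℓ) (j : ℕ), (pos a : ℤ) < pos b → T a = plain j → T b = bar j →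
      (pos b : ℤ) - pos a ≠ n - 1 - j := fun a b j hab ha hb hd =>
    h2 ⟨a, b, j, by omega, b.isLt, ha, hb, hd⟩
  have e1 := ind_nonneg T (-V + 1) (plain (k + 1))
  have e2 := ind_nonneg T (n - 1 - k - V + 1) (bar k)
  have e3 := ind_nonneg T (-(V + 1)) (plain k)
  have e4 := ind_le_one T (-V) (plain k)
  have e5 := ind_le_one T (n - 1 - k - V) (bar (k + 1))
  have e6 := ind_nonneg T (n - 1 - k - (V + 1)) (bar (k + 1))
  have key : (T c = plain k ∧ (T c).next n k = plain (k + 1) ∧ V = -pos c ∧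
        (∀ b, pos b = pos c + 1 → T b ≠ plain (k + 1)) ∧
        (∀ b, T b = bar (k + 1) → (pos b : ℤ) ≠ pos c + (n - 2 - k) ∨ pos b ≤ pos c) ∧
        ∀ b, T b = bar k → (pos b : ℤ) ≠ n - 1 - k - V ∨ pos b ≤ pos c) ∨
      (T c = bar (k + 1) ∧ (T c).next n k = bar k ∧ V = n - 1 - k - pos c ∧
        (∀ b, pos b = pos c + 1 → T b ≠ bar k ∧ (k + 1 = n → T b ≠ plain n)) ∧
        ∀ a, T a = plain k → (pos a : ℤ) ≠ pos c - (n - 1 - k)) := by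
    rcases (sg_eq_one_iff hi).1 hs with hx | hx
    · left
      have hVc := (hvl c).1 hx
      rw [hV] at hVc
      refine ⟨hx, by rw [hx]; simp [Letter.next, hi], hVc, ?_, ?_, ?_⟩
      -- A letter `k+1` just below `c` contributes `-1` at `V`. A positive jump would then need
      -- `k+1` barred at the same location, which forms with `b` a pair excluded by (D.2).
      · intro b hb hbx
        have g1 := ind_of (T := T) (p := -V + 1) (a := b) (by omega) hbx
        obtain ⟨d, hd, hdx⟩ := exists_of_ind (T := T) (p := n - 1 - k - V) (x := bar (k + 1))
          (by omega)
        have := hne b d _ _ hbx hdx (by simp)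
        have := hne c d _ _ hx hdx (by simp)
        exact hD2 b d (k + 1) (by omega) hbx hdx (by push_cast; omega)
      -- Such a letter contributes `+1` at `V + 1`, so some `-1` has to compensate it there: either
      -- `k+1` in the row of `c` itself, or `k` barred forming with `c` a pair excluded by (D.2).
      · intro b hbx
        by_contra hcon
        push Not at hcon
        have g1 := ind_of (T := T) (p := n - 1 - k - (V + 1)) (a := b) (by omega) hbx
        rcases (by omega : 0 < ind T (-(V + 1) + 1) (plain (k + 1)) ∨
          0 < ind T (n - 1 - k - (V + 1) + 1) (bar k)) with g | g
        · obtain ⟨d, hd, hdx⟩ := exists_of_ind g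
          exact hne c d _ _ hx hdx (by simp) (by omega)
        · obtain ⟨d, hd, hdx⟩ := exists_of_ind g
          exact hD2 c d k (by omega) hx hdx (by omega)
      · intro b hbx
        by_contra hcon
        push Not at hcon
        exact hD2 c b k (by omega) hx hbx (by omega)
    · right
      have hVc := (hvl c).2.1 hx
      rw [hV] at hVc
      -- A letter `k` at this distance would be a candidate at the same location in an earlier row,
      -- whereas `c` is the first candidate.
      have hno : ∀ a, T a = plain k → (pos a : ℤ) ≠ pos c - (n - 1 - k) := by
        intro a ha hpa
        have h3 := (hvl a).1 ha
        have h4 := hmin a ((hcF a).2 ⟨(sg_eq_one_iff hi).2 (Or.inl ha),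
          by rw [h3, (by omega : -(pos a : ℤ) = V)]; exact hF⟩)
        have h5 : pos c ≤ pos a := Nat.succ_le_succ h4
        exact hne a c _ _ ha hx (by simp) (by omega)
      have g0 : ind T (-V) (plain k) ≤ 0 := by
        by_contra hcon
        obtain ⟨d, hd, hdx⟩ := exists_of_ind (not_le.1 hcon)
        exact hno d hdx (by omega)
      refine ⟨hx, by rw [hx]; simp [Letter.next, hi], hVc, ?_, hno⟩
      intro b hb
      refine ⟨fun hbx => ?_, ?_⟩
      · have g1 := ind_of (T := T) (p := n - 1 - k - V + 1) (a := b) (by omega) hbx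
        omega
      · rintro rfl hbx
        have g1 := ind_of (T := T) (p := -V + 1) (a := b) (by push_cast at *; omega) hbx
        omega
  have hU : Function.update T c ((T c).next n k) c = (T c).next n k := Function.update_self ..
  have hUo : ∀ a, a ≠ c → Function.update T c ((T c).next n k) a = T a := fun a ha =>
    Function.update_of_ne ha ..
  have hvn : ((T c).next n k).Valid n := by have := hv' c; rwa [hU] at this
  refine ⟨mem_tableauSet_zero.2 ⟨hv', ?_, ?_⟩, ?_⟩
  · intro a b hab hsc
    have hD := (not_le_iff (hv a) (hv b)).1 (h1 a b hab hsc)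
    rw [not_le_iff (hv' a) (hv' b)]
    by_cases ha : a = c
    · subst ha
      rw [hU, hUo b (by rintro rfl; omega)]
      have hvb := hv b
      rcases key with ⟨hx, hy, -, hA, -, -⟩ | ⟨hx, hy, -, hA, -⟩
      · have := hA b hab
        rw [hy]; rw [hx] at hD
        generalize T b = z at *
        cases z <;> simp only [Letter.ht, plain.injEq, bar.injEq, reduceCtorEq, false_and, and_false,
          or_false, false_or, Valid, ne_eq, true_and] at * <;> omega
      · have := hA b hab
        rw [hy]; rw [hx] at hD
        generalize T b = z at *
        cases z <;> simp only [Letter.ht, plain.injEq, bar.injEq, reduceCtorEq, false_and, and_false,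
          or_false, false_or, Valid, ne_eq, true_and, and_true, not_false_eq_true] at * <;> omega
    · rw [hUo a ha]
      by_cases hb : b = c
      · subst hb
        rw [hU]
        have hva := hv a
        rcases key with ⟨hx, hy, -⟩ | ⟨hx, hy, -⟩ <;> rw [hy] <;> rw [hx] at hD <;>
          generalize T a = z at * <;>
          cases z <;> simp only [Letter.ht, plain.injEq, bar.injEq, reduceCtorEq, false_and,
            and_false, or_false, false_or, Valid, true_and, and_true] at * <;> omega
      · rwa [hUo b hb]
  · rintro ⟨a, b, j, hab, -, ha, hb, hd⟩
    by_cases hac : a = c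
    · subst hac
      rw [hU] at ha
      rw [hUo b (by rintro rfl; omega)] at hb
      rcases key with ⟨hx, hy, -, -, hB, -⟩ | ⟨hx, hy, -⟩
      · rw [hy, plain.injEq] at ha
        subst ha
        have := hB b hb
        push_cast at hd
        omega
      · rw [hy] at ha; cases ha
    · rw [hUo a hac] at ha
      by_cases hbc : b = c
      · subst hbc
        rw [hU] at hb
        rcases key with ⟨hx, hy, -⟩ | ⟨hx, hy, -, -, hB⟩
        · rw [hy] at hb; cases hb
        · rw [hy, bar.injEq] at hb
          subst hb
          exact hB a ha (by omega)
      · rw [hUo b hbc] at hb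
        exact hD2 a b j (by omega) ha hb hd
  -- Every candidate for `e` stands at the last maximum, hence at the location of `c`. A later one
  -- would have to be `k` barred below a former `k`, at a distance excluded by `key`.
  · have hlast : ∀ c' ∈ candE h 0 i (Function.update T c ((T c).next n k)), c' ≤ c := by
      intro c' hc'
      by_contra hlt
      have hcc : c' ≠ c := by rintro rfl; exact hlt le_rfl
      have hpc : pos c < pos c' := Nat.succ_lt_succ (not_le.1 hlt)
      obtain ⟨s1, -, m1, n1⟩ := (hE c').1 hc'
      obtain ⟨s2, -, m2, n2⟩ := (hE c).1 hcE
      have hvv : vloc n h 0 k (Function.update T c ((T c).next n k)) c' =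
          vloc n h 0 k (Function.update T c ((T c).next n k)) c := by
        rcases lt_trichotomy (vloc n h 0 k (Function.update T c ((T c).next n k)) c')
          (vloc n h 0 k (Function.update T c ((T c).next n k)) c) with hh | hh | hh
        · have := n1 (vloc n h 0 k (Function.update T c ((T c).next n k)) c - 1) (by omega)
          have := m2 (vloc n h 0 k (Function.update T c ((T c).next n k)) c' - 1)
          omega
        · exact hh
        · have := n2 (vloc n h 0 k (Function.update T c ((T c).next n k)) c' - 1) (by omega)
          have := m1 (vloc n h 0 k (Function.update T c ((T c).next n k)) c - 1)
          omega
      have hl1 := (hvl' c').2.2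
      have hl2 := (hvl' c).2.2
      rw [hU] at hl2
      rw [hUo c' hcc] at hl1 s1
      rcases key with ⟨hx, hy, hVc, -, -, hB⟩ | ⟨hx, hy, hVc, -, -⟩
      · have := hl2.1 hy
        rcases (sg_eq_neg_one_iff hi).1 s1 with hz | hz
        · have := hl1.1 hz
          omega
        · have := hl1.2 hz
          have := hB c' hz
          omega
      · have := hl2.2 hy
        rcases (sg_eq_neg_one_iff hi).1 s1 with hz | hz
        · have := hl1.1 hz
          omega
        · have := hl1.2 hz
          omega
    rw [tabE_zero_eq_some hcE hlast, hk, hU, hpn, Function.update_idem, Function.update_eq_self]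

/-- The vertex `n` is reduced to the vertex `n - 1` by exchanging `n` and `n̄`. -/
theorem tabF_zero {n ℓ h : ℕ} (hn : 4 ≤ n) (hh : h ≤ ℓ) {i : Fin n}
    {T T' : Tableau ℓ} (hT : T ∈ tableauSet n ℓ h 0) (hTT' : tabF h 0 i T = some T') :
    T' ∈ tableauSet n ℓ h 0 ∧ tabE h 0 i T' = some T := by
  rcases (by omega : i.val + 1 < n ∨ i.val + 1 = n) with hi | hi
  · exact tabF_zero_aux hn hh hi hT hTT'
  · have hj : (⟨n - 2, by omega⟩ : Fin n).val + 2 = n := by change n - 2 + 2 = n; omega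
    have h1 := tabF_tau (h := h) (r := 0) hn hj hi hT.1
    rw [hTT'] at h1
    obtain ⟨h2, h3⟩ := tabF_zero_aux hn hh (by omega) (tau_mem hT) h1
    have h4 := tau_mem_iff.1 h2
    refine ⟨h4, ?_⟩
    rw [tabE_tau hn hh hj hi h4.1] at h3
    obtain ⟨X, hX, hX'⟩ := Option.map_eq_some_iff.1 h3
    rw [hX, ← tau_tau n X, hX', tau_tau]

theorem isCrystalOn_zero {n ℓ h : ℕ} (hn : 4 ≤ n) (hh : h ≤ ℓ) :
    (tableauCrystal n ℓ h 0).IsCrystalOn (CartanMatrix.D n) (tableauSet n ℓ h 0) := by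
  refine isCrystalOn_of hn (fun T hT => hT.1) (fun i T hT T' => tabF_zero hn hh hT) ?_
  intro i T hT T' hTT'
  rw [tabE_eq hn hh hT.1] at hTT'
  obtain ⟨S, hS, rfl⟩ := Option.map_eq_some_iff.1 hTT'
  obtain ⟨h1, h2⟩ := tabF_zero hn (Nat.sub_le ℓ h) (dual_mem hh hT) hS
  rw [tabE_eq hn (Nat.sub_le ℓ h) h1.1, Nat.sub_sub_self hh] at h2
  obtain ⟨X, hX, hX'⟩ := Option.map_eq_some_iff.1 h2
  have h3 := dual_mem (Nat.sub_le ℓ h) h1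
  rw [Nat.sub_sub_self hh] at h3
  exact ⟨h3, hX.trans (congrArg some (dual_injective hX'))⟩

end TypeD

/-! ### Transport of the crystal axioms along an isomorphism -/

namespace CrystalData

theorem IsCrystalOn.of_isIsoOn {I B B' : Type} {X : CrystalData I B} {X' : CrystalData I B'}
    {C : Matrix I I ℤ} {S : Set B} {S' : Set B'} {s : B → B'} (H : X.IsCrystalOn C S)
    (hs : IsIsoOn X S X' S' s) : X'.IsCrystalOn C S' := by
  have hsurj : ∀ b' ∈ S', ∃ b ∈ S, s b = b' := fun b' hb' => hs.bijOn.surjOn hb'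
  have hmap : ∀ b ∈ S, s b ∈ S' := fun b hb => hs.bijOn.mapsTo hb
  have he : ∀ i, ∀ b ∈ S, ∀ b', X'.e i (s b) = some b' → ∃ b₀ ∈ S, X.e i b = some b₀ ∧ s b₀ = b' := by
    intro i b hb b' h
    rw [hs.e_eq i b hb, Option.map_eq_some_iff] at h
    obtain ⟨b₀, h1, h2⟩ := h
    exact ⟨b₀, H.e_mem i b hb b₀ h1, h1, h2⟩
  have hf : ∀ i, ∀ b ∈ S, ∀ b', X'.f i (s b) = some b' → ∃ b₀ ∈ S, X.f i b = some b₀ ∧ s b₀ = b' := by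
    intro i b hb b' h
    rw [hs.f_eq i b hb, Option.map_eq_some_iff] at h
    obtain ⟨b₀, h1, h2⟩ := h
    exact ⟨b₀, H.f_mem i b hb b₀ h1, h1, h2⟩
  refine ⟨fun i b hb0 => ?_, fun i b hb0 b' h => ?_, fun i b hb0 b' h => ?_, fun i b hb0 b' h j => ?_,
    fun i b hb0 b' h j => ?_, fun i b hb0 b' h => ?_, fun i b hb0 b' h => ?_, fun i b hb0 b' h => ?_,
    fun i b hb0 b' h => ?_, fun i b hb0 b' hb1 => ?_⟩ <;> obtain ⟨b, hb, rfl⟩ := hsurj _ hb0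
  · rw [hs.phi_eq i b hb, hs.eps_eq i b hb, hs.wt_eq b hb]
    exact H.phi_eq i b hb
  · obtain ⟨b₀, h0, -, rfl⟩ := he i b hb b' h
    exact hmap _ h0
  · obtain ⟨b₀, h0, -, rfl⟩ := hf i b hb b' h
    exact hmap _ h0
  · obtain ⟨b₀, h0, h1, rfl⟩ := he i b hb b' h
    rw [hs.wt_eq b₀ h0, hs.wt_eq b hb]
    exact H.wt_e i b hb b₀ h1 j
  · obtain ⟨b₀, h0, h1, rfl⟩ := hf i b hb b' h
    rw [hs.wt_eq b₀ h0, hs.wt_eq b hb]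
    exact H.wt_f i b hb b₀ h1 j
  · obtain ⟨b₀, h0, h1, rfl⟩ := he i b hb b' h
    rw [hs.eps_eq i b₀ h0, hs.eps_eq i b hb]
    exact H.eps_e i b hb b₀ h1
  · obtain ⟨b₀, h0, h1, rfl⟩ := he i b hb b' h
    rw [hs.phi_eq i b₀ h0, hs.phi_eq i b hb]
    exact H.phi_e i b hb b₀ h1
  · obtain ⟨b₀, h0, h1, rfl⟩ := hf i b hb b' h
    rw [hs.eps_eq i b₀ h0, hs.eps_eq i b hb]
    exact H.eps_f i b hb b₀ h1
  · obtain ⟨b₀, h0, h1, rfl⟩ := hf i b hb b' h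
    rw [hs.phi_eq i b₀ h0, hs.phi_eq i b hb]
    exact H.phi_f i b hb b₀ h1
  · obtain ⟨b', hb', rfl⟩ := hsurj b' hb1
    constructor
    · intro h
      obtain ⟨b₀, h0, h1, h2⟩ := hf i b hb _ h
      have := hs.bijOn.injOn h0 hb' h2
      subst this
      rw [hs.e_eq i b₀ h0, (H.f_iff_e i b hb b₀ h0).1 h1]
      rfl
    · intro h
      obtain ⟨b₀, h0, h1, h2⟩ := he i b' hb' _ h
      have := hs.bijOn.injOn h0 hb h2
      subst this
      rw [hs.f_eq i b₀ h0, (H.f_iff_e i b₀ h0 b' hb').2 h1]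
      rfl

end CrystalData

namespace TypeD

open Letter

/-- Duality replaces `h` by `ℓ - h` and commutes with `sigma`, so the statements on `φ` and `f` for
all `h` yield those on `ε` and `e`. The weight is `φ - ε`. -/
theorem isIsoOn_sigma_of {n ℓ r : ℕ} (hn : 4 ≤ n)
    (hbij : ∀ h ≤ ℓ, Set.BijOn (sigma n ℓ h r) (tableauSet n ℓ h r) (tableauSet n ℓ h (r + 1)))
    (hphi : ∀ h ≤ ℓ, ∀ T ∈ tableauSet n ℓ h r, ∀ i : Fin n,
      monPhi i (mon n h (r + 1) (sigma n ℓ h r T)) = monPhi i (mon n h r T))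
    (hf : ∀ h ≤ ℓ, ∀ T ∈ tableauSet n ℓ h r, ∀ i : Fin n,
      tabF h (r + 1) i (sigma n ℓ h r T) = (tabF h r i T).map (sigma n ℓ h r)) {h : ℕ} (hh : h ≤ ℓ) :
    CrystalData.IsIsoOn (tableauCrystal n ℓ h r) (tableauSet n ℓ h r)
      (tableauCrystal n ℓ h (r + 1)) (tableauSet n ℓ h (r + 1)) (sigma n ℓ h r) := by
  have heps : ∀ i : Fin n, ∀ T ∈ tableauSet n ℓ h r,
      monEps i (mon n h (r + 1) (sigma n ℓ h r T)) = monEps i (mon n h r T) := by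
    intro i T hT
    rw [monEps_eq_monPhi_dual hn hh _ i ((hbij h hh).mapsTo hT).1,
      monEps_eq_monPhi_dual hn hh _ i hT.1, ← sigma_dual hh]
    exact hphi _ (Nat.sub_le ℓ h) _ (dual_mem hh hT) i
  refine ⟨hbij h hh, fun T hT => ?_, heps, fun i T hT => hphi h hh T hT i, fun i T hT => ?_,
    fun i T hT => hf h hh T hT i⟩
  · funext i
    have h1 := monPhi_eq_eps_add_wt hn h (r + 1) i ((hbij h hh).mapsTo hT).1
    have h2 := monPhi_eq_eps_add_wt hn h r i hT.1
    have h3 := hphi h hh T hT i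
    have h4 := heps i T hT
    change monWt _ _ = monWt _ _
    omega
  · change tabE _ _ _ _ = (tabE _ _ _ _).map _
    rw [tabE_eq hn hh ((hbij h hh).mapsTo hT).1, tabE_eq hn hh hT.1, ← sigma_dual hh,
      hf _ (Nat.sub_le ℓ h) _ (dual_mem hh hT) i, Option.map_map, Option.map_map]
    congr 1
    funext S
    have := sigma_dual (n := n) (Nat.sub_le ℓ h) r S
    rw [Nat.sub_sub_self hh] at this
    exact this.symm

/-! ## Encoding of columns by counting functions -/

theorem exists_pos {ℓ : ℕ} {q : ℤ} (h1 : 1 ≤ q) (h2 : q ≤ ℓ) : ∃ c : Fin ℓ, (pos c : ℤ) = q := by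
  refine ⟨⟨(q - 1).toNat, by omega⟩, ?_⟩
  unfold pos
  simp only
  omega

theorem pos_le {ℓ : ℕ} (c : Fin ℓ) : pos c ≤ ℓ := c.isLt

theorem pos_pos {ℓ : ℕ} (c : Fin ℓ) : 1 ≤ pos c := Nat.succ_pos _

/-- The positions of the letters `1, …, j` in the first column are `1, …, P j`, for `j < n`. -/
structure ColEnc (n h : ℕ) {ℓ : ℕ} (T : Tableau ℓ) (P : ℕ → ℤ) : Prop where
  zero : P 0 = 0
  mono : ∀ j, j + 1 < n → P j ≤ P (j + 1)
  le : ∀ j < n, P j ≤ h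
  iff : ∀ j, j + 1 < n → ∀ c : Fin ℓ,
    (pos c ≤ h ∧ T c = plain (j + 1) ↔ P j < pos c ∧ (pos c : ℤ) ≤ P (j + 1))

/-- The condition (D.1) for the first column. -/
def ColD1 (n h : ℕ) {ℓ : ℕ} (T : Tableau ℓ) : Prop :=
  ∀ a b : Fin ℓ, pos b = pos a + 1 → pos b ≤ h → ¬Le n (T b) (T a)

def Steps (n : ℕ) (P : ℕ → ℤ) : Prop := ∀ j, j + 1 < n → P (j + 1) ≤ P j + 1

theorem exists_initial (p : ℕ → Prop) (h : ℕ) (hp : ∀ q, q + 1 ≤ h → p (q + 1) → p q) :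
    ∃ m ≤ h, ∀ q, 1 ≤ q → q ≤ h → (p q ↔ q ≤ m) := by
  induction h with
  | zero => exact ⟨0, le_rfl, fun q h1 h2 => by omega⟩
  | succ h ih =>
    by_cases hs : p (h + 1)
    · refine ⟨h + 1, le_rfl, fun q h1 h2 => iff_of_true ?_ h2⟩
      have : ∀ d q, q + d = h + 1 → p q := by
        intro d
        induction d with
        | zero => rintro q rfl; exact hs
        | succ d ihd =>
          intro q hq
          exact hp q (by omega) (ihd (q + 1) (by omega))
      exact this (h + 1 - q) q (by omega)
    · obtain ⟨m, hm, H⟩ := ih fun q hq => hp q (by omega)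
      refine ⟨m, by omega, fun q h1 h2 => ?_⟩
      rcases h2.lt_or_eq with h2 | rfl
      · exact H q h1 (by omega)
      · exact iff_of_false hs (by omega)

theorem Letter.ht_eq_iff {n j : ℕ} {x : Letter} (hx : x.Valid n) (hj : j < n) :
    x.ht n = j ↔ x = plain j := by
  cases x <;> simp only [Valid] at hx <;> simp [Letter.ht]
  omega

theorem Letter.ht_pos {n : ℕ} {x : Letter} (hx : x.Valid n) : 1 ≤ x.ht n := by
  cases x <;> simp only [Valid] at hx <;> simp only [Letter.ht] <;> omega

/-- Heights do not decrease down a column, so the letters of height at most `j` fill an initial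
segment. Below the height `n` the increase is strict, hence each letter `1, …, n - 1` occurs at most
once and the steps are at most 1. -/
theorem exists_colEnc {n ℓ h : ℕ} (hh : h ≤ ℓ) {T : Tableau ℓ} (hT : ∀ a, (T a).Valid n)
    (hD : CondD1 n h T) : ∃ P, ColEnc n h T P ∧ Steps n P := by
  have hlt : ∀ a b : Fin ℓ, pos a < pos b → pos b ≤ h →
      (T a).ht n < (T b).ht n ∨ ((T a).ht n = n ∧ (T b).ht n = n) := fun a b hab hb =>
    hD.ht_lt hT hab (by unfold SameColumn; omega)
  have key : ∀ j : ℕ, ∃ m ≤ h, ∀ c : Fin ℓ, pos c ≤ h → ((T c).ht n ≤ j ↔ pos c ≤ m) := by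
    intro j
    obtain ⟨m, hm, H⟩ := exists_initial (fun q => ∀ c : Fin ℓ, pos c = q → (T c).ht n ≤ j) h
      (by
        intro q hq H c hc
        obtain ⟨d, hd⟩ := exists_pos (ℓ := ℓ) (q := q + 1) (by omega) (by omega)
        have := H d (by omega)
        have := hlt c d (by omega) (by omega)
        omega)
    refine ⟨m, hm, fun c hc => ?_⟩
    rw [← H (pos c) (pos_pos c) hc]
    constructor
    · intro hle d hd
      rwa [pos_injective hd]
    · intro H
      exact H c rfl
  choose m hm H using key
  have hcell : ∀ q : ℕ, 1 ≤ q → q ≤ h → ∃ c : Fin ℓ, pos c = q := by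
    intro q h1 h2
    obtain ⟨c, hc⟩ := exists_pos (ℓ := ℓ) (q := q) (by omega) (by omega)
    exact ⟨c, by omega⟩
  have hmono : ∀ j, m j ≤ m (j + 1) := by
    intro j
    by_contra hcon
    obtain ⟨c, hc⟩ := hcell (m j) (by omega) (hm j)
    have := (H j c (by rw [hc]; exact hm j)).2 hc.le
    have := (H (j + 1) c (by rw [hc]; exact hm j)).1 (by omega)
    omega
  refine ⟨fun j => m j, ⟨?_, fun j _ => by exact_mod_cast hmono j, fun j _ => by exact_mod_cast hm j,
    fun j hj c => ?_⟩, fun j hj => ?_⟩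
  · by_contra hcon
    obtain ⟨c, hc⟩ := hcell (m 0) (by omega) (hm 0)
    have := (H 0 c (by rw [hc]; exact hm 0)).2 hc.le
    have := Letter.ht_pos (hT c)
    omega
  · rw [← Letter.ht_eq_iff (hT c) hj]
    constructor
    · rintro ⟨h1, h2⟩
      have := H j c h1
      have := H (j + 1) c h1
      omega
    · intro h12
      change (m j : ℤ) < pos c ∧ (pos c : ℤ) ≤ m (j + 1) at h12
      obtain ⟨h1, h2⟩ := h12
      have h3 : pos c ≤ h := by have := hm (j + 1); omega
      have := H j c h3
      have := H (j + 1) c h3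
      omega
  · change (m (j + 1) : ℤ) ≤ m j + 1
    by_contra hcon
    have h3 := hm (j + 1)
    obtain ⟨a, ha⟩ := hcell (m j + 1) (by omega) (by omega)
    obtain ⟨b, hb⟩ := hcell (m j + 2) (by omega) (by omega)
    have := H j a (by omega)
    have := H (j + 1) a (by omega)
    have := H j b (by omega)
    have := H (j + 1) b (by omega)
    have := hlt a b (by omega) (by omega)
    omega

/-- The letters in the first column that are not encoded by the counting function agree. -/
def ColRest (n h : ℕ) {ℓ : ℕ} (T T' : Tableau ℓ) : Prop :=
  ∀ c y, pos c ≤ h → (∀ j, j + 1 < n → y ≠ plain (j + 1)) → (T c = y ↔ T' c = y)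

theorem ColRest.refl (n h : ℕ) {ℓ : ℕ} (T : Tableau ℓ) : ColRest n h T T := fun _ _ _ _ => Iff.rfl

theorem ColRest.symm {n h ℓ : ℕ} {T T' : Tableau ℓ} (H : ColRest n h T T') : ColRest n h T' T :=
  fun c y hc hy => (H c y hc hy).symm

theorem ColRest.trans {n h ℓ : ℕ} {T T' T'' : Tableau ℓ} (H : ColRest n h T T')
    (H' : ColRest n h T' T'') : ColRest n h T T'' :=
  fun c y hc hy => (H c y hc hy).trans (H' c y hc hy)

theorem ColEnc.of_eq {n h ℓ : ℕ} {T : Tableau ℓ} {P P' : ℕ → ℤ} (H : ColEnc n h T P)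
    (hP : ∀ j < n, P' j = P j) (hn : 0 < n) : ColEnc n h T P' := by
  refine ⟨by rw [hP 0 hn, H.zero], fun j hj => ?_, fun j hj => ?_, fun j hj c => ?_⟩
  · rw [hP j (by omega), hP _ hj]; exact H.mono j hj
  · rw [hP j hj]; exact H.le j hj
  · rw [hP j (by omega), hP _ hj]; exact H.iff j hj c

theorem ColEnc.eq_of_colRest {n h ℓ : ℕ} {T T' : Tableau ℓ} {P : ℕ → ℤ} (H : ColEnc n h T P)
    (H' : ColEnc n h T' P) (hR : ColRest n h T T') {c : Fin ℓ}
    (hc : pos c ≤ h) : T c = T' c := by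
  by_cases hx : ∃ j, j + 1 < n ∧ T c = plain (j + 1)
  · obtain ⟨j, hj, hx⟩ := hx
    rw [hx, ((H'.iff j hj c).2 ((H.iff j hj c).1 ⟨hc, hx⟩)).2]
  · push Not at hx
    exact ((hR c (T c) hc hx).1 rfl).symm

/-- Relabelling the positions between two thresholds of the letters `k` and `k + 1`. -/
theorem ColEnc.move {n h ℓ : ℕ} {T T' : Tableau ℓ} {P P' : ℕ → ℤ} (H : ColEnc n h T P) {k : ℕ}
    (hk : k + 2 < n) (hP : ∀ j, j ≠ k + 1 → P' j = P j) (h1 : P k ≤ P' (k + 1))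
    (h2 : P' (k + 1) ≤ P (k + 2))
    (hin : ∀ c : Fin ℓ, P k < pos c → (pos c : ℤ) ≤ P (k + 2) →
      T' c = if (pos c : ℤ) ≤ P' (k + 1) then plain (k + 1) else plain (k + 2))
    (hout : ∀ c : Fin ℓ, pos c ≤ h → ¬(P k < pos c ∧ (pos c : ℤ) ≤ P (k + 2)) → T' c = T c) :
    ColEnc n h T' P' ∧ ColRest n h T T' := by
  have hle := H.le (k + 2) hk
  have hm1 := H.mono k (by omega)
  have hm2 : P (k + 1) ≤ P (k + 2) := H.mono (k + 1) hk
  have hTin : ∀ c : Fin ℓ, P k < pos c → (pos c : ℤ) ≤ P (k + 2) →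
      T c = plain (k + 1) ∨ T c = plain (k + 2) := by
    intro c h3 h4
    rcases le_or_gt (pos c : ℤ) (P (k + 1)) with h5 | h5
    · exact Or.inl ((H.iff k (by omega) c).2 ⟨h3, h5⟩).2
    · exact Or.inr ((H.iff (k + 1) hk c).2 ⟨h5, h4⟩).2
  constructor
  · refine ⟨by rw [hP 0 (by omega), H.zero], fun j hj => ?_, fun j hj => ?_, fun j hj c => ?_⟩
    · by_cases hj1 : j = k + 1
      · subst hj1; rw [hP (k + 1 + 1) (by omega)]; exact h2
      · by_cases hj2 : j = k
        · subst hj2; rw [hP j (by omega)]; exact h1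
        · rw [hP j hj1, hP (j + 1) (by omega)]; exact H.mono j hj
    · by_cases hj1 : j = k + 1
      · subst hj1; omega
      · rw [hP j hj1]; exact H.le j hj
    · by_cases hc : P k < pos c ∧ (pos c : ℤ) ≤ P (k + 2)
      · have e1 := hin c hc.1 hc.2
        by_cases hj1 : j = k + 1
        · subst hj1
          rw [show k + 1 + 1 = k + 2 from rfl, hP (k + 2) (by omega), e1]
          split_ifs with hif
          · simp only [plain.injEq]; omega
          · simp only [and_true]; omega
        · by_cases hj2 : j = k
          · subst hj2
            rw [hP j (by omega), e1]
            split_ifs with hif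
            · simp only [and_true]; omega
            · simp only [plain.injEq]; omega
          · rw [hP j hj1, hP (j + 1) (by omega), ← H.iff j hj c, e1]
            rcases hTin c hc.1 hc.2 with e2 | e2 <;> rw [e2] <;> split_ifs <;>
              simp only [plain.injEq] <;> omega
      · by_cases hch : pos c ≤ h
        · rw [hout c hch hc]
          by_cases hj1 : j = k + 1
          · subst hj1
            rw [H.iff (k + 1) hj c, show k + 1 + 1 = k + 2 from rfl, hP (k + 2) (by omega)]
            omega
          · by_cases hj2 : j = k
            · subst hj2
              rw [hP j (by omega), H.iff j hj c]
              omega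
            · rw [hP j hj1, hP (j + 1) (by omega)]
              exact H.iff j hj c
        · have := H.le (j + 1) hj
          refine iff_of_false (fun h' => hch h'.1) fun h' => ?_
          by_cases hj2 : j = k
          · subst hj2; omega
          · rw [hP (j + 1) (by omega)] at h'
            omega
  · intro c y hch hy
    by_cases hc : P k < pos c ∧ (pos c : ℤ) ≤ P (k + 2)
    · have h3 := hy k (by omega)
      have h4 := hy (k + 1) hk
      have e1 := hin c hc.1 hc.2
      refine iff_of_false ?_ ?_
      · rcases hTin c hc.1 hc.2 with e2 | e2 <;> rw [e2] <;> exact Ne.symm ‹_›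
      · rw [e1]; split_ifs <;> exact Ne.symm ‹_›
    · rw [hout c hch hc]

/-! ## Pairs of columns and the reflection of counting functions -/

theorem ColEnc.nonneg {n h ℓ : ℕ} {T : Tableau ℓ} {P : ℕ → ℤ} (H : ColEnc n h T P) {j : ℕ}
    (hj : j < n) : 0 ≤ P j := by
  induction j with
  | zero => exact H.zero.ge
  | succ j ih => exact (ih (by omega)).trans (H.mono j hj)

/-- The first column is encoded by `P`, and the second one, read from below, by `Q`. -/
structure Enc (n h : ℕ) {ℓ : ℕ} (T : Tableau ℓ) (P Q : ℕ → ℤ) : Prop where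
  hle : h ≤ ℓ
  fst : ColEnc n h T P
  snd : ColEnc n (ℓ - h) (dual T) Q

theorem Enc.dual {n h ℓ : ℕ} {T : Tableau ℓ} {P Q : ℕ → ℤ} (H : Enc n h T P Q) :
    Enc n (ℓ - h) (dual T) Q P := by
  refine ⟨Nat.sub_le ℓ h, H.snd, ?_⟩
  rw [Nat.sub_sub_self H.hle, dual_dual]
  exact H.fst

theorem Enc.bar_iff {n h ℓ : ℕ} {T : Tableau ℓ} {P Q : ℕ → ℤ} (H : Enc n h T P Q) {j : ℕ}
    (hj : j + 1 < n) (c : Fin ℓ) : h < pos c ∧ T c = bar (j + 1) ↔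
      Q j < ℓ + 1 - pos c ∧ (ℓ : ℤ) + 1 - pos c ≤ Q (j + 1) := by
  have h1 := H.snd.iff j hj c.rev
  have h2 := pos_rev c
  have h3 := H.hle
  rw [dual_eq_plain, Fin.rev_rev, h2] at h1
  rw [← h1]
  exact and_congr_left fun _ => by omega

theorem Enc.exists_plain {n h ℓ : ℕ} {T : Tableau ℓ} {P Q : ℕ → ℤ} (H : Enc n h T P Q) {j : ℕ}
    (hj : j + 1 < n) {q : ℤ} (h1 : P j < q) (h2 : q ≤ P (j + 1)) :
    ∃ c : Fin ℓ, (pos c : ℤ) = q ∧ pos c ≤ h ∧ T c = plain (j + 1) := by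
  have h3 := H.fst.nonneg (j := j) (by omega)
  have h4 := H.fst.le (j + 1) hj
  have h5 := H.hle
  obtain ⟨c, hc⟩ := exists_pos (ℓ := ℓ) (q := q) (by omega) (by omega)
  obtain ⟨h6, h7⟩ := (H.fst.iff j hj c).2 ⟨by omega, by omega⟩
  exact ⟨c, hc, h6, h7⟩

theorem Enc.exists_bar {n h ℓ : ℕ} {T : Tableau ℓ} {P Q : ℕ → ℤ} (H : Enc n h T P Q) {j : ℕ}
    (hj : j + 1 < n) {q : ℤ} (h1 : Q j < q) (h2 : q ≤ Q (j + 1)) :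
    ∃ c : Fin ℓ, (pos c : ℤ) = ℓ + 1 - q ∧ h < pos c ∧ T c = bar (j + 1) := by
  have h3 := H.snd.nonneg (j := j) (by omega)
  have h4 := H.snd.le (j + 1) hj
  have h5 := H.hle
  obtain ⟨c, hc⟩ := exists_pos (ℓ := ℓ) (q := ℓ + 1 - q) (by omega) (by omega)
  obtain ⟨h6, h7⟩ := (H.bar_iff hj c).2 ⟨by omega, by omega⟩
  exact ⟨c, hc, h6, h7⟩

theorem Enc.partner_iff {n h ℓ : ℕ} {T : Tableau ℓ} {P Q : ℕ → ℤ} (H : Enc n h T P Q) {j : ℕ}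
    (hj : j + 1 < n) (d : ℤ) (c : Fin ℓ) :
    (∃ b : Fin ℓ, h + 1 ≤ pos b ∧ T b = bar (j + 1) ∧ (pos b : ℤ) - pos c = d) ↔
      Q j < ℓ + 1 - d - pos c ∧ (ℓ : ℤ) + 1 - d - pos c ≤ Q (j + 1) := by
  constructor
  · rintro ⟨b, h1, h2, h3⟩
    have := (H.bar_iff hj b).1 ⟨h1, h2⟩
    omega
  · rintro ⟨h1, h2⟩
    obtain ⟨b, h3, h4, h5⟩ := H.exists_bar hj h1 h2
    exact ⟨b, h4, h5, by omega⟩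

/-- Replacing `k + 1` by `k + 2` only lowers the threshold between these two letters. The hypothesis
`hpair` says that the entries with a partner are exactly those beyond the new threshold. -/
theorem Enc.push_fst {n h ℓ : ℕ} {T : Tableau ℓ} {P Q P' : ℕ → ℤ} (H : Enc n h T P Q) {k : ℕ}
    (hk : k + 2 < n) {d : ℤ} (hP : ∀ j, j ≠ k + 1 → P' j = P j) (h1 : P k ≤ P' (k + 1))
    (h2 : P' (k + 1) ≤ P (k + 1))
    (hpair : ∀ u : ℤ, P k < u → u ≤ P (k + 1) →
      (Q k < ℓ + 1 - d - u ∧ ℓ + 1 - d - u ≤ Q (k + 1) ↔ P' (k + 1) < u)) :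
    ColEnc n h (replacePairs h d (k + 1) (k + 2) T) P' ∧
      ColRest n h T (replacePairs h d (k + 1) (k + 2) T) := by
  have hm : P (k + 1) ≤ P (k + 2) := H.fst.mono (k + 1) hk
  refine H.fst.move hk hP h1 (by omega) (fun c h3 h4 => ?_) (fun c hch hc => ?_)
  · have hch : pos c ≤ h := by have := H.fst.le (k + 2) hk; omega
    have hi := H.fst.iff k (by omega) c
    have hpi := H.partner_iff (j := k) (by omega) d c
    unfold replacePairs
    by_cases h5 : (pos c : ℤ) ≤ P (k + 1)
    · have hx := (hi.2 ⟨h3, h5⟩).2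
      rw [hpair _ h3 h5] at hpi
      by_cases h6 : (pos c : ℤ) ≤ P' (k + 1)
      · rw [if_pos h6, if_neg (fun h' => by have := hpi.1 h'.2.2; omega),
          if_neg (fun h' => by omega), hx]
      · rw [if_neg h6, if_pos ⟨hch, hx, hpi.2 (by omega)⟩]
    · have hx := ((H.fst.iff (k + 1) hk c).2 ⟨by omega, h4⟩).2
      rw [if_neg (fun h' => h5 (hi.1 ⟨hch, h'.2.1⟩).2), if_neg (fun h' => by omega),
        if_neg (fun h' => by omega), hx]
  · unfold replacePairs
    rw [if_neg, if_neg (fun h' => by omega)]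
    rintro ⟨-, hx, -⟩
    have := (H.fst.iff k (by omega) c).1 ⟨hch, hx⟩
    exact hc ⟨this.1, by omega⟩

theorem Enc.pull_fst {n h ℓ : ℕ} {T : Tableau ℓ} {P Q P' : ℕ → ℤ} (H : Enc n h T P Q) {k : ℕ}
    (hk : k + 2 < n) {d : ℤ} (hP : ∀ j, j ≠ k + 1 → P' j = P j) (h1 : P (k + 1) ≤ P' (k + 1))
    (h2 : P' (k + 1) ≤ P (k + 2))
    (hpair : ∀ u : ℤ, P (k + 1) < u → u ≤ P (k + 2) →
      (Q (k + 1) < ℓ + 1 - d - u ∧ ℓ + 1 - d - u ≤ Q (k + 2) ↔ u ≤ P' (k + 1))) :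
    ColEnc n h (replacePairs h d (k + 2) (k + 1) T) P' ∧
      ColRest n h T (replacePairs h d (k + 2) (k + 1) T) := by
  have hm := H.fst.mono k (by omega)
  refine H.fst.move hk hP (by omega) h2 (fun c h3 h4 => ?_) (fun c hch hc => ?_)
  · have hch : pos c ≤ h := by have := H.fst.le (k + 2) hk; omega
    have hi := H.fst.iff (k + 1) (by omega) c
    have hpi := H.partner_iff (j := k + 1) (by omega) d c
    unfold replacePairs
    by_cases h5 : (pos c : ℤ) ≤ P (k + 1)
    · have hx := ((H.fst.iff k (by omega) c).2 ⟨h3, h5⟩).2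
      rw [if_neg (fun h' => by have := hi.1 ⟨hch, h'.2.1⟩; omega), if_neg (fun h' => by omega),
        if_pos (by omega), hx]
    · have hx := (hi.2 ⟨by omega, h4⟩).2
      rw [show k + 1 + 1 = k + 2 from rfl, hpair _ (by omega) h4] at hpi
      by_cases h6 : (pos c : ℤ) ≤ P' (k + 1)
      · rw [if_pos h6, if_pos ⟨hch, hx, hpi.2 h6⟩]
      · rw [if_neg h6, if_neg (fun h' => h6 (hpi.1 h'.2.2)), if_neg (fun h' => by omega), hx]
  · unfold replacePairs
    rw [if_neg, if_neg (fun h' => by omega)]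
    rintro ⟨-, hx, -⟩
    have := (H.fst.iff (k + 1) (by omega) c).1 ⟨hch, hx⟩
    exact hc ⟨by omega, this.2⟩

/-- The letters that are not encoded agree. -/
def Rest (n h : ℕ) {ℓ : ℕ} (T T' : Tableau ℓ) : Prop :=
  ColRest n h T T' ∧ ColRest n (ℓ - h) (dual T) (dual T')

theorem Rest.refl (n h : ℕ) {ℓ : ℕ} (T : Tableau ℓ) : Rest n h T T :=
  ⟨ColRest.refl n h T, ColRest.refl n (ℓ - h) (TypeD.dual T)⟩

theorem Rest.symm {n h ℓ : ℕ} {T T' : Tableau ℓ} (H : Rest n h T T') : Rest n h T' T :=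
  ⟨H.1.symm, H.2.symm⟩

theorem Rest.trans {n h ℓ : ℕ} {T T' T'' : Tableau ℓ} (H : Rest n h T T') (H' : Rest n h T' T'') :
    Rest n h T T'' := ⟨H.1.trans H'.1, H.2.trans H'.2⟩

theorem Rest.dual {n h ℓ : ℕ} (hh : h ≤ ℓ) {T T' : Tableau ℓ} (H : Rest n h T T') :
    Rest n (ℓ - h) (dual T) (dual T') := by
  refine ⟨H.2, ?_⟩
  rw [Nat.sub_sub_self hh, dual_dual, dual_dual]
  exact H.1

theorem Enc.eq_of_rest {n h ℓ : ℕ} {T T' : Tableau ℓ} {P Q : ℕ → ℤ} (H : Enc n h T P Q)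
    (H' : Enc n h T' P Q) (hR : Rest n h T T') : T = T' := by
  funext c
  by_cases hc : pos c ≤ h
  · exact H.fst.eq_of_colRest H'.fst hR.1 hc
  · have := pos_rev c
    have := H.hle
    have h1 := H.snd.eq_of_colRest H'.snd hR.2 (c := c.rev) (by omega)
    rw [dual_apply, dual_apply, Fin.rev_rev] at h1
    have h2 := congrArg Letter.dual h1
    rwa [dual_dual_letter, dual_dual_letter] at h2

/-- The second column is the first column of the dual tableau, and the replacement commutes with
duality, so the computation for one column is used twice. -/
theorem Enc.push {n h ℓ : ℕ} {T : Tableau ℓ} {P Q P' Q' : ℕ → ℤ} (H : Enc n h T P Q) {k : ℕ}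
    (hk : k + 2 < n) {d : ℤ} (hP : ∀ j, j ≠ k + 1 → P' j = P j ∧ Q' j = Q j)
    (h1 : P k ≤ P' (k + 1)) (h2 : P' (k + 1) ≤ P (k + 1)) (h3 : Q k ≤ Q' (k + 1))
    (h4 : Q' (k + 1) ≤ Q (k + 1))
    (hpair : ∀ u v : ℤ, u + v = ℓ + 1 - d → P k < u → u ≤ P (k + 1) →
      (Q k < v ∧ v ≤ Q (k + 1) ↔ P' (k + 1) < u))
    (hpair' : ∀ u v : ℤ, u + v = ℓ + 1 - d → Q k < v → v ≤ Q (k + 1) →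
      (P k < u ∧ u ≤ P (k + 1) ↔ Q' (k + 1) < v)) :
    Enc n h (replacePairs h d (k + 1) (k + 2) T) P' Q' ∧
      Rest n h T (replacePairs h d (k + 1) (k + 2) T) := by
  have e1 := H.push_fst hk (fun j hj => (hP j hj).1) h1 h2 (d := d)
    (fun u hu hu' => hpair u _ (by ring) hu hu')
  have e2 := H.dual.push_fst hk (fun j hj => (hP j hj).2) h3 h4 (d := d)
    (fun v hv hv' => hpair' _ v (by ring) hv hv')
  rw [replacePairs_dual H.hle] at e2
  exact ⟨⟨H.hle, e1.1, e2.1⟩, e1.2, e2.2⟩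

theorem Enc.pull {n h ℓ : ℕ} {T : Tableau ℓ} {P Q P' Q' : ℕ → ℤ} (H : Enc n h T P Q) {k : ℕ}
    (hk : k + 2 < n) {d : ℤ} (hP : ∀ j, j ≠ k + 1 → P' j = P j ∧ Q' j = Q j)
    (h1 : P (k + 1) ≤ P' (k + 1)) (h2 : P' (k + 1) ≤ P (k + 2)) (h3 : Q (k + 1) ≤ Q' (k + 1))
    (h4 : Q' (k + 1) ≤ Q (k + 2))
    (hpair : ∀ u v : ℤ, u + v = ℓ + 1 - d → P (k + 1) < u → u ≤ P (k + 2) →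
      (Q (k + 1) < v ∧ v ≤ Q (k + 2) ↔ u ≤ P' (k + 1)))
    (hpair' : ∀ u v : ℤ, u + v = ℓ + 1 - d → Q (k + 1) < v → v ≤ Q (k + 2) →
      (P (k + 1) < u ∧ u ≤ P (k + 2) ↔ v ≤ Q' (k + 1))) :
    Enc n h (replacePairs h d (k + 2) (k + 1) T) P' Q' ∧
      Rest n h T (replacePairs h d (k + 2) (k + 1) T) := by
  have e1 := H.pull_fst hk (fun j hj => (hP j hj).1) h1 h2 (d := d)
    (fun u hu hu' => hpair u _ (by ring) hu hu')
  have e2 := H.dual.pull_fst hk (fun j hj => (hP j hj).2) h3 h4 (d := d)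
    (fun v hv hv' => hpair' _ v (by ring) hv hv')
  rw [replacePairs_dual H.hle] at e2
  exact ⟨⟨H.hle, e1.1, e2.1⟩, e1.2, e2.2⟩

/-- Discrete intermediate values: the first and the last time at which `g` takes the value `c`. -/
theorem exists_hits {N : ℕ} {g : ℕ → ℤ} {c : ℤ} (h0 : g 0 < c)
    (hg : ∀ j < N, g (j + 1) ≤ g j + 1) (hN : c ≤ g N) :
    ∃ k₀ k₁, 1 ≤ k₀ ∧ k₀ ≤ k₁ ∧ k₁ ≤ N ∧ (∀ j < k₀, g j < c) ∧ g k₀ = c ∧ g k₁ = c ∧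
      ∀ j, k₁ < j → j ≤ N → c < g j := by
  have hex : ∃ j, c ≤ g j := ⟨N, hN⟩
  set k₀ := Nat.find hex with hk₀
  have h1 : c ≤ g k₀ := Nat.find_spec hex
  have h2 : ∀ j < k₀, g j < c := fun j hj => not_le.1 (Nat.find_min hex hj)
  have h3 : k₀ ≤ N := Nat.find_min' hex hN
  have h4 : 1 ≤ k₀ := by
    by_contra hcon
    have : k₀ = 0 := by omega
    rw [this] at h1
    omega
  have h5 : g k₀ = c := by
    have := h2 (k₀ - 1) (by omega)
    have := hg (k₀ - 1) (by omega)
    rw [Nat.sub_add_cancel h4] at this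
    omega
  have h6 := Nat.findGreatest_spec (P := fun j => g j ≤ c) h3 h5.le
  set k₁ := Nat.findGreatest (fun j => g j ≤ c) N with hk₁
  have h7 : k₀ ≤ k₁ := Nat.le_findGreatest h3 h5.le
  have h8 : k₁ ≤ N := Nat.findGreatest_le N
  have h9 : ∀ j, k₁ < j → j ≤ N → c < g j := fun j hj hjN =>
    not_le.1 (Nat.findGreatest_is_greatest hj hjN)
  refine ⟨k₀, k₁, h4, h7, h8, h2, h5, ?_, h9⟩
  rcases h8.lt_or_eq with h | h
  · have := h9 (k₁ + 1) (by omega) (by omega)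
    have := hg k₁ h
    change g k₁ ≤ c at h6
    omega
  · change g k₁ ≤ c at h6
    rw [h] at h6 ⊢
    omega

/-- The pair `(P', Q')` is obtained from `(P, Q)` by a reflection at the level `c` of
`j - P j - Q j`, between the first and the last time at which this level is reached. -/
structure Seg (n : ℕ) (c : ℤ) (P Q P' Q' : ℕ → ℤ) (k₀ k₁ : ℕ) : Prop where
  pos : 1 ≤ k₀
  le : k₀ ≤ k₁
  lt : k₁ < n
  pre : ∀ j < k₀, P' j = P j ∧ Q' j = Q j ∧ (j : ℤ) - P j - Q j < c
  mid : ∀ j, k₀ ≤ j → j ≤ k₁ → P' j = j - c - Q j ∧ Q' j = j - c - P j ∧ (j : ℤ) - P j - Q j ≤ c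
  left : (k₀ : ℤ) - P k₀ - Q k₀ = c
  right : (k₁ : ℤ) - P k₁ - Q k₁ = c
  post : ∀ j < n, k₁ < j → P' j = P j ∧ Q' j = Q j ∧ c < (j : ℤ) - P j - Q j

theorem Seg.swap {n : ℕ} {c : ℤ} {P Q P' Q' : ℕ → ℤ} {k₀ k₁ : ℕ} (H : Seg n c P Q P' Q' k₀ k₁) :
    Seg n c Q P Q' P' k₀ k₁ where
  pos := H.pos
  le := H.le
  lt := H.lt
  pre j hj := by have := H.pre j hj; omega
  mid j h1 h2 := by have := H.mid j h1 h2; omega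
  left := by have := H.left; omega
  right := by have := H.right; omega
  post j hj h1 := by have := H.post j hj h1; omega

theorem Seg.cases {n : ℕ} {c : ℤ} {P Q P' Q' : ℕ → ℤ} {k₀ k₁ : ℕ} (H : Seg n c P Q P' Q' k₀ k₁)
    {j : ℕ} (hj : j < n) :
    (j < k₀ ∧ P' j = P j ∧ Q' j = Q j ∧ (j : ℤ) - P j - Q j < c) ∨
    (k₀ ≤ j ∧ j ≤ k₁ ∧ P' j = j - c - Q j ∧ Q' j = j - c - P j ∧ (j : ℤ) - P j - Q j ≤ c ∧
      (j = k₀ → (j : ℤ) - P j - Q j = c) ∧ (j = k₁ → (j : ℤ) - P j - Q j = c)) ∨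
    (k₁ < j ∧ P' j = P j ∧ Q' j = Q j ∧ c < (j : ℤ) - P j - Q j) := by
  rcases lt_or_ge j k₀ with h | h
  · exact Or.inl ⟨h, H.pre j h⟩
  · rcases le_or_gt j k₁ with h' | h'
    · refine Or.inr (Or.inl ⟨h, h', (H.mid j h h').1, (H.mid j h h').2.1, (H.mid j h h').2.2, ?_, ?_⟩)
      · rintro rfl; exact H.left
      · rintro rfl; exact H.right
    · exact Or.inr (Or.inr ⟨h', H.post j hj h'⟩)

/-- Inside the segment an increment of `P'` is 1 minus the increment of `Q`, so it is again 0 or 1.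
At both ends the level is `c`, where old and new values agree, and the pieces fit together. -/
theorem Seg.steps {n : ℕ} {c : ℤ} {P Q P' Q' : ℕ → ℤ} {k₀ k₁ : ℕ} (H : Seg n c P Q P' Q' k₀ k₁)
    (hP : Steps n P) (hQ : Steps n Q) (hmP : ∀ j, j + 1 < n → P j ≤ P (j + 1))
    (hmQ : ∀ j, j + 1 < n → Q j ≤ Q (j + 1)) {j : ℕ} (hj : j + 1 < n) :
    P' j ≤ P' (j + 1) ∧ P' (j + 1) ≤ P' j + 1 ∧ Q' j ≤ Q' (j + 1) ∧ Q' (j + 1) ≤ Q' j + 1 := by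
  have := hP j hj
  have := hQ j hj
  have := hmP j hj
  have := hmQ j hj
  have e1 := H.cases (j := j) (by omega)
  have e2 := H.cases hj
  push_cast at e2
  omega

theorem Seg.steps' {n : ℕ} {c : ℤ} {P Q P' Q' : ℕ → ℤ} {k₀ k₁ : ℕ} (H : Seg n c P Q P' Q' k₀ k₁)
    (hP : Steps n P') (hQ : Steps n Q') (hmP : ∀ j, j + 1 < n → P' j ≤ P' (j + 1))
    (hmQ : ∀ j, j + 1 < n → Q' j ≤ Q' (j + 1)) {j : ℕ} (hj : j + 1 < n) :
    P j ≤ P (j + 1) ∧ P (j + 1) ≤ P j + 1 ∧ Q j ≤ Q (j + 1) ∧ Q (j + 1) ≤ Q j + 1 := by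
  have := hP j hj
  have := hQ j hj
  have := hmP j hj
  have := hmQ j hj
  have e1 := H.cases (j := j) (by omega)
  have e2 := H.cases hj
  push_cast at e2
  omega

/-- The condition (D.4) for the counting functions. -/
theorem CondD4.ne {n h r ℓ : ℕ} {T : Tableau ℓ} {P Q : ℕ → ℤ} (H : CondD4 n h r T)
    (hE : Enc n h T P Q) (hr : 1 ≤ r) {j : ℕ} (hj : j + 1 < n) (h1 : P (j + 1) = P j + 1)
    (h2 : Q (j + 1) = Q j + 1) : (ℓ : ℤ) + 1 - P (j + 1) - Q (j + 1) ≠ n - r - (j + 1) := by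
  intro h3
  obtain ⟨a, ha, hah, hx⟩ := hE.exists_plain hj (q := P (j + 1)) (by omega) le_rfl
  obtain ⟨b, hb, hbh, hy⟩ := hE.exists_bar hj (q := Q (j + 1)) (by omega) le_rfl
  refine H ⟨a, b, j + 1, hah, hbh, hx, hy, ?_⟩
  rw [max_eq_left hr]
  push_cast
  omega

theorem condD4_of_ne {n h r ℓ : ℕ} {T : Tableau ℓ} {P Q : ℕ → ℤ} (hE : Enc n h T P Q)
    (hT : ∀ a, (T a).Valid n) (hr : 1 ≤ r) (hP : Steps n P) (hQ : Steps n Q)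
    (H : ∀ j, j + 1 < n → P (j + 1) = P j + 1 → Q (j + 1) = Q j + 1 →
      (ℓ : ℤ) + 1 - P (j + 1) - Q (j + 1) ≠ n - r - (j + 1)) : CondD4 n h r T := by
  rintro ⟨a, b, k, hah, hbh, hx, hy, hd⟩
  rw [max_eq_left hr] at hd
  have hv := hT a
  rw [hx] at hv
  obtain ⟨j, rfl⟩ : ∃ j, k = j + 1 := ⟨k - 1, by have := hv.1; omega⟩
  have hj : j + 1 < n := by omega
  have h1 := (hE.fst.iff j hj a).1 ⟨hah, hx⟩
  have h2 := (hE.bar_iff hj b).1 ⟨hbh, hy⟩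
  have h3 := hP j hj
  have h4 := hQ j hj
  refine H j hj (by omega) (by omega) ?_
  push_cast at hd
  omega

/-- The path `j - P j - Q j` starts at `0 < c` and ends at a value at least `n - 1 - ℓ ≥ c`, so it
meets the level `c`. It can decrease only by a double step, and (D.4) forbids one from `c + 1` to
`c`; so, going back from the last visit, it never exceeds `c`. -/
theorem exists_seg {n h r ℓ : ℕ} (hn : ℓ + 2 + r ≤ n) (hr : 1 ≤ r) {T : Tableau ℓ} {P Q : ℕ → ℤ}
    (H : CondD4 n h r T) (hE : Enc n h T P Q) (hP : Steps n P) (hQ : Steps n Q) :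
    ∃ P' Q' k₀ k₁, Seg n (n - ℓ - 1 - r) P Q P' Q' k₀ k₁ := by
  have hh := hE.hle
  have l1 := hE.fst.le (n - 1) (by omega)
  have l2 := hE.snd.le (n - 1) (by omega)
  obtain ⟨k₀, k₁, a1, a2, a3, a4, a5, a6, a7⟩ := exists_hits (N := n - 1)
    (g := fun j => (j : ℤ) - P j - Q j) (c := n - ℓ - 1 - r)
    (by simp only [hE.fst.zero, hE.snd.zero]; push_cast; omega)
    (fun j hj => by
      have := hE.fst.mono j (by omega)
      have := hE.snd.mono j (by omega)
      push_cast
      omega)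
    (by omega)
  have key : ∀ d j, j + d = k₁ → (j : ℤ) - P j - Q j ≤ n - ℓ - 1 - r := by
    intro d
    induction d with
    | zero => rintro j rfl; exact a6.le
    | succ d ih =>
      intro j hj
      have h1 := ih (j + 1) (by omega)
      have h2 := hP j (by omega)
      have h3 := hQ j (by omega)
      have h4 := H.ne hE hr (j := j) (by omega)
      push_cast at h1
      omega
  refine ⟨fun j => if k₀ ≤ j ∧ j ≤ k₁ then j - (n - ℓ - 1 - r) - Q j else P j,
    fun j => if k₀ ≤ j ∧ j ≤ k₁ then j - (n - ℓ - 1 - r) - P j else Q j, k₀, k₁, a1, a2, by omega,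
    fun j hj => ?_, fun j h1 h2 => ?_, a5, a6, fun j h1 h2 => ?_⟩
  · rw [if_neg (by omega), if_neg (by omega)]
    exact ⟨rfl, rfl, a4 j hj⟩
  · rw [if_pos ⟨h1, h2⟩, if_pos ⟨h1, h2⟩]
    exact ⟨rfl, rfl, key (k₁ - j) j (by omega)⟩
  · rw [if_neg (by omega), if_neg (by omega)]
    exact ⟨rfl, rfl, a7 j h2 (by omega)⟩

/-- Here (D.4) for `r + 1` forbids the descent from `c` to `c - 1`, so after the first visit the
path never falls below `c`, and its reflection lies below or on the level. -/
theorem exists_seg' {n h r ℓ : ℕ} (hn : ℓ + 2 + r ≤ n) {T : Tableau ℓ} {P' Q' : ℕ → ℤ}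
    (H : CondD4 n h (r + 1) T) (hE : Enc n h T P' Q') (hP : Steps n P') (hQ : Steps n Q') :
    ∃ P Q k₀ k₁, Seg n (n - ℓ - 1 - r) P Q P' Q' k₀ k₁ := by
  have hh := hE.hle
  have l1 := hE.fst.le (n - 1) (by omega)
  have l2 := hE.snd.le (n - 1) (by omega)
  obtain ⟨k₀, k₁, a1, a2, a3, a4, a5, a6, a7⟩ := exists_hits (N := n - 1)
    (g := fun j => (j : ℤ) - P' j - Q' j) (c := n - ℓ - 1 - r)
    (by simp only [hE.fst.zero, hE.snd.zero]; push_cast; omega)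
    (fun j hj => by
      have := hE.fst.mono j (by omega)
      have := hE.snd.mono j (by omega)
      push_cast
      omega)
    (by omega)
  have key : ∀ d, k₀ + d ≤ k₁ → n - ℓ - 1 - r ≤ ((k₀ + d : ℕ) : ℤ) - P' (k₀ + d) - Q' (k₀ + d) := by
    intro d
    induction d with
    | zero => intro _; exact a5.ge
    | succ d ih =>
      intro hj
      have h1 := ih (by omega)
      have h2 := hP (k₀ + d) (by omega)
      have h3 := hQ (k₀ + d) (by omega)
      have h4 := H.ne hE (by omega) (j := k₀ + d) (by omega)
      rw [← add_assoc]
      push_cast at h1 h4 ⊢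
      omega
  refine ⟨fun j => if k₀ ≤ j ∧ j ≤ k₁ then j - (n - ℓ - 1 - r) - Q' j else P' j,
    fun j => if k₀ ≤ j ∧ j ≤ k₁ then j - (n - ℓ - 1 - r) - P' j else Q' j, k₀, k₁, a1, a2, by omega,
    fun j hj => ?_, fun j h1 h2 => ?_, ?_, ?_, fun j h1 h2 => ?_⟩
  · rw [if_neg (by omega), if_neg (by omega)]
    exact ⟨rfl, rfl, a4 j hj⟩
  · rw [if_pos ⟨h1, h2⟩, if_pos ⟨h1, h2⟩]
    have := key (j - k₀) (by omega)
    rw [Nat.add_sub_cancel' h1] at this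
    omega
  · rw [if_pos ⟨le_rfl, a2⟩, if_pos ⟨le_rfl, a2⟩]
    omega
  · rw [if_pos ⟨a2, le_rfl⟩, if_pos ⟨a2, le_rfl⟩]
    omega
  · rw [if_neg (by omega), if_neg (by omega)]
    exact ⟨rfl, rfl, a7 j h2 (by omega)⟩

/-! ### The replacements carry out the reflection -/

/-- The counting function in the course of the computation of `sigma`. -/
def stage (P' P : ℕ → ℤ) (m j : ℕ) : ℤ := if j ≤ m then P' j else P j

theorem stage_of_le {P' P : ℕ → ℤ} {m j : ℕ} (h : j ≤ m) : stage P' P m j = P' j := if_pos h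

theorem stage_of_lt {P' P : ℕ → ℤ} {m j : ℕ} (h : m < j) : stage P' P m j = P j :=
  if_neg (by omega)

theorem stage_succ {P' P : ℕ → ℤ} {m j : ℕ} (h : j ≠ m + 1) :
    stage P' P (m + 1) j = stage P' P m j := by
  unfold stage
  split_ifs <;> first | rfl | omega

/-- After the steps `1, …, m` the thresholds up to `m` have their reflected values and the later
ones are untouched: the step for `k` changes the thresholds at `k` only. -/
theorem enc_sigma {n ℓ h r : ℕ} (hn : ℓ + 2 + r ≤ n) (hr : 1 ≤ r) {T : Tableau ℓ}
    {P Q P' Q' : ℕ → ℤ} {k₀ k₁ : ℕ} (hE : Enc n h T P Q) (hP : Steps n P) (hQ : Steps n Q)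
    (hS : Seg n (n - ℓ - 1 - r) P Q P' Q' k₀ k₁) :
    Enc n h (sigma n ℓ h r T) P' Q' ∧ Rest n h T (sigma n ℓ h r T) := by
  have key : ∀ m ≤ n - r - 1,
      Enc n h ((List.range' 1 m).foldl (fun (U : Tableau ℓ) (k : ℕ) =>
        replacePairs h ((n : ℤ) - r - k - 1) k (k + 1) U) T) (stage P' P m) (stage Q' Q m) ∧
      Rest n h T ((List.range' 1 m).foldl (fun (U : Tableau ℓ) (k : ℕ) =>
        replacePairs h ((n : ℤ) - r - k - 1) k (k + 1) U) T) := by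
    intro m
    induction m with
    | zero =>
      intro _
      have h0 := hS.pre 0 hS.pos
      refine ⟨⟨hE.hle, hE.fst.of_eq (fun j _ => ?_) (by omega),
        hE.snd.of_eq (fun j _ => ?_) (by omega)⟩, Rest.refl n h T⟩ <;> unfold stage <;>
        split_ifs with hj
      · obtain rfl : j = 0 := by omega
        exact h0.1
      · rfl
      · obtain rfl : j = 0 := by omega
        exact h0.2.1
      · rfl
    | succ m ih =>
      intro hm
      obtain ⟨ih1, ih2⟩ := ih (by omega)
      rw [List.range'_concat, List.foldl_append, (by omega : 1 + 1 * m = m + 1)]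
      have e1 := hS.cases (j := m) (by omega)
      have e2 := hS.cases (j := m + 1) (by omega)
      have e3 := hP m (by omega)
      have e4 := hQ m (by omega)
      have e5 := hE.fst.mono m (by omega)
      have e6 := hE.snd.mono m (by omega)
      push_cast at e2
      have hpush := ih1.push (k := m) (by omega) (P' := stage P' P (m + 1))
        (Q' := stage Q' Q (m + 1)) (d := (n : ℤ) - r - ((m + 1 : ℕ) : ℤ) - 1)
        (fun j hj => ⟨stage_succ hj, stage_succ hj⟩)
      simp only [stage_of_le (le_refl m), stage_of_le (le_refl (m + 1)),
        stage_of_lt (Nat.lt_add_one m)] at hpush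
      -- The rows `u` and `v`, counted from the top and from the bottom, of a pair at the prescribed
      -- distance satisfy `u + v = m + 2 - c`. Inside the segment `v ≤ Q (m + 1)` then says exactly
      -- `u > P' (m + 1)`, and the bound `v > Q' m` says `u ≤ P m + 1`, which is automatic.
      have := hpush (by omega) (by omega) (by omega) (by omega)
        (fun u v huv h1 h2 => by push_cast at huv; omega)
        (fun u v huv h1 h2 => by push_cast at huv; omega)
      exact ⟨this.1, ih2.trans this.2⟩
  obtain ⟨h1, h2⟩ := key (n - r - 1) le_rfl
  refine ⟨⟨hE.hle, h1.fst.of_eq (fun j hj => ?_) (by omega),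
    h1.snd.of_eq (fun j hj => ?_) (by omega)⟩, h2⟩
  -- The steps end late enough: from `P k₁ + Q k₁ ≤ ℓ` one gets `k₁ ≤ c + ℓ = n - r - 1`, beyond
  -- which nothing is reflected.
  all_goals
    have := hE.fst.le k₁ hS.lt
    have := hE.snd.le k₁ hS.lt
    have := hE.hle
    have := hS.right
    have := hS.cases hj
    unfold stage
    split_ifs <;> omega

/-- The thresholds are restored from above. The step for `k` changes the thresholds at `k - 1`, so
only `2, …, n - r - 2` are visited. This suffices: at `j ≤ 1` and at `j ≥ n - r - 1` the path lies
outside the segment or at one of its ends, where the reflection changes nothing. -/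
theorem enc_sigmaInv {n ℓ h r : ℕ} (hn : ℓ + 2 + r ≤ n) (hr : 1 ≤ r) {T : Tableau ℓ}
    {P Q P' Q' : ℕ → ℤ} {k₀ k₁ : ℕ} (hE : Enc n h T P' Q') (hP : Steps n P') (hQ : Steps n Q')
    (hS : Seg n (n - ℓ - 1 - r) P Q P' Q' k₀ k₁) :
    Enc n h (sigmaInv n ℓ h (r + 1) T) P Q ∧ Rest n h T (sigmaInv n ℓ h (r + 1) T) := by
  have key : ∀ m, m + r + 3 ≤ n → ∀ U : Tableau ℓ,
      Enc n h U (stage P' P (m + 1)) (stage Q' Q (m + 1)) →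
      Enc n h ((List.range' 3 m).reverse.foldl (fun (U : Tableau ℓ) (k : ℕ) =>
        replacePairs h ((n : ℤ) - (r + 1 : ℕ) - k + 1) k (k - 1) U) U) (stage P' P 1) (stage Q' Q 1) ∧
      Rest n h U ((List.range' 3 m).reverse.foldl (fun (U : Tableau ℓ) (k : ℕ) =>
        replacePairs h ((n : ℤ) - (r + 1 : ℕ) - k + 1) k (k - 1) U) U) := by
    intro m
    induction m with
    | zero => exact fun _ U hU => ⟨hU, Rest.refl n h U⟩
    | succ m ih =>
      intro hm U hU
      rw [List.range'_concat, List.reverse_append, List.reverse_singleton, List.singleton_append,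
        List.foldl_cons, (by omega : 3 + 1 * m = m + 3), (by omega : m + 3 - 1 = m + 2)]
      have e1 := hS.cases (j := m + 2) (by omega)
      have e2 := hS.cases (j := m + 3) (by omega)
      have e3 : P' (m + 3) ≤ P' (m + 2) + 1 := hP (m + 2) (by omega)
      have e4 : Q' (m + 3) ≤ Q' (m + 2) + 1 := hQ (m + 2) (by omega)
      have hs := fun j (hj : j + 1 < n) => hS.steps' hP hQ hE.fst.mono hE.snd.mono hj
      have e5 := hs (m + 2) (by omega)
      rw [show m + 2 + 1 = m + 3 from rfl] at e5
      push_cast at e1 e2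
      have hpull := hU.pull (k := m + 1) (by omega) (P' := stage P' P (m + 1))
        (Q' := stage Q' Q (m + 1)) (d := (n : ℤ) - (r + 1 : ℕ) - ((m + 3 : ℕ) : ℤ) + 1)
        (fun j hj => ⟨(stage_succ hj).symm, (stage_succ hj).symm⟩)
      simp only [show m + 1 + 1 = m + 2 from rfl, show m + 1 + 2 = m + 3 from rfl,
        stage_of_le (le_refl (m + 2)), stage_of_lt (Nat.lt_add_one (m + 1)),
        stage_of_lt (Nat.lt_add_one (m + 2))] at hpull
      have := hpull (by omega) (by omega) (by omega) (by omega)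
        (fun u v huv h1 h2 => by push_cast at huv; omega)
        (fun u v huv h1 h2 => by push_cast at huv; omega)
      obtain ⟨h1, h2⟩ := ih (by omega) _ this.1
      exact ⟨h1, this.2.trans h2⟩
  have hk := hS.right
  have hk1 := hE.fst.le k₁ hS.lt
  have hk2 := hE.snd.le k₁ hS.lt
  have hk3 := hS.mid k₁ hS.le le_rfl
  have hle := hE.hle
  have hs1 := hS.pos
  have hcase : ∀ j < n, (j ≤ 1 ∨ n - r - 1 ≤ j) → P j = P' j ∧ Q j = Q' j := by
    intro j hj h1
    have := hS.cases hj
    omega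
  unfold sigmaInv
  rw [if_neg (by omega)]
  by_cases hsmall : n - (r + 1) - 2 = 0
  · rw [hsmall]
    refine ⟨⟨hE.hle, hE.fst.of_eq (fun j hj => (hcase j hj (by omega)).1) (by omega),
      hE.snd.of_eq (fun j hj => (hcase j hj (by omega)).2) (by omega)⟩, Rest.refl n h T⟩
  have hstart : Enc n h T (stage P' P (n - (r + 1) - 2 + 1)) (stage Q' Q (n - (r + 1) - 2 + 1)) := by
    refine ⟨hE.hle, hE.fst.of_eq (fun j hj => ?_) (by omega),
      hE.snd.of_eq (fun j hj => ?_) (by omega)⟩ <;> unfold stage <;> split_ifs with h3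
    · rfl
    · exact (hcase j hj (by omega)).1
    · rfl
    · exact (hcase j hj (by omega)).2
  obtain ⟨h1, h2⟩ := key (n - (r + 1) - 2) (by omega) T hstart
  refine ⟨⟨hE.hle, h1.fst.of_eq (fun j hj => ?_) (by omega),
    h1.snd.of_eq (fun j hj => ?_) (by omega)⟩, h2⟩ <;> unfold stage <;> split_ifs with h3
  · exact (hcase j hj (by omega)).1
  · rfl
  · exact (hcase j hj (by omega)).2
  · rfl

/-! ## The reflection preserves the conditions (D.1) to (D.7) -/

theorem condD1_iff {n ℓ h : ℕ} (hh : h ≤ ℓ) {T : Tableau ℓ} :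
    CondD1 n h T ↔ ColD1 n h T ∧ ColD1 n (ℓ - h) (dual T) := by
  constructor
  · intro H
    refine ⟨fun a b hab hb => H a b hab (by unfold SameColumn; omega), fun a b hab hb => ?_⟩
    exact condD1_dual hh H a b hab (by unfold SameColumn; omega)
  · rintro ⟨H1, H2⟩ a b hab hc
    by_cases hb : pos b ≤ h
    · exact H1 a b hab hb
    · have h1 := pos_rev a
      have h2 := pos_rev b
      have := H2 b.rev a.rev (by omega) (by unfold SameColumn at hc; omega)
      rwa [dual_apply, dual_apply, le_dual, Fin.rev_rev, Fin.rev_rev] at this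

theorem ColRest.valid {n h ℓ : ℕ} {T T' : Tableau ℓ}
    (hT : ∀ a, (T a).Valid n) (hR : ColRest n h T T') (c : Fin ℓ)
    (hc : pos c ≤ h) : (T' c).Valid n := by
  by_cases hx : ∃ j, j + 1 < n ∧ T' c = plain (j + 1)
  · obtain ⟨j, hj, hx⟩ := hx
    rw [hx]
    exact ⟨by omega, hj.le⟩
  · push Not at hx
    rw [← (hR c (T' c) hc hx).2 rfl]
    exact hT c

theorem Rest.valid {n h ℓ : ℕ} {T T' : Tableau ℓ} (hh : h ≤ ℓ) (hT : ∀ a, (T a).Valid n)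
    (hR : Rest n h T T') (c : Fin ℓ) : (T' c).Valid n := by
  by_cases hc : pos c ≤ h
  · exact hR.1.valid hT c hc
  · have := pos_rev c
    have h1 := hR.2.valid (forall_dual_valid hT) c.rev (by omega)
    rwa [dual_apply, Fin.rev_rev, dual_valid] at h1

/-- Above an encoded letter all letters are encoded, and the thresholds put them in increasing
order. Below an encoded letter, any unencoded letter is larger. Two consecutive unencoded letters
are those of the old column. -/
theorem ColEnc.colD1 {n h ℓ : ℕ} {T T' : Tableau ℓ} {P' : ℕ → ℤ}
    (H' : ColEnc n h T' P') (hP' : Steps n P') (hT' : ∀ a, (T' a).Valid n)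
    (hR : ColRest n h T T') (hD : ColD1 n h T) : ColD1 n h T' := by
  intro a b hab hb
  by_cases hy : ∃ j, j + 1 < n ∧ T' b = plain (j + 1)
  · obtain ⟨j, hj, hy⟩ := hy
    have hb' := (H'.iff j hj b).1 ⟨hb, hy⟩
    have hs := hP' j hj
    -- the letter above is encoded and smaller
    have key : ∀ i ≤ j, 1 ≤ pos a → (pos a : ℤ) ≤ P' i → ∃ i' < i, T' a = plain (i' + 1) := by
      intro i
      induction i with
      | zero =>
        intro _ h1 h2
        rw [H'.zero] at h2
        omega
      | succ i ih =>
        intro hi h1 h2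
        rcases le_or_gt (pos a : ℤ) (P' i) with h3 | h3
        · obtain ⟨i', h4, h5⟩ := ih (by omega) h1 h3
          exact ⟨i', by omega, h5⟩
        · exact ⟨i, by omega, ((H'.iff i (by omega) a).2 ⟨h3, h2⟩).2⟩
    obtain ⟨i', h4, h5⟩ := key j le_rfl (pos_pos a) (by omega)
    rw [hy, h5]
    simp only [Le]
    omega
  · have hy' := hy
    push Not at hy
    have hTb := (hR b (T' b) hb hy).2 rfl
    by_cases hx : ∃ j, j + 1 < n ∧ T' a = plain (j + 1)
    · obtain ⟨j, hj, hx⟩ := hx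
      rw [not_le_iff (hT' a) (hT' b)]
      left
      rw [hx]
      have hvb := hT' b
      generalize T' b = y at hy' hvb
      cases y with
      | plain i =>
        simp only [Valid] at hvb
        have : ¬i < n := fun hi => hy' ⟨i - 1, by omega, by rw [Nat.sub_add_cancel hvb.1]⟩
        simp only [Letter.ht]
        omega
      | bar i =>
        simp only [Valid] at hvb
        simp only [Letter.ht]
        omega
    · push Not at hx
      have hTa := (hR a (T' a) (by omega) hx).2 rfl
      rw [← hTa, ← hTb]
      exact hD a b hab hb

/-- Barred letters of the first column do not move. If the threshold of the letter `k` is a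
reflected one, then `n - 1 - k` rows below this letter is the row `ℓ + r - Q k ≥ h + r > h`, outside
the first column; otherwise the pair was already present. The form of `hS` serves both directions of
the reflection. -/
theorem condD2_of_seg {n ℓ h r : ℕ} (hr : 1 ≤ r) {c : ℤ} (hc : c = n - ℓ - 1 - r)
    {T T' : Tableau ℓ} {P Q P' Q' : ℕ → ℤ} (hE : Enc n h T P Q)
    (hE' : Enc n h T' P' Q') (hP' : Steps n P') (hT' : ∀ a, (T' a).Valid n)
    (hR : Rest n h T T')
    (hS : ∀ j, j + 1 < n → (P' j = P j ∧ P' (j + 1) = P (j + 1)) ∨ P' (j + 1) = j + 1 - c - Q (j + 1))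
    (H : CondD2 n h T) : CondD2 n h T' := by
  rintro ⟨a, b, k, hab, hb, hx, hy, hd⟩
  have hv := hT' a
  rw [hx] at hv
  obtain ⟨j, rfl⟩ : ∃ j, k = j + 1 := ⟨k - 1, by have := hv.1; omega⟩
  have hj : j + 1 < n := by omega
  have hTb : T b = bar (j + 1) := (hR.1 b _ hb (by simp)).2 hy
  have h1 := (hE'.fst.iff j hj a).1 ⟨by omega, hx⟩
  have h2 := hP' j hj
  rcases hS j hj with ⟨h3, h4⟩ | h3
  · have := ((hE.fst.iff j hj a).2 (by omega)).2
    exact H ⟨a, b, j + 1, hab, hb, this, hTb, hd⟩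
  · have := hE.snd.le (j + 1) hj
    have := hE.hle
    push_cast at hd
    omega

theorem Seg.d2_cases {n : ℕ} {c : ℤ} {P Q P' Q' : ℕ → ℤ} {k₀ k₁ : ℕ}
    (H : Seg n c P Q P' Q' k₀ k₁) {j : ℕ} (hj : j + 1 < n) :
    ((P' j = P j ∧ P' (j + 1) = P (j + 1)) ∨ P' (j + 1) = j + 1 - c - Q (j + 1)) ∧
    ((P j = P' j ∧ P (j + 1) = P' (j + 1)) ∨ P (j + 1) = j + 1 - c - Q' (j + 1)) := by
  have e1 := H.cases (j := j) (by omega)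
  have e2 := H.cases hj
  push_cast at e2
  omega

/-- If (D.7) fails, then both letters at the seam are unencoded, hence unchanged by the reflection.
-/
theorem condD7_of_rest {n ℓ h : ℕ} (hh : h ≤ ℓ) {T T' : Tableau ℓ} (hT' : ∀ a, (T' a).Valid n)
    (hR : Rest n h T T') (H : CondD7 n h T) : CondD7 n h T' := by
  intro x y hx hy hTy hle
  have h1 := pos_rev y
  have hxv := hT' x
  have hTy' : T y = T' y := by
    have := (hR.2 y.rev (dual T' y.rev) (by omega) (fun j hj hcon => by
      rw [dual_eq_plain, Fin.rev_rev] at hcon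
      rcases hTy with h | h <;> rw [h] at hcon <;> simp at hcon
      omega)).2 rfl
    rw [dual_apply, dual_apply, Fin.rev_rev] at this
    exact (dual_dual_letter (T y)).symm.trans ((congrArg _ this).trans (dual_dual_letter _))
  have hTx' : T x = T' x := by
    refine (hR.1 x (T' x) hx.le fun j hj hcon => ?_).2 rfl
    rw [hcon] at hle
    rcases hTy with h | h <;> rw [h] at hle <;> simp only [Le] at hle
    omega
  rw [← hTx', ← hTy'] at hle
  exact H x y hx hy (by rwa [hTy']) hle

/-- The run of letters required by (D.6) becomes a run of unit steps of `P` ending at `P (K + 1)`.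
It lies in the first column, because the second one starts with a barred letter and contains no
smaller letter after it. -/
theorem condD6_steps {n ℓ h r : ℕ} {T : Tableau ℓ} {P Q : ℕ → ℤ} (hE : Enc n h T P Q)
    (hT : ∀ a, (T a).Valid n) (hD : CondD1 n h T) (hP : Steps n P) (H : CondD6 n h r T)
    {x y : Fin ℓ} (hx : pos x = h) (hy : pos y = h + 1) {κ K : ℕ} (hK : K + 1 < n)
    (hTx : T x = bar (κ + 1)) (hTy : T y = bar (K + 1)) (hκK : κ ≤ K) :
    (∀ j, κ ≤ j → j ≤ K → P (j + 1) = P j + 1) ∧ (n : ℤ) - r - (K + 1) ≤ h - P (K + 1) ∧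
      (h : ℤ) - P (K + 1) < n - (K + 1) - 1 := by
  obtain ⟨k', -, -, hk', a, hcell, h1, h2⟩ := H x y hx hy (K + 1) (by omega) hK hTy
    (by rw [hTx, hTy]; simp only [Le]; omega)
  rw [hTx, bar.injEq] at hk'
  subst hk'
  have key : ∀ j, κ ≤ j → j ≤ K → P (j + 1) = P j + 1 ∧ P (j + 1) = pos a - ((K : ℤ) - j) := by
    intro j hj1 hj2
    obtain ⟨c, hc, hTc⟩ := hcell (j + 1) (by omega) (by omega)
    have hch : pos c ≤ h := by
      by_contra hcon
      rcases (by omega : pos c = pos y ∨ pos y < pos c) with h3 | h3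
      · rw [pos_injective h3, hTy] at hTc
        cases hTc
      · have := hD.ht_lt hT h3 (by unfold SameColumn; omega)
        rw [hTy, hTc] at this
        simp only [Letter.ht] at this
        omega
    have h3 := (hE.fst.iff j (by omega) c).1 ⟨hch, hTc⟩
    have h4 := hP j (by omega)
    push_cast at hc
    omega
  have hKK := (key K hκK le_rfl).2
  refine ⟨fun j h3 h4 => (key j h3 h4).1, ?_, ?_⟩
  · push_cast at h1; omega
  · push_cast at h2; omega

theorem eq_of_unit_steps {P : ℕ → ℤ} {κ K : ℕ} (H : ∀ j, κ ≤ j → j ≤ K → P (j + 1) = P j + 1)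
    (j : ℕ) (h1 : κ ≤ j) (h2 : j ≤ K + 1) : P j = P (K + 1) - (K + 1 - j) := by
  have key : ∀ d, j + d ≤ K + 1 → P (j + d) = P j + d := by
    intro d
    induction d with
    | zero => intro _; simp
    | succ d ih =>
      intro hd
      have h3 := ih (by omega)
      have h4 := H (j + d) (by omega) (by omega)
      push_cast
      rw [← add_assoc j d 1, h4, h3]
      ring
  have := key (K + 1 - j) (by omega)
  rw [Nat.add_sub_cancel' h2] at this
  omega

theorem condD6_of {n ℓ h r : ℕ} {T : Tableau ℓ} {P Q : ℕ → ℤ} (hE : Enc n h T P Q)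
    (hT : ∀ a, (T a).Valid n)
    (H : ∀ x y : Fin ℓ, pos x = h → pos y = h + 1 → ∀ κ K : ℕ, K + 1 < n → T x = bar (κ + 1) →
      T y = bar (K + 1) → κ ≤ K →
      (∀ j, κ ≤ j → j ≤ K → P (j + 1) = P j + 1) ∧ (n : ℤ) - r - (K + 1) ≤ h - P (K + 1) ∧
        (h : ℤ) - P (K + 1) < n - (K + 1) - 1) : CondD6 n h r T := by
  intro x y hx hy k hk1 hk hTy hle
  have hv := hT x
  cases hTx : T x with
  | plain i => rw [hTx, hTy] at hle; exact absurd hle (by simp [Le])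
  | bar i =>
    rw [hTx] at hv
    rw [hTx, hTy] at hle
    simp only [Le] at hle
    obtain ⟨κ, rfl⟩ : ∃ κ, i = κ + 1 := ⟨i - 1, by have := hv.1; omega⟩
    obtain ⟨K, rfl⟩ : ∃ K, k = K + 1 := ⟨k - 1, by omega⟩
    obtain ⟨h1, h2, h3⟩ := H x y hx hy κ K hk hTx hTy (by omega)
    obtain ⟨a, ha, -, hTa⟩ := hE.exists_plain (j := K) hk (q := P (K + 1))
      (by have := h1 K (by omega) le_rfl; omega) le_rfl
    refine ⟨κ + 1, by omega, by omega, rfl, a, ?_, by push_cast; omega, by push_cast; omega⟩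
    intro j hj1 hj2
    obtain ⟨j, rfl⟩ : ∃ i, j = i + 1 := ⟨j - 1, by omega⟩
    have h5 := eq_of_unit_steps h1 (j + 1) (by omega) (by omega)
    obtain ⟨c, hc, -, hTc⟩ := hE.exists_plain (j := j) (by omega) (q := P (j + 1))
      (by have := h1 j (by omega) (by omega); omega) le_rfl
    exact ⟨c, by push_cast; omega, hTc⟩

theorem Rest.exists_bar {n h ℓ : ℕ} (hh : h ≤ ℓ) {T T' : Tableau ℓ} (hR : Rest n h T T')
    {y : Fin ℓ} (hy : h < pos y) {K' : ℕ} (hK' : K' + 1 < n) (hTy : T' y = bar (K' + 1)) :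
    ∃ K, K + 1 < n ∧ T y = bar (K + 1) := by
  by_contra hcon
  push Not at hcon
  have h1 := pos_rev y
  have := (hR.2 y.rev (TypeD.dual T y.rev) (by omega) (fun j hj hx => by
    rw [dual_eq_plain, Fin.rev_rev] at hx
    exact hcon j hj hx)).1 rfl
  rw [dual_apply, dual_apply, Fin.rev_rev] at this
  have h2 := (dual_dual_letter (T' y)).symm.trans ((congrArg _ this).trans (dual_dual_letter _))
  exact hcon K' hK' (h2.symm.trans hTy)

theorem ColEnc.mono_le {n h ℓ : ℕ} {T : Tableau ℓ} {P : ℕ → ℤ} (H : ColEnc n h T P) {i j : ℕ}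
    (hij : i ≤ j) (hj : j < n) : P i ≤ P j := by
  induction j with
  | zero => obtain rfl : i = 0 := by omega
            exact le_rfl
  | succ j ih =>
    rcases hij.lt_or_eq with h1 | rfl
    · exact (ih (by omega) (by omega)).trans (H.mono j hj)
    · exact le_rfl

/-- If the seam was already exceptional in `T`, its run lies beyond `k₁` and is not reflected.
Otherwise `Q` has reached `ℓ - h` and is constant on the range in question, so the reflection `P' j
= j - c - (ℓ - h)` creates the run; its distance from the seam is the new lower bound allowed for `r
+ 1`. -/
theorem condD6_of_seg {n ℓ h r : ℕ} (hr : 1 ≤ r) {T T' : Tableau ℓ}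
    {P Q P' Q' : ℕ → ℤ} {k₀ k₁ : ℕ} (hE : Enc n h T P Q) (hE' : Enc n h T' P' Q')
    (hT : ∀ a, (T a).Valid n) (hT' : ∀ a, (T' a).Valid n) (hD : CondD1 n h T) (hP : Steps n P)
    (hS : Seg n (n - ℓ - 1 - r) P Q P' Q' k₀ k₁) (hR : Rest n h T T') (H : CondD6 n h r T) :
    CondD6 n h (r + 1) T' := by
  refine condD6_of hE' hT' fun x y hx hy κ K' hK' hTx' hTy' hκ => ?_
  have hh := hE.hle
  have hTx : T x = bar (κ + 1) := (hR.1 x _ hx.le (by simp)).2 hTx'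
  obtain ⟨K, hK, hTy⟩ := hR.exists_bar hh (by omega) hK' hTy'
  have y1 := (hE.bar_iff hK y).1 ⟨by omega, hTy⟩
  have y2 := (hE'.bar_iff hK' y).1 ⟨by omega, hTy'⟩
  have q1 := hE.snd.le (K + 1) hK
  have q2 := hE'.snd.le (K' + 1) hK'
  rcases le_or_gt κ K with hκK | hκK
  · obtain ⟨s1, s2, s3⟩ := condD6_steps hE hT hD hP H hx hy hK hTx hTy hκK
    have hw := eq_of_unit_steps s1
    -- The unit steps and the lower bound in (D.6) place the start of the run so that a reflected
    -- value `Q' κ` would exceed the length of the second column.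
    have hκ1 : k₁ < κ := by
      have e1 := hS.cases (j := κ) (by omega)
      have e2 := hw κ le_rfl (by omega)
      have e3 := hE'.snd.le κ (by omega)
      have e4 := hE.snd.le κ (by omega)
      omega
    have hpost : ∀ j < n, κ ≤ j → P' j = P j ∧ Q' j = Q j := fun j hj h1 => by
      have := hS.post j hj (by omega); omega
    have hKK : K' = K := by
      have e1 := hpost K' (by omega) hκ
      have e2 := hpost (K' + 1) hK' (by omega)
      have e3 := ((hE.bar_iff hK' y).2 (by omega)).2
      rw [hTy, bar.injEq] at e3
      omega
    subst hKK
    refine ⟨fun j h1 h2 => ?_, ?_, ?_⟩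
    · have e1 := hpost j (by omega) h1
      have e2 := hpost (j + 1) (by omega) (by omega)
      have e3 := s1 j h1 h2
      omega
    · have e2 := hpost (K' + 1) (by omega) (by omega)
      push_cast
      omega
    · have e2 := hpost (K' + 1) (by omega) (by omega)
      omega
  · have hQ : ∀ j < n, κ ≤ j → Q j = ℓ - h := by
      intro j hj h1
      have := hE.snd.mono_le (i := K + 1) (j := j) (by omega) hj
      have := hE.snd.le j hj
      omega
    have hmid : ∀ j, κ ≤ j → j ≤ K' + 1 → P' j = j - (n - ℓ - 1 - r) - (ℓ - h) := by
      intro j h1 h2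
      have f1 := hE'.snd.mono_le (i := κ) (j := K') hκ (by omega)
      have f2 := hS.cases (j := κ) (by omega)
      have f3 := hS.cases (j := K') (by omega)
      have f4 := hQ κ (by omega) le_rfl
      have f5 := hQ K' (by omega) hκ
      have f6 := hQ j (by omega) h1
      have f7 := hS.mid j (by omega) (by omega)
      omega
    refine ⟨fun j h1 h2 => ?_, ?_, ?_⟩
    · have e1 := hmid j h1 (by omega)
      have e2 := hmid (j + 1) (by omega) (by omega)
      push_cast at e2
      omega
    · have e2 := hmid (K' + 1) (by omega) (by omega)
      push_cast at e2 ⊢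
      omega
    · have e2 := hmid (K' + 1) (by omega) (by omega)
      push_cast at e2 ⊢
      omega

/-- For the inverse only the first case survives: when `T'` has no exceptional seam, its second
column is exhausted too early for `T` to have one. -/
theorem condD6_of_seg' {n ℓ h r : ℕ} {T T' : Tableau ℓ}
    {P Q P' Q' : ℕ → ℤ} {k₀ k₁ : ℕ} (hE : Enc n h T P Q) (hE' : Enc n h T' P' Q')
    (hT : ∀ a, (T a).Valid n) (hT' : ∀ a, (T' a).Valid n) (hD : CondD1 n h T') (hP : Steps n P')
    (hS : Seg n (n - ℓ - 1 - r) P Q P' Q' k₀ k₁) (hR : Rest n h T T') (H : CondD6 n h (r + 1) T') :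
    CondD6 n h r T := by
  refine condD6_of hE hT fun x y hx hy κ K hK hTx hTy hκ => ?_
  have hh := hE.hle
  have hTx' : T' x = bar (κ + 1) := (hR.1 x _ hx.le (by simp)).1 hTx
  obtain ⟨K', hK', hTy'⟩ := hR.symm.exists_bar hh (by omega) hK hTy
  have y1 := (hE.bar_iff hK y).1 ⟨by omega, hTy⟩
  have y2 := (hE'.bar_iff hK' y).1 ⟨by omega, hTy'⟩
  have q1 := hE.snd.le (K + 1) hK
  have q2 := hE'.snd.le (K' + 1) hK'
  have m1 := hE.snd.mono_le (i := κ) (j := K) hκ (by omega)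
  have c1 := hS.cases (j := κ) (by omega)
  have b1 := hE'.snd.le κ (by omega)
  have b2 := hE.snd.le κ (by omega)
  rcases le_or_gt κ K' with hκK | hκK
  · obtain ⟨s1, s2, s3⟩ := condD6_steps hE' hT' hD hP H hx hy hK' hTx' hTy' hκK
    have hw := eq_of_unit_steps s1
    have hκ1 : k₁ < κ := by
      have e2 := hw κ le_rfl (by omega)
      have e3 := hS.cases (j := K' + 1) (by omega)
      push_cast at *
      omega
    have hpost : ∀ j < n, κ ≤ j → P' j = P j ∧ Q' j = Q j ∧ (n : ℤ) - ℓ - 1 - r < j - P j - Q j :=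
      fun j hj h1 => hS.post j hj (by omega)
    have hKK : K' = K := by
      have e1 := hpost K (by omega) hκ
      have e2 := hpost (K + 1) hK (by omega)
      have e3 := ((hE'.bar_iff hK y).2 (by omega)).2
      rw [hTy', bar.injEq] at e3
      omega
    subst hKK
    refine ⟨fun j h1 h2 => ?_, ?_, ?_⟩
    · have e1 := hpost j (by omega) h1
      have e2 := hpost (j + 1) (by omega) (by omega)
      have e3 := s1 j h1 h2
      omega
    · have e2 := hpost (K' + 1) (by omega) (by omega)
      push_cast at *
      omega
    · have e2 := hpost (K' + 1) (by omega) (by omega)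
      omega
  · exfalso
    have := hE'.snd.mono_le (i := K' + 1) (j := κ) (by omega) (by omega)
    omega

/-- The condition (D.5) from (D.6) for the dual tableau. -/
theorem condD5_of_seg {n ℓ h r r' : ℕ} (hh : h ≤ ℓ) {T T' : Tableau ℓ}
    (hT' : ∀ a, (T' a).Valid n) (hR : Rest n h T T') (H5 : CondD5 n h r T)
    (H6 : CondD6 n (ℓ - h) r' (dual T')) : CondD5 n h r' T' := by
  intro x y hx hy k hk1 hkn hTy hle
  have hxr := pos_rev x
  have hyr := pos_rev y
  have hv := hT' x
  have hTyT : T y = plain k := by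
    have := (hR.2 y.rev (bar k) (by omega) (by simp)).2 (by rw [dual_eq_bar, Fin.rev_rev, hTy])
    rwa [dual_eq_bar, Fin.rev_rev] at this
  have hno : ∀ z, T' x = z → (∀ j, j + 1 < n → z ≠ plain (j + 1)) → False := by
    intro z hz hzn
    have h1 := (hR.1 x z hx.le hzn).2 hz
    rw [hTy, hz] at hle
    obtain ⟨k', h2, h3, h4, -⟩ := H5 x y hx hy k hk1 hkn hTyT (by rw [hTyT, h1]; exact hle)
    rw [h1] at h4
    exact hzn (k' - 1) (by omega) (by rw [Nat.sub_add_cancel h2]; exact h4)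
  cases hTx : T' x with
  | bar i => exact (hno _ hTx (by simp)).elim
  | plain K =>
    rw [hTx] at hv
    rcases hv.2.lt_or_eq with hi | rfl
    · rw [hTx, hTy] at hle
      obtain ⟨k', h1, h2, h3, a, h4, h5, h6⟩ := H6 y.rev x.rev (by omega) (by omega) K hv.1 hi
        (by rw [dual_eq_bar, Fin.rev_rev, hTx])
        (by
          rw [dual_apply, dual_apply, le_dual, Fin.rev_rev, Fin.rev_rev, hTx, hTy]
          exact hle)
      rw [dual_eq_bar, Fin.rev_rev, hTy, plain.injEq] at h3
      subst h3
      have har := pos_rev a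
      refine ⟨K, hv.1, hi, rfl, ?_⟩
      obtain ⟨d, hd1, hd2⟩ := h4 k le_rfl (show k ≤ K from hle)
      have hdr := pos_rev d
      refine ⟨d.rev, fun j hj1 hj2 => ?_, by omega, by omega⟩
      obtain ⟨e, he1, he2⟩ := h4 j hj1 hj2
      have her := pos_rev e
      exact ⟨e.rev, by omega, by rw [dual_eq_plain] at he2; exact he2⟩
    · exact (hno _ hTx (fun j hj => by simp; omega)).elim

theorem mem_of_seg {n ℓ h r : ℕ} (hr : 1 ≤ r) {T T' : Tableau ℓ}
    {P Q P' Q' : ℕ → ℤ} {k₀ k₁ : ℕ} (hE : Enc n h T P Q) (hE' : Enc n h T' P' Q')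
    (hP : Steps n P) (hQ : Steps n Q) (hP' : Steps n P') (hQ' : Steps n Q')
    (hS : Seg n (n - ℓ - 1 - r) P Q P' Q' k₀ k₁) (hR : Rest n h T T')
    (H : T ∈ tableauSet n ℓ h r) : T' ∈ tableauSet n ℓ h (r + 1) := by
  have hh := hE.hle
  have Hd := dual_mem hh H
  have hT' := hR.valid hh H.1
  have hdT' := forall_dual_valid hT'
  have h2 := condD2_of_seg hr rfl hE hE' hP' hT' hR (fun j hj => (hS.d2_cases hj).1) H.2.2.1
  have h2' := condD2_of_seg hr rfl hE.dual hE'.dual hQ' hdT' (hR.dual hh)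
    (fun j hj => (hS.swap.d2_cases hj).1) Hd.2.2.1
  have h3 := condD3_dual (Nat.sub_le ℓ h) h2'
  rw [Nat.sub_sub_self hh, dual_dual] at h3
  refine ⟨hT', (condD1_iff hh).2 ⟨?_, ?_⟩, h2, h3, ?_, ?_, ?_, condD7_of_rest hh hT' hR H.2.2.2.2.2.2.2⟩
  · exact hE'.fst.colD1 hP' hT' hR.1 ((condD1_iff hh).1 H.2.1).1
  · exact hE'.snd.colD1 hQ' hdT' hR.2 ((condD1_iff hh).1 H.2.1).2
  -- The forbidden double step descends from `c` to `c - 1`. Before the segment the path is below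
  -- `c`, and from the first visit on the reflected path is at least `c`.
  · refine condD4_of_ne hE' hT' (by omega) hP' hQ' fun j hj h4 h5 h6 => ?_
    have e1 := hS.cases (j := j) (by omega)
    have e2 := hS.cases hj
    push_cast at e2 h6
    omega
  · exact condD5_of_seg hh hT' hR H.2.2.2.2.2.1
      (condD6_of_seg hr hE.dual hE'.dual Hd.1 hdT' Hd.2.1 hQ hS.swap (hR.dual hh)
        Hd.2.2.2.2.2.2.1)
  · exact condD6_of_seg hr hE hE' H.1 hT' H.2.1 hP hS hR H.2.2.2.2.2.2.1

theorem mem_of_seg' {n ℓ h r : ℕ} (hr : 1 ≤ r) {T T' : Tableau ℓ}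
    {P Q P' Q' : ℕ → ℤ} {k₀ k₁ : ℕ} (hE : Enc n h T P Q) (hE' : Enc n h T' P' Q')
    (hP : Steps n P) (hQ : Steps n Q) (hP' : Steps n P') (hQ' : Steps n Q')
    (hS : Seg n (n - ℓ - 1 - r) P Q P' Q' k₀ k₁) (hR : Rest n h T T')
    (H : T' ∈ tableauSet n ℓ h (r + 1)) : T ∈ tableauSet n ℓ h r := by
  have hh := hE.hle
  have Hd := dual_mem hh H
  have hT := hR.symm.valid hh H.1
  have hdT := forall_dual_valid hT
  have h2 := condD2_of_seg hr rfl hE' hE hP hT hR.symm (fun j hj => (hS.d2_cases hj).2) H.2.2.1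
  have h2' := condD2_of_seg hr rfl hE'.dual hE.dual hQ hdT (hR.symm.dual hh)
    (fun j hj => (hS.swap.d2_cases hj).2) Hd.2.2.1
  have h3 := condD3_dual (Nat.sub_le ℓ h) h2'
  rw [Nat.sub_sub_self hh, dual_dual] at h3
  refine ⟨hT, (condD1_iff hh).2 ⟨?_, ?_⟩, h2, h3, ?_, ?_, ?_,
    condD7_of_rest hh hT hR.symm H.2.2.2.2.2.2.2⟩
  · exact hE.fst.colD1 hP hT hR.symm.1 ((condD1_iff hh).1 H.2.1).1
  · exact hE.snd.colD1 hQ hdT hR.symm.2 ((condD1_iff hh).1 H.2.1).2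
  · refine condD4_of_ne hE hT hr hP hQ fun j hj h4 h5 h6 => ?_
    have e1 := hS.cases (j := j) (by omega)
    have e2 := hS.cases hj
    push_cast at e2 h6
    omega
  · exact condD5_of_seg hh hT hR.symm H.2.2.2.2.2.1
      (condD6_of_seg' hE.dual hE'.dual hdT Hd.1 Hd.2.1 hQ' hS.swap (hR.dual hh)
        Hd.2.2.2.2.2.2.1)
  · exact condD6_of_seg' hE hE' hT H.1 H.2.1 hP' hS hR H.2.2.2.2.2.2.1

/-! ### Bijectivity of `sigma` -/

theorem exists_enc {n ℓ h : ℕ} (hh : h ≤ ℓ) {T : Tableau ℓ} (hT : ∀ a, (T a).Valid n)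
    (hD : CondD1 n h T) : ∃ P Q, Enc n h T P Q ∧ Steps n P ∧ Steps n Q := by
  obtain ⟨P, h1, h2⟩ := exists_colEnc hh hT hD
  obtain ⟨Q, h3, h4⟩ := exists_colEnc (Nat.sub_le ℓ h) (forall_dual_valid hT) (condD1_dual hh hD)
  exact ⟨P, Q, ⟨hh, h1, h3⟩, h2, h4⟩

theorem Seg.steps_fst {n ℓ h : ℕ} {c : ℤ} {T : Tableau ℓ} {P Q P' Q' : ℕ → ℤ} {k₀ k₁ : ℕ}
    (H : Seg n c P Q P' Q' k₀ k₁) (hE : Enc n h T P Q) (hP : Steps n P) (hQ : Steps n Q) :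
    Steps n P' ∧ Steps n Q' :=
  ⟨fun _ hj => (H.steps hP hQ hE.fst.mono hE.snd.mono hj).2.1,
    fun _ hj => (H.steps hP hQ hE.fst.mono hE.snd.mono hj).2.2.2⟩

theorem Seg.steps_fst' {n ℓ h : ℕ} {c : ℤ} {T : Tableau ℓ} {P Q P' Q' : ℕ → ℤ} {k₀ k₁ : ℕ}
    (H : Seg n c P Q P' Q' k₀ k₁) (hE : Enc n h T P' Q') (hP : Steps n P') (hQ : Steps n Q') :
    Steps n P ∧ Steps n Q :=
  ⟨fun _ hj => (H.steps' hP hQ hE.fst.mono hE.snd.mono hj).2.1,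
    fun _ hj => (H.steps' hP hQ hE.fst.mono hE.snd.mono hj).2.2.2⟩

theorem sigma_mapsTo_invOn_of_pos {n ℓ h r : ℕ} (hn : ℓ + 2 + r ≤ n) (hr : 1 ≤ r) (hh : h ≤ ℓ) :
    Set.MapsTo (sigma n ℓ h r) (tableauSet n ℓ h r) (tableauSet n ℓ h (r + 1)) ∧
    Set.MapsTo (sigmaInv n ℓ h (r + 1)) (tableauSet n ℓ h (r + 1)) (tableauSet n ℓ h r) ∧
    Set.InvOn (sigmaInv n ℓ h (r + 1)) (sigma n ℓ h r) (tableauSet n ℓ h r)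
      (tableauSet n ℓ h (r + 1)) := by
  refine ⟨fun T hT => ?_, fun T hT => ?_, fun T hT => ?_, fun T hT => ?_⟩ <;>
    obtain ⟨P, Q, hE, hP, hQ⟩ := exists_enc hh hT.1 hT.2.1
  · obtain ⟨P', Q', k₀, k₁, hS⟩ := exists_seg hn hr hT.2.2.2.2.1 hE hP hQ
    obtain ⟨hE', hR⟩ := enc_sigma hn hr hE hP hQ hS
    obtain ⟨hP', hQ'⟩ := hS.steps_fst hE hP hQ
    exact mem_of_seg hr hE hE' hP hQ hP' hQ' hS hR hT
  · obtain ⟨P', Q', k₀, k₁, hS⟩ := exists_seg' hn hT.2.2.2.2.1 hE hP hQ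
    obtain ⟨hE', hR⟩ := enc_sigmaInv hn hr hE hP hQ hS
    obtain ⟨hP', hQ'⟩ := hS.steps_fst' hE hP hQ
    exact mem_of_seg' hr hE' hE hP' hQ' hP hQ hS hR.symm hT
  · obtain ⟨P', Q', k₀, k₁, hS⟩ := exists_seg hn hr hT.2.2.2.2.1 hE hP hQ
    obtain ⟨hE', hR⟩ := enc_sigma hn hr hE hP hQ hS
    obtain ⟨hP', hQ'⟩ := hS.steps_fst hE hP hQ
    obtain ⟨hE'', hR'⟩ := enc_sigmaInv hn hr hE' hP' hQ' hS
    exact hE''.eq_of_rest hE (hR.trans hR').symm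
  · obtain ⟨P', Q', k₀, k₁, hS⟩ := exists_seg' hn hT.2.2.2.2.1 hE hP hQ
    obtain ⟨hE', hR⟩ := enc_sigmaInv hn hr hE hP hQ hS
    obtain ⟨hP', hQ'⟩ := hS.steps_fst' hE hP hQ
    obtain ⟨hE'', hR'⟩ := enc_sigma hn hr hE' hP' hQ' hS
    exact hE''.eq_of_rest hE (hR.trans hR').symm

/-- For `r = 0` the pairs to be replaced have the distance excluded by (D.2) for the whole column.
-/
theorem sigma_zero {n ℓ h : ℕ} {T : Tableau ℓ} (hT : T ∈ tableauSet n ℓ h 0) :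
    sigma n ℓ h 0 T = T := by
  have h2 := (mem_tableauSet_zero.1 hT).2.2
  have hstep : ∀ k : ℕ, replacePairs h ((n : ℤ) - (0 : ℕ) - k - 1) k (k + 1) T = T := by
    intro k
    funext c
    unfold replacePairs
    rw [if_neg, if_neg]
    · rintro ⟨h3, h4, a, h5, h6, h7⟩
      exact h2 ⟨a, c, k, by omega, pos_le c, h6, h4, by push_cast at h7; omega⟩
    · rintro ⟨h3, h4, b, h5, h6, h7⟩
      exact h2 ⟨c, b, k, by omega, pos_le b, h4, h6, by push_cast at h7; omega⟩
  have key : ∀ L : List ℕ, L.foldl (fun (U : Tableau ℓ) (k : ℕ) =>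
      replacePairs h ((n : ℤ) - (0 : ℕ) - k - 1) k (k + 1) U) T = T := by
    intro L
    induction L with
    | nil => rfl
    | cons k L ih => rw [List.foldl_cons, hstep, ih]
  exact key _

/-- The ranges in (D.5) and (D.6) are still empty for `r = 1`, and `max r 1` takes the same value
for `r = 0` and `r = 1`. -/
theorem tableauSet_one (n ℓ h : ℕ) : tableauSet n ℓ h 1 = tableauSet n ℓ h 0 := by
  ext T
  unfold tableauSet
  simp only [Set.mem_ofPred_eq]
  have h4 : CondD4 n h 1 T ↔ CondD4 n h 0 T := Iff.rfl
  have h5 : CondD5 n h 1 T ↔ CondD5 n h 0 T := by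
    constructor <;> intro H x y hx hy k h1 h2 h3 h4 <;>
      obtain ⟨k', -, -, -, b, -, h5, h6⟩ := H x y hx hy k h1 h2 h3 h4 <;> push_cast at h5 <;> omega
  have h6 : CondD6 n h 1 T ↔ CondD6 n h 0 T := by
    constructor <;> intro H x y hx hy k h1 h2 h3 h4 <;>
      obtain ⟨k', -, -, -, b, -, h5, h6⟩ := H x y hx hy k h1 h2 h3 h4 <;> push_cast at h5 <;> omega
  rw [h4, h5, h6]

theorem sigma_mapsTo_invOn {n ℓ h r : ℕ} (hn : ℓ + 2 + r ≤ n) (hh : h ≤ ℓ) :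
    Set.MapsTo (sigma n ℓ h r) (tableauSet n ℓ h r) (tableauSet n ℓ h (r + 1)) ∧
    Set.MapsTo (sigmaInv n ℓ h (r + 1)) (tableauSet n ℓ h (r + 1)) (tableauSet n ℓ h r) ∧
    Set.InvOn (sigmaInv n ℓ h (r + 1)) (sigma n ℓ h r) (tableauSet n ℓ h r)
      (tableauSet n ℓ h (r + 1)) := by
  rcases Nat.eq_zero_or_pos r with rfl | hr
  · have h1 : sigmaInv n ℓ h (0 + 1) = id := by
      funext T
      unfold sigmaInv
      rw [if_pos (by omega)]
      rfl
    rw [h1, zero_add, tableauSet_one]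
    exact ⟨fun T hT => by rwa [sigma_zero hT], fun T hT => hT, fun T hT => sigma_zero hT,
      fun T hT => sigma_zero hT⟩
  · exact sigma_mapsTo_invOn_of_pos hn hr hh

theorem bijOn_sigma {n ℓ h r : ℕ} (hn : ℓ + 2 + r ≤ n) (hh : h ≤ ℓ) :
    Set.BijOn (sigma n ℓ h r) (tableauSet n ℓ h r) (tableauSet n ℓ h (r + 1)) := by
  obtain ⟨h1, h2, h3⟩ := sigma_mapsTo_invOn hn hh
  exact h3.bijOn h1 h2

end TypeD

/-! ### Passing from the shift `r` to `r + 1` -/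

/-- Signs on a line are moved without strictly reversing their order. A partial sum can be affected
only where signs merge or separate. `H1` forbids merging a `+` with a `-` that stood to its right,
which could destroy the maximum; `H2` forbids separating coincident signs with the `+` first, which
could create a larger one. Among the signs `+` at the old first maximum, the one that ends up
furthest right marks the new first maximum. -/
theorem FirstMaxPos.of_perturb {ι : Type*} [Fintype ι] {s loc loc' : ι → ℤ}
    (hs : ∀ a, s a = 0 ∨ s a = 1 ∨ s a = -1)
    (H : ∀ a b, s a ≠ 0 → s b ≠ 0 → loc a < loc b → loc' a ≤ loc' b)
    (H1 : ∀ a b, s a = 1 → s b = -1 → loc a < loc b → loc' a ≠ loc' b)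
    (H2 : ∀ a b, s a = 1 → s b = -1 → loc' a < loc' b → loc a ≠ loc b) {c : ι} (hc : s c = 1)
    (hF : FirstMaxPos (fun V => ∑ a, if loc a ≤ V then s a else 0) (loc c))
    (hmax : ∀ a, s a = 1 → loc a = loc c → loc' a ≤ loc' c) :
    FirstMaxPos (fun V => ∑ a, if loc' a ≤ V then s a else 0) (loc' c) ∧
      (∑ a, if loc' a ≤ loc' c then s a else 0) = ∑ a, if loc a ≤ loc c then s a else 0 := by
  have H' : ∀ a b, s a ≠ 0 → s b ≠ 0 → loc' a < loc' b → loc a ≤ loc b := by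
    intro a b ha hb hab
    by_contra hcon
    have := H b a hb ha (not_le.1 hcon)
    omega
  obtain ⟨hF0, hF1, hF2⟩ := hF
  simp only at hF0 hF1 hF2
  have key : ∀ W, (∑ a, if loc' a ≤ W then s a else 0) ≤ ∑ a, (if loc a ≤ loc c then s a else 0) ∧
      (W < loc' c → (∑ a, if loc' a ≤ W then s a else 0) <
        ∑ a, if loc a ≤ loc c then s a else 0) := by
    intro W
    by_cases hI : ∃ a, s a ≠ 0 ∧ loc' a ≤ W
    -- Each new partial sum is compared with an old one, cut at the last old location among the
    -- signs that it contains, or just before it.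
    · obtain ⟨a₀, ha₀, hmaxa⟩ := Finset.exists_max_image
        (Finset.univ.filter fun a => s a ≠ 0 ∧ loc' a ≤ W) loc
        (by obtain ⟨a, ha⟩ := hI; exact ⟨a, by simpa using ha⟩)
      simp only [Finset.mem_filter, Finset.mem_univ, true_and] at ha₀ hmaxa
      have hV := hF1 (loc a₀)
      have hV1 := hF1 (loc a₀ - 1)
      by_cases hneg : ∃ a, s a = -1 ∧ loc a ≤ loc a₀ ∧ W < loc' a
      · obtain ⟨a₁, h1, h2, h3⟩ := hneg
        have h4 := H' a₀ a₁ ha₀.1 (by omega) (by omega)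
        have hlt : (∑ a, if loc' a ≤ W then s a else 0) <
            ∑ a, if loc a ≤ loc a₀ - 1 then s a else 0 := by
          have hsa : ∀ a, s a ≠ 0 → loc' a ≤ W → loc a = loc a₀ → s a = -1 := by
            intro a h5 h6 h7
            rcases hs a with h8 | h8 | h8
            · exact absurd h8 h5
            · exact absurd (by omega) (H2 a a₁ h8 h1 (by omega))
            · exact h8
          refine Finset.sum_lt_sum (fun a _ => ?_) ⟨a₀, Finset.mem_univ _, ?_⟩
          · by_cases h5 : s a = 0
            · simp [h5]
            · have h6 := hmaxa a
              have h7 := hsa a h5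
              have h8 := H a a₀ h5 ha₀.1
              split_ifs <;> omega
          · have h7 := hsa a₀ ha₀.1 ha₀.2 rfl
            rw [if_pos ha₀.2, if_neg (by omega)]
            omega
        omega
      · push Not at hneg
        have hterm : ∀ a, (if loc' a ≤ W then s a else 0) ≤ if loc a ≤ loc a₀ then s a else 0 := by
          intro a
          by_cases h5 : s a = 0
          · simp [h5]
          · have h6 := hmaxa a
            have h7 := hneg a
            have h8 := hs a
            split_ifs <;> omega
        have hle := Finset.sum_le_sum fun a (_ : a ∈ Finset.univ) => hterm a
        refine ⟨hle.trans hV, fun hW => ?_⟩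
        rcases lt_trichotomy (loc a₀) (loc c) with h | h | h
        · exact hle.trans_lt (hF2 _ h)
        · rw [← h]
          refine Finset.sum_lt_sum (fun a _ => hterm a) ⟨c, Finset.mem_univ _, ?_⟩
          rw [if_neg (by omega), if_pos (by omega)]
          omega
        · have := H c a₀ (by omega) ha₀.1 h
          omega
    · push Not at hI
      have : (∑ a, if loc' a ≤ W then s a else 0) = 0 := by
        refine Finset.sum_eq_zero fun a _ => ?_
        by_cases h5 : s a = 0
        · simp [h5]
        · have := hI a h5
          rw [if_neg (by omega)]
      omega
  -- By the choice of `c` every `+` counted before is still counted, and by `H1` no new `-` enters.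
  have hge : (∑ a, if loc a ≤ loc c then s a else 0) ≤ ∑ a, if loc' a ≤ loc' c then s a else 0 := by
    refine Finset.sum_le_sum fun a _ => ?_
    by_cases h5 : s a = 0
    · simp [h5]
    · have h1 := H c a (by omega) h5
      have h2 := H' c a (by omega) h5
      have h3 := H1 c a hc
      have h4 := H2 c a hc
      have h6 := hmax a
      have h7 := hs a
      split_ifs <;> omega
  have heq := le_antisymm (key (loc' c)).1 hge
  refine ⟨⟨?_, fun W => ?_, fun W hW => ?_⟩, heq⟩
  · simp only; omega
  · simp only; rw [heq]; exact (key W).1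
  · simp only; rw [heq]; exact (key W).2 hW

namespace TypeD

open Letter

theorem vloc_succ {n ℓ h r k : ℕ} (T : Tableau ℓ) (a : Fin ℓ) :
    vloc n h (r + 1) k T a = vloc n h r k T a - if pos a ≤ h then 0 else 1 := by
  unfold vloc shiftPos
  split_ifs <;> push_cast <;> ring

theorem sg_cases (n k : ℕ) (x : Letter) : sg n k x = 0 ∨ sg n k x = 1 ∨ sg n k x = -1 := by
  have := sg_le_one n k x
  have := neg_one_le_sg n k x
  omega

/-- The locations of the letters that matter for the label `k < n`. -/
theorem vloc_cases {n ℓ h r k : ℕ} (hkn : k < n) {T : Tableau ℓ} (a : Fin ℓ) :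
    (sg n k (T a) = 1 → T a = plain k ∧ vloc n h r k T a = -shiftPos h r a ∨
      T a = bar (k + 1) ∧ vloc n h r k T a = n - 1 - k - shiftPos h r a) ∧
    (sg n k (T a) = -1 → T a = plain (k + 1) ∧ vloc n h r k T a = 1 - shiftPos h r a ∨
      T a = bar k ∧ vloc n h r k T a = n - k - shiftPos h r a) := by
  constructor <;> intro hs
  · rcases (sg_eq_one_iff hkn).1 hs with hx | hx <;> unfold vloc <;> rw [hx] <;> simp [off, hkn]
  · rcases (sg_eq_neg_one_iff hkn).1 hs with hx | hx <;> unfold vloc <;> rw [hx] <;> simp [off, hkn]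

theorem shiftPos_cases {ℓ : ℕ} (h r : ℕ) (a : Fin ℓ) :
    (pos a ≤ h ∧ shiftPos h r a = pos a) ∨ (h < pos a ∧ shiftPos h r a = pos a + r) := by
  unfold shiftPos
  split_ifs <;> omega

/-- Only a pair of opposite signs in different columns can merge or separate when the second column
moves by one. In the harmful order such a pair is `(k, k̄)` or `k + 1` with its barred version, at
exactly the distance excluded by (D.4) for `r + 1`. -/
theorem tie_of_condD4 {n ℓ h r k : ℕ} (hkn : k < n) {T : Tableau ℓ} (H : CondD4 n h (r + 1) T)
    {a b : Fin ℓ} (ha : sg n k (T a) = 1) (hb : sg n k (T b) = -1) :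
    (vloc n h r k T a < vloc n h r k T b → vloc n h (r + 1) k T a ≠ vloc n h (r + 1) k T b) ∧
    (vloc n h (r + 1) k T a < vloc n h (r + 1) k T b → vloc n h r k T a ≠ vloc n h r k T b) := by
  have h1 := (vloc_cases (h := h) (r := r) hkn a (T := T)).1 ha
  have h2 := (vloc_cases (h := h) (r := r) hkn b (T := T)).2 hb
  rw [vloc_succ, vloc_succ]
  have h3 := shiftPos_cases h r a
  have h4 := shiftPos_cases h r b
  have hD : ∀ (a b : Fin ℓ) (j : ℕ), pos a ≤ h → h + 1 ≤ pos b → T a = plain j → T b = bar j →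
      (pos b : ℤ) - pos a ≠ n - (r + 1) - j := fun a b j h5 h6 h7 h8 h9 =>
    H ⟨a, b, j, h5, h6, h7, h8, by rw [max_eq_left (by omega)]; push_cast; exact h9⟩
  constructor <;> intro h5 h6 <;> rcases h1 with ⟨h1, h1'⟩ | ⟨h1, h1'⟩ <;>
    rcases h2 with ⟨h2, h2'⟩ | ⟨h2, h2'⟩
  · split_ifs at h6 <;> omega
  · have := hD a b k
    split_ifs at h6 <;> first | omega | exact this (by omega) (by omega) h1 h2 (by omega)
  · split_ifs at h6 <;> omega
  · split_ifs at h6 <;> omega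
  · split_ifs at h5 <;> omega
  · split_ifs at h5 <;> omega
  · have := hD b a (k + 1)
    split_ifs at h5 <;> first | omega | exact this (by omega) (by omega) h2 h1 (by push_cast; omega)
  · split_ifs at h5 <;> omega

theorem exists_of_firstMaxPos {n ℓ h r k : ℕ} {T : Tableau ℓ} {V : ℤ}
    (H : FirstMaxPos (Phi n h r k T) V) : ∃ c, sg n k (T c) = 1 ∧ vloc n h r k T c = V := by
  by_contra hcon
  push Not at hcon
  have h1 := H.2.2 (V - 1) (by omega)
  refine absurd h1 (not_lt.2 (Finset.sum_le_sum fun a _ => ?_))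
  have h2 := hcon a
  have h3 := sg_cases n k (T a)
  split_ifs <;> omega

theorem exists_mem_candF {n ℓ : ℕ} (hn : 4 ≤ n) {h r : ℕ} {i : Fin n} {T : Tableau ℓ}
    (hT : ∀ a, (T a).Valid n) {V : ℤ} (H : FirstMaxPos (Phi n h r (i.val + 1) T) V) :
    ∃ c ∈ candF h r i T, vloc n h r (i.val + 1) T c = V := by
  obtain ⟨c, h1, h2⟩ := exists_of_firstMaxPos H
  exact ⟨c, (mem_candF hn hT c).2 ⟨h1, h2 ▸ H⟩, h2⟩

theorem mem_candF_succ {n ℓ : ℕ} (hn : 4 ≤ n) {h r : ℕ} {i : Fin n} (hi : i.val + 1 < n)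
    {T : Tableau ℓ} (hT : ∀ a, (T a).Valid n) (hD : CondD4 n h (r + 1) T) {c : Fin ℓ}
    (hc : c ∈ candF h r i T)
    (hmax : ∀ a ∈ candF h r i T,
      vloc n h (r + 1) (i.val + 1) T a ≤ vloc n h (r + 1) (i.val + 1) T c) :
    c ∈ candF h (r + 1) i T ∧
      monPhi i (mon n h (r + 1) T) = monPhi i (mon n h r T) := by
  obtain ⟨h1, h2⟩ := (mem_candF hn hT c).1 hc
  obtain ⟨h3, h4⟩ := FirstMaxPos.of_perturb (s := fun a => sg n (i.val + 1) (T a))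
    (loc := vloc n h r (i.val + 1) T) (loc' := vloc n h (r + 1) (i.val + 1) T)
    (fun a => sg_cases _ _ _) (fun a b _ _ hab => by
      rw [vloc_succ, vloc_succ]
      split_ifs <;> omega)
    (fun a b ha hb => (tie_of_condD4 hi hD ha hb).1)
    (fun a b ha hb => (tie_of_condD4 hi hD ha hb).2) h1 h2
    (fun a ha hac => hmax a ((mem_candF hn hT a).2 ⟨ha, by rw [hac]; exact h2⟩))
  refine ⟨(mem_candF hn hT c).2 ⟨h1, h3⟩, ?_⟩
  rw [monPhi_of_firstMaxPos hn hT h2, monPhi_of_firstMaxPos hn hT h3]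
  exact h4

theorem mem_candF_of_succ {n ℓ : ℕ} (hn : 4 ≤ n) {h r : ℕ} {i : Fin n} (hi : i.val + 1 < n)
    {T : Tableau ℓ} (hT : ∀ a, (T a).Valid n) (hD : CondD4 n h (r + 1) T) {c : Fin ℓ}
    (hc : c ∈ candF h (r + 1) i T)
    (hmax : ∀ a ∈ candF h (r + 1) i T,
      vloc n h r (i.val + 1) T a ≤ vloc n h r (i.val + 1) T c) : c ∈ candF h r i T := by
  obtain ⟨h1, h2⟩ := (mem_candF hn hT c).1 hc
  obtain ⟨h3, -⟩ := FirstMaxPos.of_perturb (s := fun a => sg n (i.val + 1) (T a))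
    (loc := vloc n h (r + 1) (i.val + 1) T) (loc' := vloc n h r (i.val + 1) T)
    (fun a => sg_cases _ _ _) (fun a b _ _ hab => by
      rw [vloc_succ, vloc_succ] at hab
      split_ifs at hab <;> omega)
    (fun a b ha hb => (tie_of_condD4 hi hD ha hb).2)
    (fun a b ha hb => (tie_of_condD4 hi hD ha hb).1) h1 h2
    (fun a ha hac => hmax a ((mem_candF hn hT a).2 ⟨ha, by rw [hac]; exact h2⟩))
  exact (mem_candF hn hT c).2 ⟨h1, h3⟩

theorem candF_succ_eq_empty {n ℓ : ℕ} (hn : 4 ≤ n) {h r : ℕ} {i : Fin n} (hi : i.val + 1 < n)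
    {T : Tableau ℓ} (hT : ∀ a, (T a).Valid n) (hD : CondD4 n h (r + 1) T)
    (H : ∀ c, c ∉ candF h r i T) (c : Fin ℓ) : c ∉ candF h (r + 1) i T := by
  intro hc
  obtain ⟨c', h1, h2⟩ := Finset.exists_max_image (candF h (r + 1) i T)
    (vloc n h r (i.val + 1) T) ⟨c, hc⟩
  exact H c' (mem_candF_of_succ hn hi hT hD h1 h2)

theorem monPhi_succ {n ℓ : ℕ} (hn : 4 ≤ n) {h r : ℕ} {i : Fin n} (hi : i.val + 1 < n)
    {T : Tableau ℓ} (hT : ∀ a, (T a).Valid n) (hD : CondD4 n h (r + 1) T) :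
    monPhi i (mon n h (r + 1) T) = monPhi i (mon n h r T) := by
  by_cases hne : (candF h r i T).Nonempty
  · obtain ⟨c, h1, h2⟩ := Finset.exists_max_image (candF h r i T)
      (vloc n h (r + 1) (i.val + 1) T) hne
    exact (mem_candF_succ hn hi hT hD h1 h2).2
  · have h1 : ∀ c, c ∉ candF h r i T := fun c hc => hne ⟨c, hc⟩
    have h2 := candF_succ_eq_empty hn hi hT hD h1
    have key : ∀ r', (∀ c, c ∉ candF h r' i T) → monPhi i (mon n h r' T) = 0 := by
      intro r' hr'
      rcases Phi_nonpos_or_firstMaxPos n h r' (i.val + 1) T with H | ⟨V, H⟩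
      · exact monPhi_of_nonpos hn hT H
      · obtain ⟨c, hc, -⟩ := exists_mem_candF hn hT H
        exact absurd hc (hr' c)
    rw [key _ h1, key _ h2]

/-- The structure for `r + 1` always selects the first entry that is possible for `r`. -/
theorem tabF_succ {n ℓ : ℕ} (hn : 4 ≤ n) {h r : ℕ} {i : Fin n} (hi : i.val + 1 < n)
    {T : Tableau ℓ} (hT : ∀ a, (T a).Valid n) (hD : CondD4 n h (r + 1) T) {c : Fin ℓ}
    (hc : c ∈ candF h r i T) (hmin : ∀ c' ∈ candF h r i T, c ≤ c') :
    tabF h (r + 1) i T = some (Function.update T c ((T c).next n (i.val + 1))) := by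
  have hm0 := fun a => mem_candF (r := r) hn (h := h) (i := i) hT a
  have hm1 := fun a => mem_candF (r := r + 1) hn (h := h) (i := i) hT a
  have hcF := ((hm0 c).1 hc).2
  have hs0 : ∀ a ∈ candF h r i T, vloc n h r (i.val + 1) T a = vloc n h r (i.val + 1) T c :=
    fun a ha => ((hm0 a).1 ha).2.unique hcF
  have hS1 : ∀ b ∈ candF h (r + 1) i T,
      vloc n h r (i.val + 1) T b ≤ vloc n h r (i.val + 1) T c ∧
      (vloc n h r (i.val + 1) T b = vloc n h r (i.val + 1) T c → b ∈ candF h r i T) := by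
    intro b hb
    obtain ⟨c', h1, h2⟩ := Finset.exists_max_image (candF h (r + 1) i T)
      (vloc n h r (i.val + 1) T) ⟨b, hb⟩
    rw [← hs0 c' (mem_candF_of_succ hn hi hT hD h1 h2)]
    refine ⟨h2 b hb, fun h3 => mem_candF_of_succ hn hi hT hD hb fun a ha => ?_⟩
    rw [h3]
    exact h2 a ha
  have hpos : ∀ a b : Fin ℓ, a ≤ b ↔ pos a ≤ pos b := fun a b => by
    unfold pos; rw [Fin.le_def]; omega
  have hc1 : c ∈ candF h (r + 1) i T := by
    refine (mem_candF_succ hn hi hT hD hc fun a ha => ?_).1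
    have h1 := hs0 a ha
    have h2 := (hpos _ _).1 (hmin a ha)
    rw [vloc_succ, vloc_succ, h1]
    split_ifs <;> omega
  have hs1 : ∀ b ∈ candF h (r + 1) i T,
      vloc n h (r + 1) (i.val + 1) T b = vloc n h (r + 1) (i.val + 1) T c :=
    fun b hb => ((hm1 b).1 hb).2.unique ((hm1 c).1 hc1).2
  -- In the first case `c` must be the only candidate in the second column. Two candidates there at
  -- one location carry different letters, and one of these letters is that of `b`; equality of
  -- locations up to the shift would then put `b` below it, although `b` is in the first column.
  by_cases hex : ∃ b ∈ candF h (r + 1) i T, pos b ≤ h ∧ h < pos c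
  · obtain ⟨b, hb, hbh, hch⟩ := hex
    refine tabF_eq_some hc1 (Or.inr fun c' hc' => ?_)
    rw [hpos]
    by_cases hc'h : pos c' ≤ h
    · exact ⟨by omega, Or.inr ⟨by omega, by unfold SameColumn; omega⟩⟩
    · have e1 := hs1 b hb
      have e2 := hs1 c' hc'
      rw [vloc_succ, vloc_succ, if_pos hbh, if_neg (by omega)] at e1
      rw [vloc_succ, vloc_succ, if_neg hc'h, if_neg (by omega)] at e2
      have l1 := (vloc_cases (h := h) (r := r) hi b).1 ((hm1 b).1 hb).1
      have l2 := (vloc_cases (h := h) (r := r) hi c').1 ((hm1 c').1 hc').1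
      have l3 := (vloc_cases (h := h) (r := r) hi c).1 ((hm1 c).1 hc1).1
      have p1 := shiftPos_cases h r b
      have p2 := shiftPos_cases h r c'
      have p3 := shiftPos_cases h r c
      have : pos c' = pos c := by omega
      exact ⟨this.le, Or.inl (pos_injective this)⟩
  · push Not at hex
    refine tabF_eq_some hc1 (Or.inl fun b hb => ?_)
    have e1 := hs1 b hb
    have e2 := hS1 b hb
    have e3 := hex b hb
    rw [vloc_succ, vloc_succ] at e1
    have hmem : b ∈ candF h r i T ∧ (pos b ≤ h ↔ pos c ≤ h) := by
      split_ifs at e1 with q1 q2 q2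
      · exact ⟨e2.2 (by omega), by omega⟩
      · have := e3 q1; omega
      · omega
      · exact ⟨e2.2 (by omega), by omega⟩
    exact ⟨hmin b hmem.1, Or.inr (by unfold SameColumn; omega)⟩

/-! ## The statistics in terms of the counting functions -/

/-- The sign of an entry that is not encoded by the counting functions. -/
def freeSg (n h k : ℕ) {ℓ : ℕ} (T : Tableau ℓ) (a : Fin ℓ) : ℤ :=
  match T a with
  | plain i => if pos a ≤ h then 0 else sg n k (plain i)
  | bar i => if pos a ≤ h then sg n k (bar i) else 0

def freeSum (n h r k : ℕ) {ℓ : ℕ} (T : Tableau ℓ) (p : ℤ → Prop) [DecidablePred p] : ℤ :=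
  ∑ a, if p (vloc n h r k T a) then freeSg n h k T a else 0

/-- The half-open interval contains at most one row because the counting functions have unit steps.
-/
theorem sum_unit {ℓ : ℕ} {lo hi : ℤ} (h0 : 0 ≤ lo) (h1 : lo ≤ hi) (h2 : hi ≤ lo + 1) (h3 : hi ≤ ℓ)
    (f : Fin ℓ → ℤ) (v : ℤ) (hf : ∀ a : Fin ℓ, lo < hi → (pos a : ℤ) = hi → f a = v)
    (hz : ∀ a : Fin ℓ, ¬(lo < pos a ∧ (pos a : ℤ) ≤ hi) → f a = 0) :
    ∑ a, f a = (hi - lo) * v := by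
  by_cases h : lo < hi
  · obtain ⟨c, hc⟩ := exists_pos (ℓ := ℓ) (q := hi) (by omega) h3
    rw [Finset.sum_eq_single c, hf c h hc, show hi - lo = 1 by omega, one_mul]
    · intro b _ hb
      refine hz b fun hcon => hb (pos_injective ?_)
      omega
    · intro hcon
      exact absurd (Finset.mem_univ c) hcon
  · rw [Finset.sum_eq_zero fun a _ => hz a (by omega), show hi - lo = 0 by omega, zero_mul]

theorem ColEnc.sum_plain {n h ℓ : ℕ} {T : Tableau ℓ} {P : ℕ → ℤ} (H : ColEnc n h T P) (hh : h ≤ ℓ)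
    (hP : Steps n P) {j : ℕ} (hj : j + 1 < n) (g : ℤ → ℤ) :
    (∑ a : Fin ℓ, if pos a ≤ h ∧ T a = plain (j + 1) then g (pos a) else 0) =
      (P (j + 1) - P j) * g (P (j + 1)) := by
  have h1 := H.le (j + 1) hj
  refine sum_unit (H.nonneg (by omega)) (H.mono j hj) (hP j hj) (by omega) _ _
    (fun a h2 h3 => ?_) (fun a h2 => ?_)
  · rw [if_pos ((H.iff j hj a).2 ⟨by omega, by omega⟩), h3]
  · rw [if_neg (fun h3 => h2 ((H.iff j hj a).1 h3))]

theorem Enc.sum_bar {n h ℓ : ℕ} {T : Tableau ℓ} {P Q : ℕ → ℤ} (H : Enc n h T P Q)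
    (hQ : Steps n Q) {j : ℕ} (hj : j + 1 < n) (g : ℤ → ℤ) :
    (∑ a : Fin ℓ, if h < pos a ∧ T a = bar (j + 1) then g (ℓ + 1 - pos a) else 0) =
      (Q (j + 1) - Q j) * g (Q (j + 1)) := by
  have hh := H.hle
  rw [← H.snd.sum_plain (Nat.sub_le ℓ h) hQ hj g]
  refine Fintype.sum_equiv Fin.revPerm _ _ fun a => ?_
  have := pos_rev a
  have hle := pos_le a
  rw [Fin.revPerm_apply, this]
  refine if_congr ?_ rfl rfl
  rw [dual_eq_plain, Fin.rev_rev]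
  exact and_congr_left fun _ => by omega

/-- If present, the letters `k` and `k + 1` of the first column both have the location `-P k`, with
opposite signs, so their weight is minus the second difference of `P` at `k`. In the same way the
letters `k̄` and `k + 1` barred of the second column share the location `Q k + c - k`. -/
theorem Enc.sum_eq {n h ℓ : ℕ} {T : Tableau ℓ} {P Q : ℕ → ℤ} (H : Enc n h T P Q)
    (hT : ∀ a, (T a).Valid n) (hP : Steps n P) (hQ : Steps n Q) (r : ℕ) {k : ℕ} (hk : k + 1 < n)
    (p : ℤ → Prop) [DecidablePred p] :
    (∑ a, if p (vloc n h r k T a) then sg n k (T a) else 0) =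
      (2 * P k - P (k - 1) - P (k + 1)) * (if p (-P k) then 1 else 0) +
      (Q (k + 1) + Q (k - 1) - 2 * Q k) * (if p (Q k + (n - ℓ - 1 - r) - k) then 1 else 0) +
      freeSum n h r k T p := by
  have e1 : (∑ a : Fin ℓ, if pos a ≤ h ∧ T a = plain k then
      (fun q : ℤ => if p (-q) then (1 : ℤ) else 0) (pos a) else 0) =
      (P k - P (k - 1)) * (if p (-P k) then 1 else 0) := by
    -- For `k = 0` the truncated subtraction makes the coefficient vanish, in accordance with the
    -- absence of a letter 0.
    rcases k with _ | k
    · rw [Finset.sum_eq_zero, Nat.zero_sub, sub_self, zero_mul]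
      intro a _
      refine if_neg fun hcon => ?_
      have := hT a
      rw [hcon.2] at this
      exact absurd this.1 (by omega)
    · exact H.fst.sum_plain H.hle hP (j := k) (by omega) (fun q : ℤ => if p (-q) then (1 : ℤ) else 0)
  have e2 := H.fst.sum_plain H.hle hP hk (fun q : ℤ => if p (1 - q) then (1 : ℤ) else 0)
  have e3 : (∑ a : Fin ℓ, if h < pos a ∧ T a = bar k then
      (fun q : ℤ => if p (n - k - (ℓ + 1 - q) - r) then (1 : ℤ) else 0) (ℓ + 1 - pos a) else 0) =
      (Q k - Q (k - 1)) * (if p (Q k + (n - ℓ - 1 - r) - k) then 1 else 0) := by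
    rcases k with _ | k
    · rw [Finset.sum_eq_zero, Nat.zero_sub, sub_self, zero_mul]
      intro a _
      refine if_neg fun hcon => ?_
      have := hT a
      rw [hcon.2] at this
      exact absurd this.1 (by omega)
    · refine (H.sum_bar hQ (j := k) (by omega)
        (fun q : ℤ => if p (n - (k + 1 : ℕ) - (ℓ + 1 - q) - r) then (1 : ℤ) else 0)).trans ?_
      simp only [Nat.add_sub_cancel]
      rw [show (n : ℤ) - (k + 1 : ℕ) - (ℓ + 1 - Q (k + 1)) - r =
        Q (k + 1) + (n - ℓ - 1 - r) - (k + 1 : ℕ) by ring]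
  have e4 := H.sum_bar hQ hk
    (fun q : ℤ => if p (n - 1 - k - (ℓ + 1 - q) - r) then (1 : ℤ) else 0)
  have e5 : P (k + 1) = P k ∨ P (k + 1) = P k + 1 := by
    have := H.fst.mono k hk; have := hP k hk; omega
  have e6 : Q (k + 1) = Q k ∨ Q (k + 1) = Q k + 1 := by
    have := H.snd.mono k hk; have := hQ k hk; omega
  have e7 : (P (k + 1) - P k) * (if p (1 - P (k + 1)) then (1 : ℤ) else 0) =
      (P (k + 1) - P k) * (if p (-P k) then 1 else 0) := by
    rcases e5 with e5 | e5
    · rw [e5]; ring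
    · rw [e5]; congr 3; ring
  have e8 : (Q (k + 1) - Q k) * (if p (n - 1 - k - (ℓ + 1 - Q (k + 1)) - r) then (1 : ℤ) else 0) =
      (Q (k + 1) - Q k) * (if p (Q k + (n - ℓ - 1 - r) - k) then 1 else 0) := by
    rcases e6 with e6 | e6
    · rw [e6]; ring
    · rw [e6]; congr 3; ring
  rw [e7] at e2
  rw [e8] at e4
  rw [show (2 * P k - P (k - 1) - P (k + 1)) * (if p (-P k) then 1 else 0) +
      (Q (k + 1) + Q (k - 1) - 2 * Q k) * (if p (Q k + (n - ℓ - 1 - r) - k) then 1 else 0) +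
      freeSum n h r k T p =
      (P k - P (k - 1)) * (if p (-P k) then 1 else 0) -
      (P (k + 1) - P k) * (if p (-P k) then 1 else 0) -
      (Q k - Q (k - 1)) * (if p (Q k + (n - ℓ - 1 - r) - k) then 1 else 0) +
      (Q (k + 1) - Q k) * (if p (Q k + (n - ℓ - 1 - r) - k) then 1 else 0) +
      freeSum n h r k T p by ring, ← e1, ← e2, ← e3, ← e4, freeSum, ← Finset.sum_sub_distrib,
    ← Finset.sum_sub_distrib, ← Finset.sum_add_distrib, ← Finset.sum_add_distrib]
  refine Finset.sum_congr rfl fun a _ => ?_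
  have hs := shiftPos_cases h r a
  have hkn : k < n := by omega
  unfold freeSg vloc
  rcases hx : T a with i | i
  · simp only [plain.injEq, reduceCtorEq, and_false, if_false, sub_zero, add_zero]
    by_cases h1 : pos a ≤ h
    · have hs' : shiftPos h r a = pos a := by omega
      rw [hs']
      simp only [h1, true_and, if_true, ite_self, add_zero, sg, off, hkn]
      by_cases h2 : i = k
      · subst h2
        simp
      · by_cases h3 : i = k + 1
        · subst h3
          simp
          split_ifs <;> rfl
        · simp [h2, h3]
    · simp [h1]
  · simp only [bar.injEq, reduceCtorEq, and_false, if_false, sub_zero, zero_sub]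
    by_cases h1 : pos a ≤ h
    · simp [h1, not_lt.2 h1]
    · have hs' : shiftPos h r a = pos a + r := by omega
      rw [hs']
      simp only [h1, not_le.1 h1, true_and, if_true, if_false, ite_self, add_zero, sg, off, hkn]
      by_cases h2 : i = k
      · subst h2
        simp only [Nat.left_eq_add, one_ne_zero, if_false, if_true, add_zero]
        rw [show (n : ℤ) - i - (ℓ + 1 - (ℓ + 1 - pos a)) - r = n - i - (pos a + r) by ring]
        split_ifs <;> rfl
      · by_cases h3 : i = k + 1
        · subst h3
          simp only [Nat.add_eq_left, one_ne_zero, if_false, if_true, neg_zero, zero_add]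
          rw [show (n : ℤ) - 1 - k - (ℓ + 1 - (ℓ + 1 - pos a)) - r = n - 1 - k - (pos a + r) by ring]
        · simp [h2, h3]

theorem freeSum_eq_of_rest {n h ℓ : ℕ} (hh : h ≤ ℓ) {T T' : Tableau ℓ} (hR : Rest n h T T')
    (r k : ℕ) (p : ℤ → Prop) [DecidablePred p] :
    freeSum n h r k T p = freeSum n h r k T' p := by
  have key : ∀ S S' : Tableau ℓ, Rest n h S S' → ∀ a, freeSg n h k S a ≠ 0 → S a = S' a := by
    intro S S' hS a ha
    have hle := pos_le a
    unfold freeSg at ha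
    rcases hx : S a with i | i <;> rw [hx] at ha <;> simp only at ha
    · have h1 : ¬pos a ≤ h := fun h1 => by simp [h1] at ha
      have h2 := hS.2 a.rev (bar i) (by have := pos_rev a; omega) (fun j _ => by simp)
      rw [dual_apply, dual_apply, Fin.rev_rev, hx] at h2
      have h3 := congrArg Letter.dual (h2.1 rfl)
      rw [dual_dual_letter] at h3
      exact h3.symm
    · have h1 : pos a ≤ h := by by_contra h1; simp [h1] at ha
      exact ((hS.1 a (bar i) h1 (fun j _ => by simp)).1 hx).symm
  refine Finset.sum_congr rfl fun a _ => ?_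
  by_cases h1 : freeSg n h k T a = 0
  · by_cases h2 : freeSg n h k T' a = 0
    · rw [h1, h2]; simp
    · have := key T' T hR.symm a h2
      unfold freeSg vloc
      rw [this]
  · have := key T T' hR a h1
    unfold freeSg vloc
    rw [this]

/-- Inside the segment `-P' k` is the old `Q k + c - k` and conversely, and the second differences
are exchanged as well. When the path is at the level `c` the two locations coincide, and only the
sum of the weights matters; this settles the ends of the segment. -/
theorem Seg.psi_eq {n : ℕ} {c : ℤ} {P Q P' Q' : ℕ → ℤ} {k₀ k₁ : ℕ} (H : Seg n c P Q P' Q' k₀ k₁)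
    {k : ℕ} (hk : k + 1 < n) (p : ℤ → Prop) [DecidablePred p] :
    (2 * P' k - P' (k - 1) - P' (k + 1)) * (if p (-P' k) then 1 else 0) +
      (Q' (k + 1) + Q' (k - 1) - 2 * Q' k) * (if p (Q' k + c - k) then 1 else 0) =
    (2 * P k - P (k - 1) - P (k + 1)) * (if p (-P k) then 1 else 0) +
      (Q (k + 1) + Q (k - 1) - 2 * Q k) * (if p (Q k + c - k) then 1 else 0) := by
  have h0 := H.pos
  have e1 := H.cases (j := k - 1) (by omega)
  have e2 := H.cases (j := k) (by omega)
  have e3 := H.cases hk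
  push_cast at e3
  by_cases hA : (k : ℤ) - P k - Q k = c
  · have a1 : P' k = P k := by omega
    have a2 : Q' k = Q k := by omega
    have a3 : Q k + c - k = -P k := by omega
    have a4 : P' (k - 1) - Q' (k - 1) = P (k - 1) - Q (k - 1) := by omega
    have a5 : P' (k + 1) - Q' (k + 1) = P (k + 1) - Q (k + 1) := by omega
    rw [a1, a2, a3, ← add_mul, ← add_mul]
    congr 1
    omega
  · by_cases hm : k₀ ≤ k ∧ k ≤ k₁
    · have hc : ((k - 1 : ℕ) : ℤ) = k - 1 := by omega
      rw [hc] at e1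
      have a1 : -P' k = Q k + c - k := by omega
      have a2 : Q' k + c - k = -P k := by omega
      have a3 : 2 * P' k - P' (k - 1) - P' (k + 1) = Q (k + 1) + Q (k - 1) - 2 * Q k := by omega
      have a4 : Q' (k + 1) + Q' (k - 1) - 2 * Q' k = 2 * P k - P (k - 1) - P (k + 1) := by omega
      rw [a1, a2, a3, a4, add_comm]
    · have a1 : P' k = P k := by omega
      have a2 : Q' k = Q k := by omega
      have a3 : P' (k - 1) = P (k - 1) := by omega
      have a4 : Q' (k - 1) = Q (k - 1) := by omega
      have a5 : P' (k + 1) = P (k + 1) := by omega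
      have a6 : Q' (k + 1) = Q (k + 1) := by omega
      rw [a1, a2, a3, a4, a5, a6]

/-- The distribution of the signs over the locations is the same for a tableau and its image. -/
theorem Seg.sum_eq {n h r ℓ : ℕ} {T T' : Tableau ℓ} {P Q P' Q' : ℕ → ℤ} {k₀ k₁ : ℕ}
    (hS : Seg n (n - ℓ - 1 - r) P Q P' Q' k₀ k₁) (hE : Enc n h T P Q) (hE' : Enc n h T' P' Q')
    (hT : ∀ a, (T a).Valid n) (hT' : ∀ a, (T' a).Valid n) (hP : Steps n P) (hQ : Steps n Q)
    (hP' : Steps n P') (hQ' : Steps n Q') (hR : Rest n h T T') {k : ℕ} (hk : k + 1 < n)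
    (p : ℤ → Prop) [DecidablePred p] :
    (∑ a, if p (vloc n h r k T' a) then sg n k (T' a) else 0) =
      ∑ a, if p (vloc n h r k T a) then sg n k (T a) else 0 := by
  rw [hE.sum_eq hT hP hQ r hk, hE'.sum_eq hT' hP' hQ' r hk, freeSum_eq_of_rest hE.hle hR,
    hS.psi_eq hk]

/-- The same for the last vertex of the long branch. -/
theorem phi_last_of_seg {n h r ℓ : ℕ} {T T' : Tableau ℓ} {P Q P' Q' : ℕ → ℤ} {k₀ k₁ : ℕ}
    (hS : Seg n (n - ℓ - 1 - r) P Q P' Q' k₀ k₁) (hk₁ : k₁ + 1 < n) (hE : Enc n h T P Q)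
    (hE' : Enc n h T' P' Q') (hR : Rest n h T T') {k : ℕ} (hk : k + 1 = n) (hn : 2 ≤ n) (V : ℤ) :
    Phi n h r k T' V = Phi n h r k T V := by
  obtain ⟨j, rfl⟩ : ∃ j, k = j + 1 := ⟨k - 1, by omega⟩
  have e1 := hS.cases (j := j) (by omega)
  have e2 := hS.cases (j := j + 1) (by omega)
  have a1 : P' j = P j := by omega
  have a2 : Q' j = Q j := by omega
  have a3 : P' (j + 1) = P (j + 1) := by omega
  have a4 : Q' (j + 1) = Q (j + 1) := by omega
  have key : ∀ S S' : Tableau ℓ, ∀ p q p' q' : ℕ → ℤ, Enc n h S p q → Enc n h S' p' q' →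
      Rest n h S S' → p' j = p j → q' j = q j → p' (j + 1) = p (j + 1) → q' (j + 1) = q (j + 1) →
      ∀ a, sg n (j + 1) (S a) ≠ 0 → S a = S' a := by
    intro S S' p q p' q' hS hS' hR b1 b2 b3 b4 a ha
    have hle := pos_le a
    have hrev := pos_rev a
    have f1 := hS.fst.iff j (by omega) a
    have f2 := hS'.fst.iff j (by omega) a
    have f3 := hS.bar_iff (j := j) (by omega) a
    have f4 := hS'.bar_iff (j := j) (by omega) a
    rw [b1, b3] at f2
    rw [b2, b4] at f4
    by_cases hc : pos a ≤ h
    · by_cases hx : S a = plain (j + 1)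
      · rw [hx, (f2.2 (f1.1 ⟨hc, hx⟩)).2]
      · refine ((hR.1 a (S a) hc fun i hi hy => ?_).1 rfl).symm
        rw [hy] at ha hx
        simp only [plain.injEq, sg] at ha hx
        split_ifs at ha <;> omega
    · by_cases hx : S a = bar (j + 1)
      · rw [hx, (f4.2 (f3.1 ⟨by omega, hx⟩)).2]
      · have h2 := hR.2 a.rev (S a).dual (by have := hS.hle; omega) fun i hi hy => ?_
        · rw [dual_apply, dual_apply, Fin.rev_rev] at h2
          have h3 := congrArg Letter.dual (h2.1 rfl)
          rw [dual_dual_letter, dual_dual_letter] at h3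
          exact h3.symm
        · have h3 := congrArg Letter.dual hy
          rw [dual_dual_letter] at h3
          rw [h3] at ha hx
          simp only [Letter.dual, bar.injEq, sg] at ha hx
          split_ifs at ha <;> omega
  refine (Finset.sum_congr rfl fun a _ => ?_).symm
  have c1 := key T T' P Q P' Q' hE hE' hR a1 a2 a3 a4 a
  have c2 := key T' T P' Q' P Q hE' hE hR.symm a1.symm a2.symm a3.symm a4.symm a
  unfold vloc
  by_cases d1 : sg n (j + 1) (T a) = 0
  · by_cases d2 : sg n (j + 1) (T' a) = 0
    · rw [d1, d2]; simp
    · rw [c2 d2]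
  · rw [c1 d1]

/-! ## Recovering the counting functions from the distribution of signs -/

/-- The part of the distribution that comes from the encoded letters. -/
def psi (c : ℤ) (P Q : ℕ → ℤ) (k : ℕ) (V : ℤ) : ℤ :=
  (if -P k = V then 2 * P k - P (k - 1) - P (k + 1) else 0) +
    if Q k + c - k = V then Q (k + 1) + Q (k - 1) - 2 * Q k else 0

/-- A pair of counting functions without a double step at the level `c` of `j - P j - Q j`. -/
structure NoDouble (n : ℕ) (c : ℤ) (P Q : ℕ → ℤ) : Prop where
  zero : P 0 = 0 ∧ Q 0 = 0
  step : ∀ j, j + 1 < n → P j ≤ P (j + 1) ∧ P (j + 1) ≤ P j + 1 ∧ Q j ≤ Q (j + 1) ∧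
    Q (j + 1) ≤ Q j + 1
  ne : ∀ j, j + 1 < n → P (j + 1) = P j + 1 → Q (j + 1) = Q j + 1 → (j : ℤ) - P j - Q j ≠ c

/-- If the two locations differ, the next values of `P` and `Q` are read off separately. If they
coincide, only the difference of the two steps is visible; the path is then at the level `c`, where
a double step is excluded, so it cannot be confused with no step. -/
theorem NoDouble.next_eq {n : ℕ} {c : ℤ} {P Q P' Q' : ℕ → ℤ} (H : NoDouble n c P Q)
    (H' : NoDouble n c P' Q') {k : ℕ} (hk : k + 1 < n) (h0 : P' (k - 1) = P (k - 1))
    (h1 : Q' (k - 1) = Q (k - 1)) (h2 : P' k = P k) (h3 : Q' k = Q k)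
    (hpsi : ∀ V, psi c P' Q' k V = psi c P Q k V) :
    P' (k + 1) = P (k + 1) ∧ Q' (k + 1) = Q (k + 1) := by
  have s1 := H.step k hk
  have s2 := H'.step k hk
  have n1 := H.ne k hk
  have n2 := H'.ne k hk
  have p1 := hpsi (-P k)
  have p2 := hpsi (Q k + c - k)
  simp only [psi, h0, h1, h2, h3] at p1 p2 s2 n2
  split_ifs at p1 p2 <;> omega

theorem NoDouble.eq_of_psi {n : ℕ} {c : ℤ} {P Q P' Q' : ℕ → ℤ} (H : NoDouble n c P Q)
    (H' : NoDouble n c P' Q') (hpsi : ∀ k, k + 1 < n → ∀ V, psi c P' Q' k V = psi c P Q k V)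
    (j : ℕ) (hj : j < n) : P' j = P j ∧ Q' j = Q j := by
  induction j using Nat.strong_induction_on with
  | _ j ih =>
    rcases j with _ | j
    · have := H.zero; have := H'.zero; omega
    · have h1 := ih j (by omega) (by omega)
      have h2 := ih (j - 1) (by omega) (by omega)
      exact H.next_eq H' hj h2.1 h2.2 h1.1 h1.2 (hpsi j hj)

/-- The change of the distribution at the vertex `j` under an arrow labelled `κ`, when the entry
stands at the location `V₀`. -/
def arrowShift (κ : ℕ) (V₀ : ℤ) (j : ℕ) (V : ℤ) : ℤ :=
  if j = κ then (if V = V₀ then -1 else 0) - (if V = V₀ + 1 then 1 else 0)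
  else if j + 1 = κ then (if V = V₀ + 1 then 1 else 0)
  else if j = κ + 1 then (if V = V₀ then 1 else 0)
  else 0

/-- The values at `κ - 1`, `κ`, `κ + 1` are `x, p, z` for `P` and `y, q, w` for `Q`, with primes
after the arrow; here the entry in the first column moves. The delicate cases are those where `d`,
the location of the second column, meets `-p` or `-p + 1`. -/
theorem two_jumps_left {x p z z' y q w w' d : ℤ} (hx : x = p - 1) (h1 : p ≤ z) (h2 : z ≤ p + 1)
    (h3 : p - 1 ≤ z') (h4 : z' ≤ p) (hy : y ≤ q) (hy' : q ≤ y + 1) (h5 : q ≤ w) (h6 : w ≤ q + 1)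
    (h7 : q ≤ w') (h8 : w' ≤ q + 1)
    (hF : ∀ V, ((if -(p - 1) = V then 2 * (p - 1) - x - z' else 0) +
        if d = V then w' + y - 2 * q else 0) =
      ((if -p = V then 2 * p - x - z else 0) + if d = V then w + y - 2 * q else 0) +
        ((if V = -p then -1 else 0) - if V = -p + 1 then 1 else 0))
    (hA : d = -p → ¬(z = p + 1 ∧ w = q + 1))
    (hB : d = -p + 1 → y + 1 ≠ q)
    (hR : d = -p + 1 → w + y - 2 * q ≤ 0) : z' = z ∧ w' = w := by
  have p1 := hF (-p)
  have p2 := hF (-p + 1)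
  have p3 := hF d
  rcases eq_or_ne d (-p) with h | h
  · rw [h] at p1 p2
    simp at p1 p2
    split_ifs at p1 p2
    omega
  · rcases eq_or_ne d (-p + 1) with h' | h'
    · rw [h'] at p1 p2
      simp at p1 p2
      split_ifs at p1 p2 <;> omega
    · simp [h] at p1 p2 p3
      split_ifs at p1 p2 p3 <;> omega

/-- The counterpart for an entry of the second column: `d` moves to `d + 1`, while `a` is the
location of the first column. -/
theorem two_jumps_right {x p z z' y q w w' a : ℤ} (hx : x ≤ p) (hx' : p ≤ x + 1) (h1 : p ≤ z)
    (h2 : z ≤ p + 1) (h3 : p ≤ z') (h4 : z' ≤ p + 1) (hy : y = q) (h5 : q ≤ w) (h6 : w ≤ q + 1)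
    (h7 : q + 1 ≤ w') (h8 : w' ≤ q + 2) {d : ℤ}
    (hF : ∀ V, ((if a = V then 2 * p - x - z' else 0) +
        if d + 1 = V then w' + y - 2 * (q + 1) else 0) =
      ((if a = V then 2 * p - x - z else 0) + if d = V then w + y - 2 * q else 0) +
        ((if V = d then -1 else 0) - if V = d + 1 then 1 else 0))
    (hA : a = d + 1 → ¬(z' = p + 1 ∧ w' = q + 2))
    (hB : a = d → x + 1 ≠ p)
    (hR : a = d → z' = p + 1 → 1 ≤ (2 * p - x - z) + (w + y - 2 * q)) : z' = z ∧ w' = w := by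
  have p1 := hF d
  have p2 := hF (d + 1)
  have p3 := hF a
  rcases eq_or_ne a d with h | h
  · rw [h] at p1 p2
    simp at p1 p2
    omega
  · rcases eq_or_ne a (d + 1) with h' | h'
    · rw [h'] at p1 p2
      simp at p1 p2
      omega
    · simp [h, h.symm, h', h'.symm] at p1 p2 p3
      omega

/-- Below `κ` the distributions force equality. The vertex `κ - 1` then shows an additional sign,
which moves one of the two thresholds at `κ`. The vertices `κ` and `κ + 1` fix the next two values,
and beyond them the arrow is invisible. The hypotheses `hR` and `hR'` exclude a remaining ambiguity
when the two locations interfere; they come from the position of the arrow at a first maximum. -/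
theorem NoDouble.eq_of_psi_arrow {n : ℕ} {c : ℤ} {P Q P' Q' : ℕ → ℤ} (H : NoDouble n c P Q)
    (H' : NoDouble n c P' Q') {κ : ℕ} (hκ : 1 ≤ κ) (hκn : κ < n) {V₀ : ℤ}
    (hpsi : ∀ k, k + 1 < n → ∀ V, psi c P' Q' k V = psi c P Q k V + arrowShift κ V₀ k V)
    (hR : κ + 1 < n → P κ = P (κ - 1) + 1 → V₀ = -P κ → psi c P Q κ (V₀ + 1) ≤ 0)
    (hR' : κ + 1 < n → P' (κ + 1) = P' κ + 1 → -P' κ = V₀ → 1 ≤ psi c P Q κ V₀) :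
    (∀ j < n, j ≠ κ → P' j = P j ∧ Q' j = Q j) ∧
      (P' κ = P κ - 1 ∧ Q' κ = Q κ ∧ V₀ = -P κ ∨
        P' κ = P κ ∧ Q' κ = Q κ + 1 ∧ V₀ = Q κ + c - κ) := by
  obtain ⟨κ, rfl⟩ : ∃ i, κ = i + 1 := ⟨κ - 1, by omega⟩
  have hpre : ∀ j, j < κ + 1 → P' j = P j ∧ Q' j = Q j := by
    intro j hj
    induction j using Nat.strong_induction_on with
    | _ j ih =>
      rcases j with _ | j
      · have := H.zero; have := H'.zero; omega
      · have h1 := ih j (by omega) (by omega)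
        have h2 := ih (j - 1) (by omega) (by omega)
        refine H.next_eq H' (by omega) h2.1 h2.2 h1.1 h1.2 fun V => ?_
        rw [hpsi j (by omega), arrowShift, if_neg (by omega), if_neg (by omega), if_neg (by omega),
          add_zero]
  have a1 := hpre κ (by omega)
  have a0 := hpre (κ - 1) (by omega)
  have s0 := H.step κ hκn
  have s0' := H'.step κ hκn
  have n0 := H.ne κ hκn
  have n0' := H'.ne κ hκn
  have hat : P' (κ + 1) = P (κ + 1) - 1 ∧ Q' (κ + 1) = Q (κ + 1) ∧ V₀ = -P (κ + 1) ∨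
      P' (κ + 1) = P (κ + 1) ∧ Q' (κ + 1) = Q (κ + 1) + 1 ∧ V₀ = Q (κ + 1) + c - (κ + 1 : ℕ) := by
    -- After the renaming of `κ`, this is the vertex just before the arrow: the distribution gains 1
    -- at `V₀ + 1`.
    have p1 := hpsi κ hκn (-P κ)
    have p2 := hpsi κ hκn (Q κ + c - κ)
    have p3 := hpsi κ hκn (V₀ + 1)
    simp only [psi, arrowShift, a0, a1, if_neg (show ¬κ = κ + 1 by omega), if_true] at p1 p2 p3 s0'
    split_ifs at p1 p2 p3 <;> omega
  refine ⟨?_, hat⟩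
  have hnext : κ + 2 < n → P' (κ + 2) = P (κ + 2) ∧ Q' (κ + 2) = Q (κ + 2) := by
    intro hk
    obtain ⟨s1, s2, s3, s4⟩ := H.step (κ + 1) hk
    obtain ⟨t1, t2, t3, t4⟩ := H'.step (κ + 1) hk
    have n1 := H.ne (κ + 1) hk
    have n1' := H'.ne (κ + 1) hk
    have hF := hpsi (κ + 1) hk
    have r1 := hR hk
    have r2 := hR' hk
    simp only [psi, arrowShift, if_true, Nat.add_sub_cancel] at hF r1 r2
    simp only [show κ + 1 + 1 = κ + 2 from rfl] at hF r1 r2 n1 n1' s2 s3 s4 s1 t1 t2 t3 t4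
    rcases hat with ⟨h1, h2, h3⟩ | ⟨h1, h2, h3⟩
    · simp only [h1, h2, h3, a1.1, a1.2] at hF s0' t1 t2 t3 t4
      refine two_jumps_left (x := P κ) (y := Q κ) (by omega) s1 s2 (by omega) (by omega) (by omega)
        (by omega) s3 s4 t3 t4 hF (by push_cast; omega) (by push_cast; omega) fun h4 => ?_
      have r3 := r1 (by omega) h3
      rw [if_neg (by omega), if_pos (by omega)] at r3
      simpa using r3
    · have hd : Q (κ + 1) + 1 + c - (κ + 1 : ℕ) = Q (κ + 1) + c - (κ + 1 : ℕ) + 1 := by ring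
      simp only [h1, h2, h3, a1.1, a1.2, hd] at hF s0' t1 t2 t3 t4
      refine two_jumps_right (x := P κ) (y := Q κ) (by omega) (by omega) s1 s2 t1 t2 (by omega)
        s3 s4 t3 (by omega) hF (by push_cast; omega) (by push_cast; omega) fun h4 h5 => ?_
      have r3 := r2 (by omega) (by omega)
      rw [if_pos (by omega), if_pos (by omega)] at r3
      exact r3
  have hnext2 : κ + 3 < n → P' (κ + 3) = P (κ + 3) ∧ Q' (κ + 3) = Q (κ + 3) := by
    intro hk
    have b1 := hnext (by omega)
    obtain ⟨s1, s2, s3, s4⟩ := H.step (κ + 2) hk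
    obtain ⟨t1, t2, t3, t4⟩ := H'.step (κ + 2) hk
    have u := H.step (κ + 1) (by omega)
    have u' := H'.step (κ + 1) (by omega)
    have n1 := H.ne (κ + 2) hk
    have n1' := H'.ne (κ + 2) hk
    have hF := hpsi (κ + 2) hk
    have hF1 := hF (-P (κ + 2))
    have hF2 := hF (Q (κ + 2) + c - (κ + 2 : ℕ))
    simp only [psi, arrowShift, if_true, show κ + 2 - 1 = κ + 1 from rfl, b1.1, b1.2,
      if_neg (show ¬κ + 2 = κ + 1 by omega), if_neg (show ¬κ + 2 + 1 = κ + 1 by omega)] at hF1 hF2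
    simp only [show κ + 1 + 1 = κ + 2 from rfl, show κ + 2 + 1 = κ + 3 from rfl]
      at hF1 hF2 n1 n1' s1 s2 s3 s4 t1 t2 t3 t4 u u'
    rcases hat with ⟨h1, h2, h3⟩ | ⟨h1, h2, h3⟩ <;> split_ifs at hF1 hF2 <;> omega
  intro j hj hjκ
  induction j using Nat.strong_induction_on with
  | _ j ih =>
    rcases lt_or_ge j (κ + 1) with h1 | h1
    · exact hpre j h1
    · obtain ⟨d, rfl⟩ : ∃ d, j = κ + 2 + d := ⟨j - (κ + 2), by omega⟩
      rcases d with _ | _ | d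
      · exact hnext hj
      · exact hnext2 hj
      · have h1 := ih (κ + 2 + (d + 1)) (by omega) (by omega) (by omega)
        have h2 := ih (κ + 2 + d) (by omega) (by omega) (by omega)
        refine H.next_eq H' hj h2.1 h2.2 h1.1 h1.2 fun V => ?_
        have h3 := hpsi (κ + 2 + (d + 1)) hj V
        rw [arrowShift, if_neg (show ¬κ + 2 + (d + 1) = κ + 1 by omega),
          if_neg (show ¬κ + 2 + (d + 1) + 1 = κ + 1 by omega),
          if_neg (show ¬κ + 2 + (d + 1) = κ + 1 + 1 by omega), add_zero] at h3
        exact h3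

/-! ## Replacing one entry -/

theorem ColEnc.le_of_plain {n h ℓ : ℕ} {T : Tableau ℓ} {P : ℕ → ℤ} (H : ColEnc n h T P) {i j : ℕ}
    (hj : j < n) (hij : i + 1 ≤ j) {a : Fin ℓ} (ha : pos a ≤ h) (hx : T a = plain (i + 1)) :
    (pos a : ℤ) ≤ P j :=
  ((H.iff i (by omega) a).1 ⟨ha, hx⟩).2.trans (H.mono_le hij hj)

theorem ColEnc.eq_of_thresholds {n h ℓ : ℕ} {S S' T T' : Tableau ℓ} {P P' : ℕ → ℤ}
    (hT : ColEnc n h T P) (hT' : ColEnc n h T' P') (hR : ColRest n h S T)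
    (hR' : ColRest n h S' T') {a : Fin ℓ} (ha : pos a ≤ h)
    (hS : ∀ y, (∀ j, j + 1 < n → y ≠ plain (j + 1)) → S a = y → S' a = y)
    (hP : ∀ j, j + 1 < n → P j < pos a ∧ (pos a : ℤ) ≤ P (j + 1) →
      P' j < pos a ∧ (pos a : ℤ) ≤ P' (j + 1)) : T' a = T a := by
  by_cases hx : ∃ j, j + 1 < n ∧ T a = plain (j + 1)
  · obtain ⟨j, hj, hx⟩ := hx
    rw [hx, ((hT'.iff j hj a).2 (hP j hj ((hT.iff j hj a).1 ⟨ha, hx⟩))).2]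
  · push Not at hx
    exact (hR' a (T a) ha hx).1 (hS _ hx ((hR a (T a) ha hx).2 rfl))

theorem ColEnc.eq_of_eq {n h ℓ κ : ℕ} {S S' T T' : Tableau ℓ} {P P' : ℕ → ℤ} (hκ : 1 ≤ κ)
    (hκn : κ < n) (hT : ColEnc n h T P) (hT' : ColEnc n h T' P') (hR : ColRest n h S T)
    (hR' : ColRest n h S' T')
    (hS : ∀ a : Fin ℓ, pos a ≤ h → S' a = S a ∨ S a = plain κ ∧ S' a = plain (κ + 1))
    (hP : ∀ j < n, P' j = P j) {a : Fin ℓ} (ha : pos a ≤ h) : T' a = T a := by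
  refine hT.eq_of_thresholds hT' hR hR' ha (fun y hy hx => ?_) (fun j hj => ?_)
  · rcases hS a ha with h1 | ⟨h1, -⟩
    · rw [h1, hx]
    · obtain ⟨i, rfl⟩ : ∃ i, κ = i + 1 := ⟨κ - 1, by omega⟩
      exact absurd (hx.symm.trans h1) (hy i hκn)
  · rw [hP j (by omega), hP (j + 1) hj]
    exact id

/-- Lowering the single threshold at `κ` by one relabels just the row `P κ`, from `κ` to `κ + 1`. -/
theorem ColEnc.exists_update {n h ℓ κ : ℕ} {S S' T T' : Tableau ℓ} {P P' : ℕ → ℤ} (hh : h ≤ ℓ)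
    (hκ : 1 ≤ κ) (hκn : κ < n) (hT : ColEnc n h T P) (hT' : ColEnc n h T' P')
    (hR : ColRest n h S T) (hR' : ColRest n h S' T')
    (hS : ∀ a : Fin ℓ, pos a ≤ h → S' a = S a ∨ S a = plain κ ∧ S' a = plain (κ + 1))
    (hP : ∀ j < n, j ≠ κ → P' j = P j) (hPκ : P' κ = P κ - 1) :
    ∃ c : Fin ℓ, pos c ≤ h ∧ (pos c : ℤ) = P κ ∧ T c = plain κ ∧ T' c = plain (κ + 1) ∧
      ∀ a : Fin ℓ, pos a ≤ h → a ≠ c → T' a = T a := by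
  obtain ⟨i, rfl⟩ : ∃ i, κ = i + 1 := ⟨κ - 1, by omega⟩
  have h0 := hP i (by omega) (by omega)
  have h1 := hT'.mono i hκn
  have h2 := hT.le (i + 1) hκn
  have h3 := hT.nonneg (j := i) (by omega)
  obtain ⟨c, hc⟩ := exists_pos (ℓ := ℓ) (q := P (i + 1)) (by omega) (by omega)
  have hch : pos c ≤ h := by omega
  have hTc := ((hT.iff i hκn c).2 ⟨by omega, by omega⟩).2
  refine ⟨c, hch, hc, hTc, ?_, fun a ha hac => ?_⟩
  · by_cases hn : i + 2 < n
    · have h4 := hP (i + 1 + 1) hn (by omega)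
      have h5 := hT.mono (i + 1) hn
      exact ((hT'.iff (i + 1) hn c).2 ⟨by omega, by omega⟩).2
    -- For `κ + 1 = n` the new letter `n` is not encoded by thresholds and has to be recovered from
    -- the unencoded letters of `S'`.
    · have hy : ∀ j, j + 1 < n → T' c ≠ plain (j + 1) := by
        intro j hj hx
        have := hT'.le_of_plain hκn (by omega) hch hx
        omega
      have h4 := (hR' c (T' c) hch hy).2 rfl
      rcases hS c hch with h5 | ⟨-, h5⟩
      · have h6 := (hR c (T' c) hch hy).1 (by rw [← h5, h4])
        exact absurd (h6.symm.trans hTc) (hy i hκn)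
      · rw [← h4, h5]
  · have hne : (pos a : ℤ) ≠ P (i + 1) := fun h4 => hac (pos_injective (by omega))
    refine hT.eq_of_thresholds hT' hR hR' ha (fun y hy hx => ?_) (fun j hj => ?_)
    · rcases hS a ha with h1 | ⟨h1, -⟩
      · rw [h1, hx]
      · exact absurd (hx.symm.trans h1) (hy i hκn)
    · by_cases e1 : j = i + 1
      · subst e1
        have h4 := hP (i + 1 + 1) hj (by omega)
        omega
      · have h4 := hP j (by omega) e1
        by_cases e2 : j + 1 = i + 1
        · rw [e2]; omega
        · have h5 := hP (j + 1) hj e2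
          omega

/-! ## The distribution of signs under an arrow -/

theorem arrowShift_letter {n κ k : ℕ} (hκ : 1 ≤ κ) (hκn : κ < n) (hk : k + 1 < n) {x : Letter}
    (hx : sg n κ x = 1) (s V : ℤ) :
    (if off n k (x.next n κ) - s = V then sg n k (x.next n κ) else 0) =
      (if off n k x - s = V then sg n k x else 0) + arrowShift κ (off n κ x - s) k V := by
  have hkn : k < n := by omega
  have hκ0 : κ ≠ κ + 1 := by omega
  rcases next_cases hκn.le hx with ⟨-, rfl, h1⟩ | ⟨-, rfl, h1⟩ | ⟨h0, -⟩ | ⟨h0, -⟩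
  rotate_left 2
  · omega
  · omega
  all_goals
    rw [h1]
    clear hx h1
    by_cases e1 : k = κ
    · subst e1
      simp only [sg, off, arrowShift, hkn, true_and, if_true, if_neg hκ0, if_neg hκ0.symm]
      split_ifs <;> omega
    · by_cases e2 : k + 1 = κ
      · subst e2
        simp only [sg, off, arrowShift, hkn, hκn, true_and, if_true, if_neg hκ0,
          if_neg (show ¬k = k + 1 by omega), if_neg (show ¬k + 1 = k by omega),
          if_neg (show ¬k + 1 + 1 = k by omega), if_neg (show ¬k + 1 + 1 = k + 1 by omega)]
        split_ifs <;> omega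
      · by_cases e3 : k = κ + 1
        · subst e3
          simp only [sg, off, arrowShift, hkn, hκn, true_and, if_true, if_neg hκ0, if_neg hκ0.symm,
            if_neg (show ¬κ = κ + 1 + 1 by omega), if_neg (show ¬κ + 1 = κ + 1 + 1 by omega),
            if_neg (show ¬κ + 1 + 1 = κ by omega)]
          split_ifs <;> omega
        · simp only [sg, off, arrowShift, hkn, hκn, true_and, if_true, if_neg e1, if_neg e2,
            if_neg e3, if_neg (Ne.symm e1), if_neg (Ne.symm e2), if_neg (Ne.symm e3),
            if_neg (show ¬κ + 1 = k + 1 by omega), ite_self, add_zero]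

/-- The letter `n` in the first column and `n̄` in the second are neither free nor encoded; they
carry no sign for `k + 1 < n`. -/
def IsFree {ℓ : ℕ} (h : ℕ) (T : Tableau ℓ) (a : Fin ℓ) : Prop :=
  (pos a ≤ h ∧ ∃ i, T a = bar i) ∨ (h < pos a ∧ ∃ i, T a = plain i)

theorem freeSg_of_isFree {n h k ℓ : ℕ} {T : Tableau ℓ} {a : Fin ℓ} (H : IsFree h T a) :
    freeSg n h k T a = sg n k (T a) := by
  unfold freeSg
  rcases H with ⟨h1, i, hx⟩ | ⟨h1, i, hx⟩ <;> rw [hx]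
  · simp [h1]
  · simp [h1]

theorem freeSg_of_not_isFree {n h k ℓ : ℕ} {T : Tableau ℓ} {a : Fin ℓ} (H : ¬IsFree h T a) :
    freeSg n h k T a = 0 := by
  unfold freeSg
  rcases hx : T a with i | i <;> simp only <;> split_ifs with h1
  · rfl
  · exact absurd (Or.inr ⟨by omega, i, hx⟩) H
  · exact absurd (Or.inl ⟨h1, i, hx⟩) H
  · rfl

theorem sum_eq_add_sub {ℓ : ℕ} (c : Fin ℓ) (f g : Fin ℓ → ℤ)
    (hfg : ∀ a ≠ c, g a = f a) : ∑ a, g a = ∑ a, f a + (g c - f c) := by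
  rw [← Finset.add_sum_erase _ _ (Finset.mem_univ c), ← Finset.add_sum_erase _ f (Finset.mem_univ c),
    Finset.sum_congr rfl fun a ha => hfg a (Finset.ne_of_mem_erase ha)]
  ring

theorem sum_sg_update {n h r ℓ κ k : ℕ} (hκ : 1 ≤ κ) (hκn : κ < n) (hk : k + 1 < n) {T : Tableau ℓ}
    {c : Fin ℓ} (hc : sg n κ (T c) = 1) (V : ℤ) :
    (∑ a, if vloc n h r k (Function.update T c ((T c).next n κ)) a = V then
      sg n k (Function.update T c ((T c).next n κ) a) else 0) =
    (∑ a, if vloc n h r k T a = V then sg n k (T a) else 0) +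
      arrowShift κ (vloc n h r κ T c) k V := by
  refine (sum_eq_add_sub c (fun a => if vloc n h r k T a = V then sg n k (T a) else 0) _
    fun a ha => ?_).trans ?_
  · unfold vloc
    rw [Function.update_of_ne ha]
  · have h1 := arrowShift_letter hκ hκn hk hc (shiftPos h r c) V
    unfold vloc
    rw [Function.update_self, h1, add_sub_cancel_left]

theorem isFree_update {n h κ ℓ : ℕ} (hκn : κ < n) {T : Tableau ℓ} {c : Fin ℓ}
    (hc : sg n κ (T c) = 1) (a : Fin ℓ) :
    IsFree h (Function.update T c ((T c).next n κ)) a ↔ IsFree h T a := by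
  by_cases ha : a = c
  · subst ha
    unfold IsFree
    rw [Function.update_self]
    rcases next_cases hκn.le hc with ⟨-, h0, h1⟩ | ⟨-, h0, h1⟩ | ⟨h0, -⟩ | ⟨h0, -⟩
    · rw [h1, h0]; simp
    · rw [h1, h0]; simp
    · omega
    · omega
  · unfold IsFree
    rw [Function.update_of_ne ha]

/-- An arrow with label below `n` does not change whether a letter is barred. Hence freeness is
preserved, and the change of the distribution falls wholly on the free part or wholly on the encoded
one. -/
theorem freeSum_update {n h r ℓ κ k : ℕ} (hκ : 1 ≤ κ) (hκn : κ < n) (hk : k + 1 < n) {T : Tableau ℓ}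
    {c : Fin ℓ} (hc : sg n κ (T c) = 1) (V : ℤ) :
    (IsFree h T c → freeSum n h r k (Function.update T c ((T c).next n κ)) (· = V) =
      freeSum n h r k T (· = V) + arrowShift κ (vloc n h r κ T c) k V) ∧
    (¬IsFree h T c → freeSum n h r k (Function.update T c ((T c).next n κ)) (· = V) =
      freeSum n h r k T (· = V)) := by
  have h1 : ∀ a ≠ c, freeSg n h k (Function.update T c ((T c).next n κ)) a = freeSg n h k T a := by
    intro a ha
    unfold freeSg
    rw [Function.update_of_ne ha]
  unfold freeSum
  have h2 := sum_eq_add_sub c (fun a => if vloc n h r k T a = V then freeSg n h k T a else 0)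
    (fun a => if vloc n h r k (Function.update T c ((T c).next n κ)) a = V then
      freeSg n h k (Function.update T c ((T c).next n κ)) a else 0) fun a ha => by
        rw [h1 a ha]
        unfold vloc
        rw [Function.update_of_ne ha]
  constructor <;> intro hF <;> refine h2.trans ?_
  · rw [freeSg_of_isFree hF, freeSg_of_isFree ((isFree_update hκn hc c).2 hF)]
    have h3 := arrowShift_letter hκ hκn hk hc (shiftPos h r c) V
    unfold vloc
    rw [Function.update_self, h3, add_sub_cancel_left]
  · rw [freeSg_of_not_isFree hF, freeSg_of_not_isFree fun h2 => hF ((isFree_update hκn hc c).1 h2),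
      ite_self, ite_self, sub_zero, add_zero]

/-- If replacing an entry leads to a tableau with (D.2) to (D.4), then this entry is the first
one that can be replaced. -/
theorem le_of_mem_candF {n ℓ : ℕ} (hn : 4 ≤ n) {h r : ℕ} {i : Fin n} (hi : i.val + 1 < n)
    {T : Tableau ℓ} (hT : ∀ a, (T a).Valid n) {c c' : Fin ℓ} (hc : c ∈ candF h r i T)
    (hc' : c' ∈ candF h r i T)
    (h2 : CondD2 n h (Function.update T c ((T c).next n (i.val + 1))))
    (h3 : CondD3 n h (Function.update T c ((T c).next n (i.val + 1))))
    (h4 : CondD4 n h (r + 1) (Function.update T c ((T c).next n (i.val + 1)))) : c ≤ c' := by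
  obtain ⟨a1, a2⟩ := (mem_candF hn hT c).1 hc
  obtain ⟨b1, b2⟩ := (mem_candF hn hT c').1 hc'
  have hV := a2.unique b2
  have l1 := (vloc_cases (h := h) (r := r) hi c (T := T)).1 a1
  have l2 := (vloc_cases (h := h) (r := r) hi c' (T := T)).1 b1
  have p1 := shiftPos_cases h r c
  have p2 := shiftPos_cases h r c'
  by_contra hlt
  have hpos : pos c' < pos c := by unfold pos; rw [Fin.le_def] at hlt; omega
  have hne : c' ≠ c := by rintro rfl; omega
  rcases l1 with ⟨l1, l1'⟩ | ⟨l1, l1'⟩ <;> rcases l2 with ⟨l2, l2'⟩ | ⟨l2, l2'⟩ <;> push_cast at * <;>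
    try omega
  have hnx : (T c).next n (i.val + 1) = bar (i.val + 1) := by rw [l1]; simp [Letter.next, hi]
  rw [hnx] at h2 h3 h4
  have e1 : Function.update T c (bar (i.val + 1)) c' = plain (i.val + 1) := by
    rw [Function.update_of_ne hne, l2]
  have e2 : Function.update T c (bar (i.val + 1)) c = bar (i.val + 1) := Function.update_self _ _ _
  by_cases q1 : pos c ≤ h
  · exact h2 ⟨c', c, i.val + 1, hpos, q1, e1, e2, by push_cast; omega⟩
  · by_cases q2 : pos c' ≤ h
    · refine h4 ⟨c', c, i.val + 1, q2, by omega, e1, e2, ?_⟩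
      rw [max_eq_left (by omega)]
      push_cast
      omega
    · exact h3 ⟨c', c, i.val + 1, by omega, hpos, e1, e2, by push_cast; omega⟩

/-! ### Compatibility of `sigma` with the lowering operators -/

theorem exists_sigma_enc {n ℓ h r : ℕ} (hn : ℓ + 2 + r ≤ n) (hr : 1 ≤ r) (hh : h ≤ ℓ)
    {T : Tableau ℓ} (hT : T ∈ tableauSet n ℓ h r) :
    ∃ P Q P' Q' k₀ k₁, Enc n h T P Q ∧ Steps n P ∧ Steps n Q ∧ Enc n h (sigma n ℓ h r T) P' Q' ∧
      Steps n P' ∧ Steps n Q' ∧ Seg n (n - ℓ - 1 - r) P Q P' Q' k₀ k₁ ∧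
      Rest n h T (sigma n ℓ h r T) := by
  obtain ⟨P, Q, hE, hP, hQ⟩ := exists_enc hh hT.1 hT.2.1
  obtain ⟨P', Q', k₀, k₁, hS⟩ := exists_seg hn hr hT.2.2.2.2.1 hE hP hQ
  obtain ⟨hE', hR⟩ := enc_sigma hn hr hE hP hQ hS
  obtain ⟨hP', hQ'⟩ := hS.steps_fst hE hP hQ
  exact ⟨P, Q, P', Q', k₀, k₁, hE, hP, hQ, hE', hP', hQ', hS, hR⟩

theorem sum_sg_sigma {n ℓ h r : ℕ} (hn : ℓ + 2 + r ≤ n) (hr : 1 ≤ r) (hh : h ≤ ℓ)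
    {T : Tableau ℓ} (hT : T ∈ tableauSet n ℓ h r) {k : ℕ} (hk : k + 1 < n)
    (p : ℤ → Prop) [DecidablePred p] :
    (∑ a, if p (vloc n h r k (sigma n ℓ h r T) a) then sg n k (sigma n ℓ h r T a) else 0) =
      ∑ a, if p (vloc n h r k T a) then sg n k (T a) else 0 := by
  obtain ⟨P, Q, P', Q', k₀, k₁, hE, hP, hQ, hE', hP', hQ', hS, hR⟩ := exists_sigma_enc hn hr hh hT
  exact hS.sum_eq hE hE' hT.1 ((bijOn_sigma hn hh).mapsTo hT).1 hP hQ hP' hQ' hR hk p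

theorem Phi_sigma {n ℓ h r : ℕ} (hn : ℓ + 2 + r ≤ n) (hr : 1 ≤ r) (hh : h ≤ ℓ)
    {T : Tableau ℓ} (hT : T ∈ tableauSet n ℓ h r) {k : ℕ} (hk : k < n) (V : ℤ) :
    Phi n h r k (sigma n ℓ h r T) V = Phi n h r k T V := by
  by_cases hk' : k + 1 < n
  · exact sum_sg_sigma hn hr hh hT hk' (· ≤ V)
  · obtain ⟨P, Q, P', Q', k₀, k₁, hE, hP, hQ, hE', hP', hQ', hS, hR⟩ :=
      exists_sigma_enc hn hr hh hT
    refine phi_last_of_seg hS ?_ hE hE' hR (by omega) (by omega) V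
    -- As `P + Q ≤ ℓ`, the last visit to the level `c` takes place at `k₁ ≤ c + ℓ = n - 1 - r < n -
    -- 1`.
    by_contra hcon
    have h1 := hS.lt
    have h2 := hS.right
    have h3 := hE.fst.le k₁ h1
    have h4 := hE.snd.le k₁ h1
    omega

theorem firstMaxPos_sigma_iff {n ℓ h r : ℕ} (hn : ℓ + 2 + r ≤ n) (hr : 1 ≤ r) (hh : h ≤ ℓ)
    {T : Tableau ℓ} (hT : T ∈ tableauSet n ℓ h r) {k : ℕ} (hk : k < n) (V : ℤ) :
    FirstMaxPos (Phi n h r k (sigma n ℓ h r T)) V ↔ FirstMaxPos (Phi n h r k T) V := by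
  rw [show Phi n h r k (sigma n ℓ h r T) = Phi n h r k T from funext (Phi_sigma hn hr hh hT hk)]

theorem noDouble_of {n h r ℓ : ℕ} {T : Tableau ℓ} {P Q : ℕ → ℤ} (H : CondD4 n h (r + 1) T)
    (hE : Enc n h T P Q) (hP : Steps n P) (hQ : Steps n Q) : NoDouble n (n - ℓ - 1 - r) P Q := by
  refine ⟨⟨hE.fst.zero, hE.snd.zero⟩,
    fun j hj => ⟨hE.fst.mono j hj, hP j hj, hE.snd.mono j hj, hQ j hj⟩, fun j hj h1 h2 h3 => ?_⟩
  refine H.ne hE (by omega) hj h1 h2 ?_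
  push_cast
  omega

theorem Enc.sum_eq_psi {n h ℓ : ℕ} {T : Tableau ℓ} {P Q : ℕ → ℤ} (H : Enc n h T P Q)
    (hT : ∀ a, (T a).Valid n) (hP : Steps n P) (hQ : Steps n Q) (r : ℕ) {k : ℕ} (hk : k + 1 < n)
    (V : ℤ) : (∑ a, if vloc n h r k T a = V then sg n k (T a) else 0) =
      psi (n - ℓ - 1 - r) P Q k V + freeSum n h r k T (· = V) := by
  refine (H.sum_eq hT hP hQ r hk (· = V)).trans ?_
  unfold psi
  simp only [mul_ite, mul_one, mul_zero]

/-- The partial sum rises strictly into its first maximum and does not rise out of it. This supplies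
the two side conditions needed to recover the counting functions across an arrow. -/
theorem jump_of_firstMaxPos {n h r k ℓ : ℕ} {T : Tableau ℓ} {V : ℤ}
    (H : FirstMaxPos (Phi n h r k T) V) :
    1 ≤ (∑ a, if vloc n h r k T a = V then sg n k (T a) else 0) ∧
      (∑ a, if vloc n h r k T a = V + 1 then sg n k (T a) else 0) ≤ 0 := by
  have key : ∀ W, (∑ a, if vloc n h r k T a = W then sg n k (T a) else 0) =
      Phi n h r k T W - Phi n h r k T (W - 1) := by
    intro W
    unfold Phi
    rw [← Finset.sum_sub_distrib]
    refine Finset.sum_congr rfl fun a _ => ?_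
    split_ifs <;> omega
  have h1 := H.2.2 (V - 1) (by omega)
  have h2 := H.2.1 (V + 1)
  rw [key, key, add_sub_cancel_right]
  omega

/-- A free sign `-1` at this location would be `κ̄` in the first column, at the distance from the
letter `κ` excluded by (D.2), or `κ + 1` in the second column, whose location is too low. -/
theorem freeSum_nonneg_of {n h r ℓ κ : ℕ} (hκn : κ + 1 < n) {T : Tableau ℓ} {P Q : ℕ → ℤ}
    (hE : Enc n h T P Q) (hD : CondD2 n h T) (hκ : 1 ≤ κ) (hP : P κ = P (κ - 1) + 1) :
    0 ≤ freeSum n h r κ T (· = -P κ + 1) := by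
  refine Finset.sum_nonneg fun a _ => ?_
  split_ifs with h1 <;> try simp only at h1
  · by_contra hneg
    by_cases hF : IsFree h T a
    · rw [freeSg_of_isFree hF] at hneg
      have h2 := sg_cases n κ (T a)
      have h3 := (vloc_cases (n := n) (h := h) (r := r) (k := κ) (by omega) a (T := T)).2 (by omega)
      have h4 := shiftPos_cases h r a
      have h5 := hE.fst.le κ (by omega)
      obtain ⟨i, rfl⟩ : ∃ i, κ = i + 1 := ⟨κ - 1, by omega⟩
      obtain ⟨b, h6, h7, h8⟩ := hE.exists_plain (j := i) (by omega) (q := P (i + 1))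
        (by rw [Nat.add_sub_cancel] at hP; omega) le_rfl
      rcases hF with ⟨hF1, j, hF2⟩ | ⟨hF1, j, hF2⟩ <;> rw [hF2] at h3 <;> simp at h3
      · exact hD ⟨b, a, i + 1, by omega, hF1, h8, by rw [hF2, h3.1], by push_cast; omega⟩
      · omega
    · rw [freeSg_of_not_isFree hF] at hneg
      omega
  · exact le_rfl

theorem freeSum_nonpos_of {n h r ℓ κ : ℕ} (hκn : κ + 1 < n) {T : Tableau ℓ} {P Q : ℕ → ℤ}
    (hE : Enc n h T P Q) (hD : CondD2 n h T) (hP : P (κ + 1) = P κ + 1) :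
    freeSum n h r κ T (· = -P κ) ≤ 0 := by
  refine Finset.sum_nonpos fun a _ => ?_
  split_ifs with h1 <;> try simp only at h1
  · by_contra hneg
    by_cases hF : IsFree h T a
    · rw [freeSg_of_isFree hF] at hneg
      have h2 := sg_cases n κ (T a)
      have h3 := (vloc_cases (n := n) (h := h) (r := r) (k := κ) (by omega) a (T := T)).1 (by omega)
      have h4 := shiftPos_cases h r a
      have h5 := hE.fst.le κ (by omega)
      obtain ⟨b, h6, h7, h8⟩ := hE.exists_plain (j := κ) hκn (q := P (κ + 1)) (by omega) le_rfl
      rcases hF with ⟨hF1, j, hF2⟩ | ⟨hF1, j, hF2⟩ <;> rw [hF2] at h3 <;> simp at h3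
      · have hne : pos a ≠ pos b := by
          intro h9
          rw [pos_injective h9, h8] at hF2
          cases hF2
        exact hD ⟨b, a, κ + 1, by omega, hF1, h8, by rw [hF2, h3.1], by push_cast; omega⟩
      · omega
    · rw [freeSg_of_not_isFree hF] at hneg
      omega
  · exact le_rfl

/-- The image of a tableau obtained along an arrow is obtained by replacing one entry of the image,
at the same location. -/
theorem exists_update_sigma {n ℓ h r κ : ℕ} (hn : ℓ + 2 + r ≤ n) (hr : 1 ≤ r) (hh : h ≤ ℓ)
    (hκ : 1 ≤ κ) (hκn : κ < n) {T : Tableau ℓ} (hT : T ∈ tableauSet n ℓ h r) {c : Fin ℓ}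
    (hc : sg n κ (T c) = 1) (hF : FirstMaxPos (Phi n h r κ T) (vloc n h r κ T c))
    (hT1 : Function.update T c ((T c).next n κ) ∈ tableauSet n ℓ h r) :
    ∃ c', sg n κ (sigma n ℓ h r T c') = 1 ∧
      vloc n h r κ (sigma n ℓ h r T) c' = vloc n h r κ T c ∧
      sigma n ℓ h r (Function.update T c ((T c).next n κ)) =
        Function.update (sigma n ℓ h r T) c' ((sigma n ℓ h r T c').next n κ) := by
  set T1 := Function.update T c ((T c).next n κ) with hT1def
  have hT1a : ∀ a ≠ c, T1 a = T a := fun a ha => Function.update_of_ne ha _ _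
  have hT1c : T1 c = (T c).next n κ := Function.update_self _ _ _
  have hcase : (T c = plain κ ∧ T1 c = plain (κ + 1)) ∨ (T c = bar (κ + 1) ∧ T1 c = bar κ) := by
    rcases next_cases hκn.le hc with ⟨-, h0, h1⟩ | ⟨-, h0, h1⟩ | ⟨h0, -⟩ | ⟨h0, -⟩
    · exact Or.inl ⟨h0, hT1c.trans h1⟩
    · exact Or.inr ⟨h0, hT1c.trans h1⟩
    · omega
    · omega
  obtain ⟨P, Q, P', Q', k₀, k₁, hE, hP, hQ, hE', hP', hQ', -, hR⟩ := exists_sigma_enc hn hr hh hT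
  obtain ⟨p, q, p', q', j₀, j₁, hE1, hp, hq, hE1', hp', hq', -, hR1⟩ := exists_sigma_enc hn hr hh hT1
  have hU := (bijOn_sigma hn hh).mapsTo hT
  have hU1 := (bijOn_sigma hn hh).mapsTo hT1
  have hF' := (firstMaxPos_sigma_iff hn hr hh hT hκn _).2 hF
  have N := noDouble_of hU.2.2.2.2.1 hE' hP' hQ'
  have N1 := noDouble_of hU1.2.2.2.2.1 hE1' hp' hq'
  have hfree := fun k V => freeSum_eq_of_rest hh hR r k (· = V)
  have hfree1 := fun k V => freeSum_eq_of_rest hh hR1 r k (· = V)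
  have hpsi : ∀ k, k + 1 < n → ∀ V, psi (n - ℓ - 1 - r) p' q' k V + freeSum n h r k T1 (· = V) =
      psi (n - ℓ - 1 - r) P' Q' k V + freeSum n h r k T (· = V) +
        arrowShift κ (vloc n h r κ T c) k V := by
    intro k hk V
    have e1 := hE'.sum_eq_psi hU.1 hP' hQ' r hk V
    have e2 := hE1'.sum_eq_psi hU1.1 hp' hq' r hk V
    have e3 := sum_sg_sigma hn hr hh hT hk (· = V)
    have e4 := sum_sg_sigma hn hr hh hT1 hk (· = V)
    have e5 := sum_sg_update (h := h) (r := r) hκ hκn hk hc V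
    have e6 := hfree k V
    have e7 := hfree1 k V
    rw [← hT1def] at e5
    rw [e3] at e1
    rw [e4, e5] at e2
    omega
  have hrev : ∀ a : Fin ℓ, h < pos a → pos a.rev ≤ ℓ - h := fun a ha => by
    have := pos_rev a; omega
  have hdual : ∀ S S' : Tableau ℓ, ∀ a : Fin ℓ, dual S a.rev = dual S' a.rev → S a = S' a := by
    intro S S' a ha
    rw [dual_apply, dual_apply, Fin.rev_rev] at ha
    have := congrArg Letter.dual ha
    rwa [dual_dual_letter, dual_dual_letter] at this
  -- A free entry is untouched by `sigma`: the encoded parts of the two distributions agree, hence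
  -- so do the counting functions, and the arrow acts at the same position. Otherwise the arrow
  -- shifts one of the counting functions of the image.
  by_cases hfr : IsFree h T c
  · have hpq := N.eq_of_psi N1 fun k hk V => by
      have e1 := hpsi k hk V
      have e2 := (freeSum_update (r := r) hκ hκn hk hc V).1 hfr
      rw [← hT1def] at e2
      omega
    have hfst : ∀ a, pos a ≤ h → (∀ y, (∀ j, j + 1 < n → y ≠ plain (j + 1)) → T a = y → T1 a = y) →
        sigma n ℓ h r T1 a = sigma n ℓ h r T a := fun a ha hS =>
      hE'.fst.eq_of_thresholds hE1'.fst hR.1 hR1.1 ha hS fun j hj => by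
        rw [(hpq j (by omega)).1, (hpq (j + 1) hj).1]
        exact id
    have hsnd : ∀ a, h < pos a →
        (∀ y, (∀ j, j + 1 < n → y ≠ plain (j + 1)) → dual T a.rev = y → dual T1 a.rev = y) →
        sigma n ℓ h r T1 a = sigma n ℓ h r T a := fun a ha hS =>
      hdual _ _ _ (hE'.snd.eq_of_thresholds hE1'.snd hR.2 hR1.2 (hrev a ha) hS fun j hj => by
        rw [(hpq j (by omega)).2, (hpq (j + 1) hj).2]
        exact id)
    have hcc : sigma n ℓ h r T c = T c ∧ sigma n ℓ h r T1 c = T1 c := by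
      rcases hfr with ⟨h1, i, h2⟩ | ⟨h1, i, h2⟩ <;>
        rcases hcase with ⟨h3, h4⟩ | ⟨h3, h4⟩ <;> rw [h2] at h3 <;> cases h3
      · rw [h2, h4]
        exact ⟨(hR.1 c (bar (κ + 1)) h1 fun j _ => by simp).1 h2,
          (hR1.1 c (bar κ) h1 fun j _ => by simp).1 h4⟩
      · refine ⟨hdual _ _ c ?_, hdual _ _ c ?_⟩
        · have h5 := (hR.2 c.rev (bar κ) (hrev c h1) fun j _ => by simp).1
            (by rw [dual_apply, Fin.rev_rev, h2]; rfl)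
          rw [h5, dual_apply, Fin.rev_rev, h2]
          rfl
        · have h5 := (hR1.2 c.rev (bar (κ + 1)) (hrev c h1) fun j _ => by simp).1
            (by rw [dual_apply, Fin.rev_rev, h4]; rfl)
          rw [h5, dual_apply, Fin.rev_rev, h4]
          rfl
    refine ⟨c, by rw [hcc.1, hc], by unfold vloc; rw [hcc.1], ?_⟩
    funext a
    by_cases hac : a = c
    · subst hac
      rw [Function.update_self, hcc.1, hcc.2, hT1c]
    · rw [Function.update_of_ne hac]
      by_cases ha : pos a ≤ h
      · exact hfst a ha fun y _ hy => by rw [hT1a a hac, hy]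
      · exact hsnd a (by omega) fun y _ hy => by
          rw [dual_apply, Fin.rev_rev, hT1a a hac, ← hy, dual_apply, Fin.rev_rev]
  · have hfe : ∀ k, k + 1 < n → ∀ V, freeSum n h r k T1 (· = V) = freeSum n h r k T (· = V) :=
      fun k hk V => (freeSum_update hκ hκn hk hc V).2 hfr
    -- The side conditions combine the jumps of `Phi` at the first maximum and just after it with
    -- the sign of the free part at these locations.
    obtain ⟨hpq, hor⟩ := N.eq_of_psi_arrow N1 hκ hκn (V₀ := vloc n h r κ T c)
      (fun k hk V => by have := hpsi k hk V; have := hfe k hk V; omega)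
      (fun hk h1 h2 => by
        have e1 := (jump_of_firstMaxPos hF').2
        rw [hE'.sum_eq_psi hU.1 hP' hQ' r hk] at e1
        have e2 := freeSum_nonneg_of (r := r) hk hE' hU.2.2.1 hκ h1
        rw [← h2] at e2
        omega)
      (fun hk h1 h2 => by
        have e1 := (jump_of_firstMaxPos hF').1
        rw [hE'.sum_eq_psi hU.1 hP' hQ' r hk] at e1
        have e2 := freeSum_nonpos_of (r := r) hk hE1' hU1.2.2.1 h1
        rw [h2] at e2
        have e3 := hfree κ (vloc n h r κ T c)
        have e4 := hfree1 κ (vloc n h r κ T c)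
        have e5 := hfe κ hk (vloc n h r κ T c)
        omega)
    have hcol1 : ∀ a : Fin ℓ, pos a ≤ h → T1 a = T a ∨ T a = plain κ ∧ T1 a = plain (κ + 1) := by
      intro a ha
      by_cases hac : a = c
      · subst hac
        rcases hcase with h1 | h1
        · exact Or.inr h1
        · exact absurd (Or.inl ⟨ha, _, h1.1⟩) hfr
      · exact Or.inl (hT1a a hac)
    have hcol2 : ∀ a : Fin ℓ, pos a ≤ ℓ - h →
        dual T a = dual T1 a ∨ dual T1 a = plain κ ∧ dual T a = plain (κ + 1) := by
      intro a ha
      have h0 := pos_rev a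
      rw [dual_apply, dual_apply]
      by_cases hac : a.rev = c
      · rw [hac] at h0 ⊢
        rcases hcase with h1 | h1
        · exact absurd (Or.inr ⟨by omega, _, h1.1⟩) hfr
        · rw [h1.1, h1.2]; exact Or.inr ⟨rfl, rfl⟩
      · rw [hT1a _ hac]; exact Or.inl rfl
    rcases hor with ⟨h1, h2, h3⟩ | ⟨h1, h2, h3⟩
    · have hqe : ∀ j < n, Q' j = q' j := fun j hj => by
        by_cases hjκ : j = κ
        · rw [hjκ, h2]
        · exact (hpq j hj hjκ).2.symm
      obtain ⟨c', d1, d2, d3, d4, d5⟩ := hE'.fst.exists_update hh hκ hκn hE1'.fst hR.1 hR1.1 hcol1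
        (fun j hj hjκ => (hpq j hj hjκ).1) h1
      have hsg : sg n κ (sigma n ℓ h r T c') = 1 := by rw [d3]; simp [sg, hκn]
      refine ⟨c', hsg, ?_, ?_⟩
      · have e1 := (vloc_cases (h := h) (r := r) hκn c' (T := sigma n ℓ h r T)).1 hsg
        have e2 := shiftPos_cases h r c'
        rw [d3] at e1
        simp only [reduceCtorEq, true_and, false_and, or_false] at e1
        omega
      · funext a
        by_cases hac : a = c'
        · rw [hac, Function.update_self, d3, d4]
          simp [Letter.next, hκn]
        · rw [Function.update_of_ne hac]
          by_cases ha : pos a ≤ h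
          · exact d5 a ha hac
          · exact (hdual _ _ a (hE1'.snd.eq_of_eq hκ hκn hE'.snd hR1.2 hR.2 hcol2 hqe
              (hrev a (by omega)))).symm
    · have hpe : ∀ j < n, p' j = P' j := fun j hj => by
        by_cases hjκ : j = κ
        · rw [hjκ, h1]
        · exact (hpq j hj hjκ).1
      -- In the dual the arrow from `κ + 1` barred to `κ̄` is reversed and `Q` increases, so the
      -- roles of the images of `T` and `T1` are exchanged.
      obtain ⟨c', d1, d2, d3, d4, d5⟩ := hE1'.snd.exists_update (Nat.sub_le ℓ h) hκ hκn hE'.snd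
        hR1.2 hR.2 hcol2 (fun j hj hjκ => (hpq j hj hjκ).2.symm) (by omega)
      rw [dual_apply] at d3 d4
      have d3' : sigma n ℓ h r T1 c'.rev = bar κ := by
        have := congrArg Letter.dual d3; rwa [dual_dual_letter] at this
      have d4' : sigma n ℓ h r T c'.rev = bar (κ + 1) := by
        have := congrArg Letter.dual d4; rwa [dual_dual_letter] at this
      have hsg : sg n κ (sigma n ℓ h r T c'.rev) = 1 := by rw [d4']; simp [sg, hκn]
      have hrv := pos_rev c'
      refine ⟨c'.rev, hsg, ?_, ?_⟩
      · have e1 := (vloc_cases (h := h) (r := r) hκn c'.rev (T := sigma n ℓ h r T)).1 hsg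
        have e2 := shiftPos_cases h r c'.rev
        rw [d4'] at e1
        simp only [reduceCtorEq, true_and, false_and, false_or] at e1
        omega
      · funext a
        by_cases hac : a = c'.rev
        · rw [hac, Function.update_self, d4', d3']
          simp [Letter.next, hκn]
        · rw [Function.update_of_ne hac]
          by_cases ha : pos a ≤ h
          · exact hE'.fst.eq_of_eq hκ hκn hE1'.fst hR.1 hR1.1 hcol1 hpe ha
          · refine (hdual _ _ a (d5 a.rev (hrev a (by omega)) fun h4 => hac ?_)).symm
            rw [← h4, Fin.rev_rev]

theorem exists_tabF_of_mem {n ℓ h r : ℕ} {k : Fin n} {T : Tableau ℓ} {c : Fin ℓ}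
    (hc : c ∈ candF h r k T) : ∃ T', tabF h r k T = some T' := by
  unfold tabF
  rw [dif_pos ⟨c, hc⟩]
  exact ⟨_, rfl⟩

/-- The arrow found on the image is possible for the shift `r`. Since its result lies in the set for
`r + 1`, it is at the first possible entry, and this is the entry that the structure for `r + 1`
uses. -/
theorem tabF_sigma_of_pos {n ℓ h r : ℕ} (hn4 : 4 ≤ n) (hn : ℓ + 2 + r ≤ n) (hr : 1 ≤ r)
    (hh : h ≤ ℓ) {i : Fin n} (hi : i.val + 1 < n) {T : Tableau ℓ} (hT : T ∈ tableauSet n ℓ h r)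
    (hcr : ∀ T', tabF h r i T = some T' → T' ∈ tableauSet n ℓ h r) :
    tabF h (r + 1) i (sigma n ℓ h r T) = (tabF h r i T).map (sigma n ℓ h r) := by
  have hU := (bijOn_sigma hn hh).mapsTo hT
  have hiff := firstMaxPos_sigma_iff hn hr hh hT hi
  rcases hf : tabF h r i T with _ | T1
  · rw [Option.map_none]
    refine tabF_eq_none (candF_succ_eq_empty hn4 hi hU.1 hU.2.2.2.2.1 fun c hc => ?_)
    obtain ⟨c', hc', -⟩ := exists_mem_candF hn4 hT.1 ((hiff _).1 ((mem_candF hn4 hU.1 c).1 hc).2)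
    obtain ⟨T', hT'⟩ := exists_tabF_of_mem hc'
    rw [hf] at hT'
    cases hT'
  · rw [Option.map_some]
    obtain ⟨c, hc, rfl⟩ := exists_of_tabF_eq_some hf
    obtain ⟨h1, h2⟩ := (mem_candF hn4 hT.1 c).1 hc
    have hT1 := hcr _ hf
    obtain ⟨c', h3, h4, h5⟩ := exists_update_sigma hn hr hh (by omega) hi hT h1 h2 hT1
    have hU1 := (bijOn_sigma hn hh).mapsTo hT1
    rw [h5] at hU1 ⊢
    have hc' : c' ∈ candF h r i (sigma n ℓ h r T) :=
      (mem_candF hn4 hU.1 c').2 ⟨h3, by rw [h4]; exact (hiff _).2 h2⟩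
    exact tabF_succ hn4 hi hU.1 hU.2.2.2.2.1 hc' fun c'' hc'' =>
      le_of_mem_candF hn4 hi hU.1 hc' hc'' hU1.2.2.1 hU1.2.2.2.1 hU1.2.2.2.2.1

theorem monPhi_sigma_of_pos {n ℓ h r : ℕ} (hn4 : 4 ≤ n) (hn : ℓ + 2 + r ≤ n) (hr : 1 ≤ r)
    (hh : h ≤ ℓ) {i : Fin n} (hi : i.val + 1 < n) {T : Tableau ℓ} (hT : T ∈ tableauSet n ℓ h r) :
    monPhi i (mon n h (r + 1) (sigma n ℓ h r T)) = monPhi i (mon n h r T) := by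
  have hU := (bijOn_sigma hn hh).mapsTo hT
  rw [monPhi_succ hn4 hi hU.1 hU.2.2.2.2.1, monPhi_eq_iff hn4 h r i hU.1,
    show Phi n h r (i.val + 1) (sigma n ℓ h r T) = Phi n h r (i.val + 1) T from
      funext (Phi_sigma hn hr hh hT hi)]
  exact (monPhi_eq_iff hn4 h r i hT.1).1 rfl

/-! ### The vertex `n` and the induction on `r` -/

theorem sigma_tau_of_mem {n ℓ h r : ℕ} {T : Tableau ℓ} (hT : T ∈ tableauSet n ℓ h r) :
    sigma n ℓ h r (tau n T) = tau n (sigma n ℓ h r T) := by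
  rcases Nat.eq_zero_or_pos r with rfl | hr
  · rw [sigma_zero hT, sigma_zero (tau_mem hT)]
  · exact sigma_tau hr T

theorem tabF_sigma_of_lt {n ℓ h r : ℕ} (hn4 : 4 ≤ n) (hn : ℓ + 2 + r ≤ n) (hh : h ≤ ℓ)
    (hcr : (tableauCrystal n ℓ h r).IsCrystalOn (CartanMatrix.D n) (tableauSet n ℓ h r))
    {i : Fin n} (hi : i.val + 1 < n) {T : Tableau ℓ} (hT : T ∈ tableauSet n ℓ h r) :
    tabF h (r + 1) i (sigma n ℓ h r T) = (tabF h r i T).map (sigma n ℓ h r) := by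
  have hmem : ∀ T', tabF h r i T = some T' → T' ∈ tableauSet n ℓ h r := hcr.f_mem i T hT
  rcases Nat.eq_zero_or_pos r with rfl | hr
  · have hD : CondD4 n h (0 + 1) T := hT.2.2.2.2.1
    rw [sigma_zero hT]
    rcases hf : tabF h 0 i T with _ | T1
    · refine tabF_eq_none (candF_succ_eq_empty hn4 hi hT.1 hD fun c hc => ?_)
      obtain ⟨T', hT'⟩ := exists_tabF_of_mem hc
      rw [hf] at hT'
      cases hT'
    · have hT1 := sigma_zero (hmem T1 hf)
      obtain ⟨c, hc, hmin, rfl⟩ := exists_of_tabF_zero hf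
      rw [Option.map_some, hT1]
      exact tabF_succ hn4 hi hT.1 hD hc hmin
  · exact tabF_sigma_of_pos hn4 hn hr hh hi hT hmem

theorem monPhi_sigma_of_lt {n ℓ h r : ℕ} (hn4 : 4 ≤ n) (hn : ℓ + 2 + r ≤ n) (hh : h ≤ ℓ)
    {i : Fin n} (hi : i.val + 1 < n) {T : Tableau ℓ} (hT : T ∈ tableauSet n ℓ h r) :
    monPhi i (mon n h (r + 1) (sigma n ℓ h r T)) = monPhi i (mon n h r T) := by
  rcases Nat.eq_zero_or_pos r with rfl | hr
  · rw [sigma_zero hT]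
    exact monPhi_succ hn4 hi hT.1 hT.2.2.2.2.1
  · exact monPhi_sigma_of_pos hn4 hn hr hh hi hT

theorem monPhi_sigma {n ℓ h r : ℕ} (hn4 : 4 ≤ n) (hn : ℓ + 2 + r ≤ n) (hh : h ≤ ℓ) (i : Fin n)
    {T : Tableau ℓ} (hT : T ∈ tableauSet n ℓ h r) :
    monPhi i (mon n h (r + 1) (sigma n ℓ h r T)) = monPhi i (mon n h r T) := by
  by_cases hi : i.val + 1 < n
  · exact monPhi_sigma_of_lt hn4 hn hh hi hT
  · have hj : (⟨n - 2, by omega⟩ : Fin n).val + 2 = n := by change n - 2 + 2 = n; omega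
    have hi' : i.val + 1 = n := by omega
    rw [← monPhi_tau hn4 hj hi' hT.1, ← monPhi_tau hn4 hj hi' ((bijOn_sigma hn hh).mapsTo hT).1,
      ← sigma_tau_of_mem hT]
    exact monPhi_sigma_of_lt hn4 hn hh (by omega) (tau_mem hT)

theorem tabF_sigma {n ℓ h r : ℕ} (hn4 : 4 ≤ n) (hn : ℓ + 2 + r ≤ n) (hh : h ≤ ℓ)
    (hcr : (tableauCrystal n ℓ h r).IsCrystalOn (CartanMatrix.D n) (tableauSet n ℓ h r))
    (i : Fin n) {T : Tableau ℓ} (hT : T ∈ tableauSet n ℓ h r) :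
    tabF h (r + 1) i (sigma n ℓ h r T) = (tabF h r i T).map (sigma n ℓ h r) := by
  by_cases hi : i.val + 1 < n
  · exact tabF_sigma_of_lt hn4 hn hh hcr hi hT
  · have hj : (⟨n - 2, by omega⟩ : Fin n).val + 2 = n := by change n - 2 + 2 = n; omega
    have hi' : i.val + 1 = n := by omega
    have h1 := tabF_sigma_of_lt hn4 hn hh hcr (i := ⟨n - 2, by omega⟩) (by omega) (tau_mem hT)
    rw [sigma_tau_of_mem hT, tabF_tau hn4 hj hi' ((bijOn_sigma hn hh).mapsTo hT).1,
      tabF_tau hn4 hj hi' hT.1, Option.map_map] at h1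
    have hmem : ∀ T', tabF h r i T = some T' → T' ∈ tableauSet n ℓ h r := hcr.f_mem i T hT
    rcases hf : tabF h r i T with _ | T1
    · rw [hf] at h1
      simpa using h1
    · rw [hf, Option.map_some, Function.comp_apply, sigma_tau_of_mem (hmem T1 hf)] at h1
      obtain ⟨X, hX, hX'⟩ := Option.map_eq_some_iff.1 h1
      rw [hX, ← tau_tau n X, hX', tau_tau, Option.map_some]

theorem isIsoOn_sigma {n ℓ h r : ℕ} (hn4 : 4 ≤ n) (hn : ℓ + 2 + r ≤ n)
    (hcr : ∀ h ≤ ℓ,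
      (tableauCrystal n ℓ h r).IsCrystalOn (CartanMatrix.D n) (tableauSet n ℓ h r))
    (hh : h ≤ ℓ) :
    CrystalData.IsIsoOn (tableauCrystal n ℓ h r) (tableauSet n ℓ h r)
      (tableauCrystal n ℓ h (r + 1)) (tableauSet n ℓ h (r + 1)) (sigma n ℓ h r) :=
  isIsoOn_sigma_of hn4 (fun _ h1 => bijOn_sigma hn h1)
    (fun _ h1 _ hT i => monPhi_sigma hn4 hn h1 i hT)
    (fun _ h1 _ hT i => tabF_sigma hn4 hn h1 (hcr _ h1) i hT) hh

/-- The induction runs over all `h` at once: the isomorphism needs stability of the set for `r`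
under `f`, and its statement for `e` uses the set for `ℓ - h`. -/
theorem isCrystalOn_tableauSet {n ℓ r : ℕ} (hn4 : 4 ≤ n) (hn : ℓ + 1 + r ≤ n) :
    ∀ h ≤ ℓ, (tableauCrystal n ℓ h r).IsCrystalOn (CartanMatrix.D n) (tableauSet n ℓ h r) := by
  induction r with
  | zero => exact fun h hh => isCrystalOn_zero hn4 hh
  | succ r ih =>
    have hcr := ih (by omega)
    exact fun h hh => (hcr h hh).of_isIsoOn (isIsoOn_sigma hn4 (by omega) hcr hh)

end TypeD

theorem mainTheorem8 (n ℓ h r : ℕ) (hn : 4 ≤ n) (hℓ : 1 ≤ ℓ) (hℓn : ℓ ≤ n - 2) (hh : h ≤ ℓ)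
    (hr : r + 1 ≤ n - ℓ - 1) :
    (TypeD.tableauCrystal n ℓ h r).IsCrystalOn (CartanMatrix.D n) (TypeD.tableauSet n ℓ h r) ∧
    (TypeD.tableauCrystal n ℓ h (r + 1)).IsCrystalOn (CartanMatrix.D n)
      (TypeD.tableauSet n ℓ h (r + 1)) ∧
    CrystalData.IsIsoOn (TypeD.tableauCrystal n ℓ h r) (TypeD.tableauSet n ℓ h r)
      (TypeD.tableauCrystal n ℓ h (r + 1)) (TypeD.tableauSet n ℓ h (r + 1))
      (TypeD.sigma n ℓ h r) ∧
    Set.InvOn (TypeD.sigmaInv n ℓ h (r + 1)) (TypeD.sigma n ℓ h r)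
      (TypeD.tableauSet n ℓ h r) (TypeD.tableauSet n ℓ h (r + 1)) := by
  have hcr := TypeD.isCrystalOn_tableauSet (ℓ := ℓ) (r := r) hn (by omega)
  have hiso := TypeD.isIsoOn_sigma hn (by omega) hcr hh
  exact ⟨hcr h hh, (hcr h hh).of_isIsoOn hiso, hiso,
    (TypeD.sigma_mapsTo_invOn (by omega) hh).2.2⟩
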